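/- Let $q\in\mathbb C$ be nonzero and not a root of unity, and let $t\in\mathbb C$ satisfy $t^2=-q$ (i.e. $t=\mathbf i\sqrt q$). Let $\mathcal U=U_q(osp(1,2))$ be the $\mathbb C$-algebra with generators $k^{\pm1},e,f$ and relations $$kk^{-1}=k^{-1}k=1,\quad kek^{-1}=qe,\quad kfk^{-1}=q^{-1}f,\quad ef+fe=\frac{k-k^{-1}}{q-q^{-1}},$$ with counit $\varepsilon(k^{\pm1})=1$, $\varepsilon(e)=\varepsilon(f)=0$. Let $\mathcal A=\mathbb C_q[osp(1,2)]$ be the $\mathbb Z_2$-graded algebra with even generators $a,d,\sigma$ and odd generators $b,c$ and relations $$ab=tba,\ ac=tca,\ bc=-cb,\ bd=-tdb,\ cd=-tdc,\ ad-da=(t^{-1}-t)bc,\ ad+tbc=\sigma,\ \sigma^2=1,$$ with comultiplication $\Delta$ and counit $\varepsilon$ given by the matrix $\begin{pmatrix}a&b&0\\c&d&0\\0&0&\sigma\end{pmatrix}$; here $\Delta:\mathcal A\to\mathcal A\otimes\mathcal A$ is an algebra homomorphism for the product $(u\otimes v)(u'\otimes v')=(-1)^{p(v)p(u')}uu'\otimes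 vv'$. Elements of $\mathcal U$ are functionals on $\mathcal A$ through the pairing with $(xy)(u)=\sum x(u_1)y(u_2)$ in which $k^{\pm1}$ are the algebra homomorphisms $a\mapsto t^{\pm1}$, $d\mapsto -t^{\mp1}$, $\sigma\mapsto-1$, $b,c\mapsto0$; $e$ and $f$ vanish on $1$ and on the generators except $e(b)=\frac{t-t^{-1}}{q-q^{-1}}$ and $f(c)=1$; and $e(uv)=e(u)\varepsilon(v)+k(u)e(v)$, $f(uv)=f(u)k^{-1}(v)+\varepsilon(u)f(v)$. Put $R_x(u)=\sum x(u_1)u_2$ and $L_x(u)=\sum(-1)^{p(x)p(u_1)}x(u_2)u_1$. For $x,y\in\mathcal U$, an $(x,y)$-spherical function is an element $u\in\mathcal A$ with $R_x(u)=\varepsilon(x)u$ and $L_y(u)=\varepsilon(y)u$. For $n\in\mathbb Z_{\ge0}$ let $V_n\sigma^n$ be the left subcomodule of $\mathcal A$ spanned by $a^{2n-j}c^j\sigma^n$ ($0\le j\le 2n$), and let $M_n\sigma^n\subset\mathcal A$ be the span of its matrix elements. For $\alpha,\beta\in\mathbb C$ let $x_{\alpha\beta}=\alpha e+\beta fk$.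 Let $\alpha,\beta,\alpha',\beta'\in\mathbb C$ be nonzero with $(\alpha')^{-1}\beta'\alpha\beta^{-1}=1$, and let $$\rho_1=\Big(a^2-(\alpha')^{-1}\beta't(1-q)\,b^2+\alpha\beta^{-1}t(1-q)^{-1}\,c^2-\alpha\beta^{-1}(\alpha')^{-1}\beta'q\,d^2\Big)\sigma .$$ Then the $(x_{\alpha\beta},x_{\alpha'\beta'})$-spherical functions in $M_1\sigma$ are exactly the constant multiples of $\rho_1$, and for every $n\ge0$ the $(x_{\alpha\beta},x_{\alpha'\beta'})$-spherical functions in $M_n\sigma^n$ are exactly the constant multiples of the nonzero element $$p_n\big(\tfrac{1}{2t}\rho_1;\,t,-t,\mathbf it,-\mathbf it\,|\,q\big),$$ where $p_n$ is the Askey–Wilson polynomial, i.e. the polynomial in $\cos\theta$ $$p_n(\cos\theta;a,b,c,d|q)=a^{-n}(ab,ac,ad;q)_n\;{}_4\phi_3\!\left[\begin{matrix}q^{-n},q^{n-1}abcd,ae^{\mathbf i\theta},ae^{-\mathbf i\theta}\\ab,ac,ad\end{matrix};q,q\right].$$ -/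

import Mathlib

open scoped TensorProduct DirectSum

set_option linter.unusedSimpArgs false

noncomputable section

/-- The deformation parameter `q`, nonzero and not a root of unity, together with a square root
`t = i√q` of `-q`. -/
structure QuantumParameter where
  q : ℂ
  t : ℂ
  q_ne_zero : q ≠ 0
  q_pow_ne_one : ∀ n : ℕ, 0 < n → q ^ n ≠ 1
  t_sq : t ^ 2 = -q

namespace QuantumOSp

variable (P : QuantumParameter)

lemma t_ne_zero : P.t ≠ 0 := by
  intro h
  have := P.t_sq
  rw [h] at this
  exact P.q_ne_zero (by simpa using this.symm)

/-! ### The quantum supergroup -/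

/-- The generators of the quantum supergroup. -/
inductive AGen
  | a | b | c | d | σ

open AGen in
/-- The defining relations of the quantum supergroup. -/
inductive ARel : FreeAlgebra ℂ AGen → FreeAlgebra ℂ AGen → Prop
  | ab : ARel (.ι ℂ a * .ι ℂ b) (P.t • (.ι ℂ b * .ι ℂ a))
  | ac : ARel (.ι ℂ a * .ι ℂ c) (P.t • (.ι ℂ c * .ι ℂ a))
  | bc : ARel (.ι ℂ b * .ι ℂ c) (-(.ι ℂ c * .ι ℂ b))
  | bd : ARel (.ι ℂ b * .ι ℂ d) (-P.t • (.ι ℂ d * .ι ℂ b))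
  | cd : ARel (.ι ℂ c * .ι ℂ d) (-P.t • (.ι ℂ d * .ι ℂ c))
  | ad_da : ARel (.ι ℂ a * .ι ℂ d - .ι ℂ d * .ι ℂ a) ((P.t⁻¹ - P.t) • (.ι ℂ b * .ι ℂ c))
  | ad_bc : ARel (.ι ℂ a * .ι ℂ d + P.t • (.ι ℂ b * .ι ℂ c)) (.ι ℂ σ)
  | σσ : ARel (.ι ℂ σ ^ 2) 1

/-- The quantum supergroup `ℂ_q[osp(1,2)]` as an algebra. -/
def A : Type := RingQuot (ARel P)

instance : Ring (A P) := inferInstanceAs (Ring (RingQuot (ARel P)))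
instance : Algebra ℂ (A P) := inferInstanceAs (Algebra ℂ (RingQuot (ARel P)))

/-- The quotient map. -/
def Amk : FreeAlgebra ℂ AGen →ₐ[ℂ] A P := RingQuot.mkAlgHom ℂ (ARel P)

lemma Amk_surjective : Function.Surjective (Amk P) := RingQuot.mkAlgHom_surjective ℂ (ARel P)

variable {P} in
lemma Amk_rel {x y} (h : ARel P x y) : Amk P x = Amk P y := RingQuot.mkAlgHom_rel ℂ h

/-- The generators, as elements of the quantum supergroup. -/
def gen (g : AGen) : A P := Amk P (.ι ℂ g)

/-- The relations of the quantum supergroup for a family of elements of an algebra. -/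
structure IsARep {B : Type*} [Ring B] [Algebra ℂ B] (a b c d σ : B) : Prop where
  ab : a * b = P.t • (b * a)
  ac : a * c = P.t • (c * a)
  bc : b * c = -(c * b)
  bd : b * d = -P.t • (d * b)
  cd : c * d = -P.t • (d * c)
  ad_da : a * d - d * a = (P.t⁻¹ - P.t) • (b * c)
  ad_bc : a * d + P.t • (b * c) = σ
  σσ : σ ^ 2 = 1

lemma gen_rep : IsARep P (gen P .a) (gen P .b) (gen P .c) (gen P .d) (gen P .σ) := by
  constructor
  · simpa [gen] using Amk_rel (ARel.ab (P := P))
  · simpa [gen] using Amk_rel (ARel.ac (P := P))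
  · simpa [gen] using Amk_rel (ARel.bc (P := P))
  · simpa [gen] using Amk_rel (ARel.bd (P := P))
  · simpa [gen] using Amk_rel (ARel.cd (P := P))
  · simpa [gen] using Amk_rel (ARel.ad_da (P := P))
  · simpa [gen] using Amk_rel (ARel.ad_bc (P := P))
  · simpa [gen] using Amk_rel (ARel.σσ (P := P))

section lift
variable {P} {B : Type*} [Ring B] [Algebra ℂ B] {a b c d σ : B}

/-- The universal property of the quantum supergroup. -/
def liftA (h : IsARep P a b c d σ) : A P →ₐ[ℂ] B :=
  RingQuot.liftAlgHom ℂ ⟨FreeAlgebra.lift ℂ (fun g => AGen.rec a b c d σ g), by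
    rintro _ _ (_ | _ | _ | _ | _ | _ | _ | _)
    · simpa using h.ab
    · simpa using h.ac
    · simpa using h.bc
    · simpa using h.bd
    · simpa using h.cd
    · simpa using h.ad_da
    · simpa using h.ad_bc
    · simpa using h.σσ⟩

variable (h : IsARep P a b c d σ)

@[simp] lemma liftA_a : liftA h (gen P .a) = a := by
  simp only [liftA, gen]; exact (RingQuot.liftAlgHom_mkAlgHom_apply ..).trans (by simp)
@[simp] lemma liftA_b : liftA h (gen P .b) = b := by
  simp only [liftA, gen]; exact (RingQuot.liftAlgHom_mkAlgHom_apply ..).trans (by simp)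
@[simp] lemma liftA_c : liftA h (gen P .c) = c := by
  simp only [liftA, gen]; exact (RingQuot.liftAlgHom_mkAlgHom_apply ..).trans (by simp)
@[simp] lemma liftA_d : liftA h (gen P .d) = d := by
  simp only [liftA, gen]; exact (RingQuot.liftAlgHom_mkAlgHom_apply ..).trans (by simp)
@[simp] lemma liftA_σ : liftA h (gen P .σ) = σ := by
  simp only [liftA, gen]; exact (RingQuot.liftAlgHom_mkAlgHom_apply ..).trans (by simp)

end lift

variable {P} in
/-- Induction: a property that holds for `1` and is stable under linear combinations and left
multiplication by generators holds everywhere. -/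
lemma A_induction {p : A P → Prop} (one : p 1) (add : ∀ x y, p x → p y → p (x + y))
    (smul : ∀ (r : ℂ) x, p x → p (r • x)) (mul : ∀ g x, p x → p (gen P g * x)) (x : A P) :
    p x := by
  have key : ∀ (y : FreeAlgebra ℂ AGen) (z : A P), p z → p (Amk P y * z) := by
    intro y
    induction y using FreeAlgebra.induction with
    | grade0 r =>
      intro z hz
      rw [AlgHom.commutes, ← Algebra.smul_def]
      exact smul r z hz
    | grade1 g => intro z hz; exact mul g z hz
    | mul u v hu hv =>
      intro z hz
      rw [map_mul, mul_assoc]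
      exact hu _ (hv _ hz)
    | add u v hu hv =>
      intro z hz
      rw [map_add, add_mul]
      exact add _ _ (hu _ hz) (hv _ hz)
  obtain ⟨y, rfl⟩ := Amk_surjective P x
  simpa using key y 1 one

/-! ### The `ℤ/2`-grading -/

lemma parity_rep : IsARep P (gen P .a) (-gen P .b) (-gen P .c) (gen P .d) (gen P .σ) := by
  have h := gen_rep P
  constructor
  · simp [h.ab]
  · simp [h.ac]
  · simp [h.bc]
  · simp [h.bd]
  · simp [h.cd]
  · simp [h.ad_da]
  · simp [← h.ad_bc]
  · exact h.σσ

/-- The parity automorphism `u ↦ (-1)^{p(u)} u`, where `a, d, σ` are even and `b, c` are odd. -/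
def parity : A P →ₐ[ℂ] A P := liftA (parity_rep P)

@[simp] lemma parity_a : parity P (gen P .a) = gen P .a := liftA_a _
@[simp] lemma parity_b : parity P (gen P .b) = -gen P .b := liftA_b _
@[simp] lemma parity_c : parity P (gen P .c) = -gen P .c := liftA_c _
@[simp] lemma parity_d : parity P (gen P .d) = gen P .d := liftA_d _
@[simp] lemma parity_σ : parity P (gen P .σ) = gen P .σ := liftA_σ _

@[simp] lemma parity_parity (x : A P) : parity P (parity P x) = x := by
  induction x using A_induction with
  | one => simp
  | add x y hx hy => simp [hx, hy]
  | smul r x hx => simp [hx]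
  | mul g x hx => cases g <;> simp [hx]

/-- The homogeneous components of the `ℤ/2`-grading in which `a, d, σ` are even and `b, c` are odd:
the eigenspaces of the parity automorphism. -/
def grading (i : ZMod 2) : Submodule ℂ (A P) :=
  LinearMap.eqLocus (parity P).toLinearMap (((-1 : ℂ) ^ i.val) • LinearMap.id)

lemma mem_grading {i : ZMod 2} {x : A P} :
    x ∈ grading P i ↔ parity P x = ((-1 : ℂ) ^ i.val) • x := Iff.rfl

lemma mem_zero {x : A P} : x ∈ grading P 0 ↔ parity P x = x := by
  rw [mem_grading]; simp

lemma mem_one {x : A P} : x ∈ grading P 1 ↔ parity P x = -x := by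
  rw [mem_grading]; simp [ZMod.val_one]

instance : SetLike.GradedMonoid (grading P) where
  one_mem := by simp [mem_zero]
  mul_mem i j x y hx hy := by
    rw [mem_grading] at *
    rw [map_mul, hx, hy, smul_mul_smul_comm, ← pow_add, ZMod.val_add, ← neg_one_pow_eq_pow_mod_two]

lemma even_mem (x : A P) : (2⁻¹ : ℂ) • (x + parity P x) ∈ grading P 0 := by
  rw [mem_zero]; simp [add_comm]

lemma odd_mem (x : A P) : (2⁻¹ : ℂ) • (x - parity P x) ∈ grading P 1 := by
  rw [mem_one]; simp [← smul_neg]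

/-- The projection onto the even part. -/
def evenPart : A P →ₗ[ℂ] grading P 0 :=
  LinearMap.codRestrict (grading P 0) ((2⁻¹ : ℂ) • (LinearMap.id + (parity P).toLinearMap))
    (fun x => by simpa using even_mem P x)

/-- The projection onto the odd part. -/
def oddPart : A P →ₗ[ℂ] grading P 1 :=
  LinearMap.codRestrict (grading P 1) ((2⁻¹ : ℂ) • (LinearMap.id - (parity P).toLinearMap))
    (fun x => by simpa using odd_mem P x)

lemma coe_evenPart (x : A P) : (evenPart P x : A P) = (2⁻¹ : ℂ) • (x + parity P x) := rfl
lemma coe_oddPart (x : A P) : (oddPart P x : A P) = (2⁻¹ : ℂ) • (x - parity P x) := rfl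

lemma zmod_two_cases (i : ZMod 2) : i = 0 ∨ i = 1 := by revert i; decide

instance : GradedAlgebra (grading P) where
  toDecomposition := DirectSum.Decomposition.ofLinearMap (grading P)
    (DirectSum.lof ℂ _ (fun i => grading P i) 0 ∘ₗ evenPart P +
      DirectSum.lof ℂ _ (fun i => grading P i) 1 ∘ₗ oddPart P)
    (by
      ext x
      simp only [LinearMap.comp_apply, LinearMap.add_apply, map_add, DirectSum.coeLinearMap_lof,
        coe_evenPart, coe_oddPart, LinearMap.id_apply]
      module)
    (by
      refine DirectSum.linearMap_ext ℂ fun i => LinearMap.ext fun ⟨x, hx⟩ => ?_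
      simp only [LinearMap.comp_apply, LinearMap.add_apply, DirectSum.coeLinearMap_lof,
        LinearMap.id_apply]
      obtain rfl | rfl := zmod_two_cases i
      · have hx' := (mem_zero P).1 hx
        rw [show evenPart P x = ⟨x, hx⟩ from Subtype.ext (by rw [coe_evenPart, hx']; module),
          show oddPart P x = 0 from Subtype.ext (by rw [coe_oddPart, hx']; simp)]
        simp
      · have hx' := (mem_one P).1 hx
        rw [show evenPart P x = 0 from Subtype.ext (by rw [coe_evenPart, hx']; simp),
          show oddPart P x = ⟨x, hx⟩ from Subtype.ext (by rw [coe_oddPart, hx']; module)]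
        simp)

/-! ### The comultiplication -/


/-- The `ℤ/2`-graded tensor product algebra, with
`(u ⊗ v) (u' ⊗ v') = (-1)^{p(v) p(u')} u u' ⊗ v v'`. -/
abbrev AA : Type := GradedTensorProduct ℂ (grading P) (grading P)

variable {P} in
lemma gadd_left (x x' y : A P) : ((x + x') ᵍ⊗ₜ[ℂ] y : AA P) = x ᵍ⊗ₜ[ℂ] y + x' ᵍ⊗ₜ[ℂ] y :=
  TensorProduct.add_tmul x x' y

variable {P} in
lemma gadd_right (x y y' : A P) : (x ᵍ⊗ₜ[ℂ] (y + y') : AA P) = x ᵍ⊗ₜ[ℂ] y + x ᵍ⊗ₜ[ℂ] y' :=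
  TensorProduct.tmul_add x y y'

variable {P} in
lemma gsub_left (x x' y : A P) : ((x - x') ᵍ⊗ₜ[ℂ] y : AA P) = x ᵍ⊗ₜ[ℂ] y - x' ᵍ⊗ₜ[ℂ] y :=
  TensorProduct.sub_tmul x x' y

variable {P} in
lemma gsub_right (x y y' : A P) : (x ᵍ⊗ₜ[ℂ] (y - y') : AA P) = x ᵍ⊗ₜ[ℂ] y - x ᵍ⊗ₜ[ℂ] y' :=
  TensorProduct.tmul_sub x y y'

variable {P} in
lemma gneg_left (x y : A P) : ((-x) ᵍ⊗ₜ[ℂ] y : AA P) = -x ᵍ⊗ₜ[ℂ] y :=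
  TensorProduct.neg_tmul x y

variable {P} in
lemma gneg_right (x y : A P) : (x ᵍ⊗ₜ[ℂ] (-y) : AA P) = -x ᵍ⊗ₜ[ℂ] y :=
  TensorProduct.tmul_neg x y

variable {P} in
lemma gsmul_left (r : ℂ) (x y : A P) : ((r • x) ᵍ⊗ₜ[ℂ] y : AA P) = r • x ᵍ⊗ₜ[ℂ] y := rfl

variable {P} in
lemma gsmul_right (r : ℂ) (x y : A P) : (x ᵍ⊗ₜ[ℂ] (r • y) : AA P) = r • x ᵍ⊗ₜ[ℂ] y :=
  TensorProduct.tmul_smul r x y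

variable {P} in
lemma tmul_even {y : A P} (hy : parity P y = y) (x x' y' : A P) :
    (x ᵍ⊗ₜ[ℂ] y * x' ᵍ⊗ₜ[ℂ] y' : AA P) = (x * x') ᵍ⊗ₜ[ℂ] (y * y') := by
  have key : ∀ i, ∀ z ∈ grading P i,
      (x ᵍ⊗ₜ[ℂ] y * z ᵍ⊗ₜ[ℂ] y' : AA P) = (x * z) ᵍ⊗ₜ[ℂ] (y * y') := fun i z hz =>
    GradedTensorProduct.tmul_zero_coe_mul_coe_tmul (grading P) (grading P) x
      ⟨y, (mem_zero P).2 hy⟩ ⟨z, hz⟩ y'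
  have h0 := key 0 _ (even_mem P x')
  have h1 := key 1 _ (odd_mem P x')
  have : x' = (2⁻¹ : ℂ) • (x' + parity P x') + (2⁻¹ : ℂ) • (x' - parity P x') := by module
  rw [this, gadd_left, mul_add, h0, h1, mul_add, gadd_left]

variable {P} in
lemma tmul_odd {y : A P} (hy : parity P y = -y) (x x' y' : A P) :
    (x ᵍ⊗ₜ[ℂ] y * x' ᵍ⊗ₜ[ℂ] y' : AA P) = (x * parity P x') ᵍ⊗ₜ[ℂ] (y * y') := by
  have h0 := GradedTensorProduct.tmul_coe_mul_coe_tmul (grading P) (grading P) x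
      ⟨y, (mem_one P).2 hy⟩ ⟨_, even_mem P x'⟩ y'
  have h1 := GradedTensorProduct.tmul_coe_mul_coe_tmul (grading P) (grading P) x
      ⟨y, (mem_one P).2 hy⟩ ⟨_, odd_mem P x'⟩ y'
  simp only [mul_zero, uzpow_zero, one_smul, mul_one, uzpow_one, Units.neg_smul] at h0 h1
  have e1 : x' = (2⁻¹ : ℂ) • (x' + parity P x') + (2⁻¹ : ℂ) • (x' - parity P x') := by module
  have e2 : parity P x' = (2⁻¹ : ℂ) • (x' + parity P x') - (2⁻¹ : ℂ) • (x' - parity P x') := by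
    module
  conv_lhs => rw [e1]
  conv_rhs => rw [e2]
  rw [gadd_left, mul_add, h0, h1, mul_sub, gsub_left]
  abel

local notation "ga" => gen P AGen.a
local notation "gb" => gen P AGen.b
local notation "gc" => gen P AGen.c
local notation "gd" => gen P AGen.d
local notation "gσ" => gen P AGen.σ

lemma comul_rep : IsARep P (ga ᵍ⊗ₜ[ℂ] ga + gb ᵍ⊗ₜ[ℂ] gc : AA P) (ga ᵍ⊗ₜ[ℂ] gb + gb ᵍ⊗ₜ[ℂ] gd)
    (gc ᵍ⊗ₜ[ℂ] ga + gd ᵍ⊗ₜ[ℂ] gc) (gc ᵍ⊗ₜ[ℂ] gb + gd ᵍ⊗ₜ[ℂ] gd) (gσ ᵍ⊗ₜ[ℂ] gσ) := by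
  have h := gen_rep P
  have ht := t_ne_zero P
  have ba : gb * ga = P.t⁻¹ • (ga * gb) := by rw [h.ab, smul_smul, inv_mul_cancel₀ ht, one_smul]
  have ca : gc * ga = P.t⁻¹ • (ga * gc) := by rw [h.ac, smul_smul, inv_mul_cancel₀ ht, one_smul]
  have cb : gc * gb = -(gb * gc) := by rw [h.bc, neg_neg]
  have db : gd * gb = -P.t⁻¹ • (gb * gd) := by
    rw [h.bd, smul_smul, neg_mul_neg, inv_mul_cancel₀ ht, one_smul]
  have dc : gd * gc = -P.t⁻¹ • (gc * gd) := by
    rw [h.cd, smul_smul, neg_mul_neg, inv_mul_cancel₀ ht, one_smul]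
  have da : gd * ga = ga * gd - (P.t⁻¹ - P.t) • (gb * gc) := by rw [← h.ad_da, sub_sub_cancel]
  constructor
  case σσ =>
    rw [pow_two, tmul_even (parity_σ P), ← pow_two, h.σσ]
    rfl
  all_goals
    simp only [add_mul, mul_add, tmul_even (parity_a P), tmul_odd (parity_b P),
      tmul_odd (parity_c P), tmul_even (parity_d P), parity_a, parity_b,
      parity_c, parity_d, ← h.ad_bc, mul_neg, gneg_left, ba, ca, cb, db, dc, da, gadd_left,
      gadd_right, gsub_left, gsub_right, gneg_right, gsmul_left, gsmul_right]
    match_scalars <;> field_simp <;> ring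

/-- The comultiplication, as a homomorphism to the graded tensor product algebra. -/
def comulHom : A P →ₐ[ℂ] AA P := liftA (comul_rep P)

lemma counit_rep : IsARep P (1 : ℂ) 0 0 1 1 := by constructor <;> simp

/-- The counit. -/
def counitHom : A P →ₐ[ℂ] ℂ := liftA (counit_rep P)

@[simp] lemma counit_a : counitHom P ga = 1 := liftA_a _
@[simp] lemma counit_b : counitHom P gb = 0 := liftA_b _
@[simp] lemma counit_c : counitHom P gc = 0 := liftA_c _
@[simp] lemma counit_d : counitHom P gd = 1 := liftA_d _
@[simp] lemma counit_σ : counitHom P gσ = 1 := liftA_σ _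

lemma counit_parity (x : A P) : counitHom P (parity P x) = counitHom P x := by
  induction x using A_induction with
  | one => simp
  | add x y hx hy => simp [hx, hy]
  | smul r x hx => simp [hx]
  | mul g x hx => cases g <;> simp [hx]

instance : CoalgebraStruct ℂ (A P) where
  comul := (GradedTensorProduct.of ℂ (grading P) (grading P)).symm.toLinearMap ∘ₗ
    (comulHom P).toLinearMap
  counit := (counitHom P).toLinearMap

lemma of_comul (x : A P) :
    GradedTensorProduct.of ℂ (grading P) (grading P) (Coalgebra.comul x) = comulHom P x := rfl

lemma counit_eq (x : A P) : Coalgebra.counit (R := ℂ) x = counitHom P x := rfl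

/-- Left multiplication by a generator. -/
abbrev lm (g : AGen) : A P →ₗ[ℂ] A P := LinearMap.mulLeft ℂ (gen P g)

/-- The parity automorphism as a linear map. -/
abbrev τ : A P →ₗ[ℂ] A P := (parity P).toLinearMap

variable {P} in
lemma of_symm_even {y : A P} (hy : parity P y = y) (x : A P) (X : A P ⊗[ℂ] A P) :
    (x ᵍ⊗ₜ[ℂ] y * GradedTensorProduct.of ℂ (grading P) (grading P) X : AA P) =
      GradedTensorProduct.of ℂ (grading P) (grading P)
        (TensorProduct.map (LinearMap.mulLeft ℂ x) (LinearMap.mulLeft ℂ y) X) := by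
  induction X using TensorProduct.induction_on with
  | zero => simp
  | tmul x' y' => exact tmul_even hy x x' y'
  | add X Y hX hY => rw [map_add, mul_add, hX, hY, map_add, map_add]

variable {P} in
lemma of_symm_odd {y : A P} (hy : parity P y = -y) (x : A P) (X : A P ⊗[ℂ] A P) :
    (x ᵍ⊗ₜ[ℂ] y * GradedTensorProduct.of ℂ (grading P) (grading P) X : AA P) =
      GradedTensorProduct.of ℂ (grading P) (grading P)
        (TensorProduct.map (LinearMap.mulLeft ℂ x ∘ₗ τ P) (LinearMap.mulLeft ℂ y) X) := by
  induction X using TensorProduct.induction_on with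
  | zero => simp
  | tmul x' y' => exact tmul_odd hy x x' y'
  | add X Y hX hY => rw [map_add, mul_add, hX, hY, map_add, map_add]

open AGen TensorProduct

lemma comul_a : Coalgebra.comul ∘ₗ lm P a =
    (map (lm P a) (lm P a) + map (lm P b ∘ₗ τ P) (lm P c)) ∘ₗ Coalgebra.comul := by
  ext x
  apply (GradedTensorProduct.of ℂ (grading P) (grading P)).injective
  simp only [LinearMap.comp_apply, LinearMap.mulLeft_apply, LinearMap.add_apply, map_add]
  rw [← of_symm_even (parity_a P), ← of_symm_odd (parity_c P), of_comul, of_comul, map_mul,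
    ← add_mul, comulHom, liftA_a]

lemma comul_b : Coalgebra.comul ∘ₗ lm P b =
    (map (lm P a ∘ₗ τ P) (lm P b) + map (lm P b) (lm P d)) ∘ₗ Coalgebra.comul := by
  ext x
  apply (GradedTensorProduct.of ℂ (grading P) (grading P)).injective
  simp only [LinearMap.comp_apply, LinearMap.mulLeft_apply, LinearMap.add_apply, map_add]
  rw [← of_symm_even (parity_d P), ← of_symm_odd (parity_b P), of_comul, of_comul, map_mul,
    ← add_mul, comulHom, liftA_b]

lemma comul_c : Coalgebra.comul ∘ₗ lm P c =
    (map (lm P c) (lm P a) + map (lm P d ∘ₗ τ P) (lm P c)) ∘ₗ Coalgebra.comul := by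
  ext x
  apply (GradedTensorProduct.of ℂ (grading P) (grading P)).injective
  simp only [LinearMap.comp_apply, LinearMap.mulLeft_apply, LinearMap.add_apply, map_add]
  rw [← of_symm_even (parity_a P), ← of_symm_odd (parity_c P), of_comul, of_comul, map_mul,
    ← add_mul, comulHom, liftA_c]

lemma comul_d : Coalgebra.comul ∘ₗ lm P d =
    (map (lm P c ∘ₗ τ P) (lm P b) + map (lm P d) (lm P d)) ∘ₗ Coalgebra.comul := by
  ext x
  apply (GradedTensorProduct.of ℂ (grading P) (grading P)).injective
  simp only [LinearMap.comp_apply, LinearMap.mulLeft_apply, LinearMap.add_apply, map_add]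
  rw [← of_symm_even (parity_d P), ← of_symm_odd (parity_b P), of_comul, of_comul, map_mul,
    ← add_mul, comulHom, liftA_d]

lemma comul_σ : Coalgebra.comul ∘ₗ lm P σ = map (lm P σ) (lm P σ) ∘ₗ Coalgebra.comul := by
  ext x
  apply (GradedTensorProduct.of ℂ (grading P) (grading P)).injective
  simp only [LinearMap.comp_apply, LinearMap.mulLeft_apply]
  rw [← of_symm_even (parity_σ P), of_comul, of_comul, map_mul, comulHom, liftA_σ]

lemma comul_one : Coalgebra.comul (R := ℂ) (1 : A P) = 1 ⊗ₜ 1 := by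
  apply (GradedTensorProduct.of ℂ (grading P) (grading P)).injective
  rw [of_comul, map_one]
  rfl

lemma τ_a : τ P ∘ₗ lm P a = lm P a ∘ₗ τ P := by ext; simp
lemma τ_b : τ P ∘ₗ lm P b = -(lm P b ∘ₗ τ P) := by ext; simp
lemma τ_c : τ P ∘ₗ lm P c = -(lm P c ∘ₗ τ P) := by ext; simp
lemma τ_d : τ P ∘ₗ lm P d = lm P d ∘ₗ τ P := by ext; simp
lemma τ_σ : τ P ∘ₗ lm P σ = lm P σ ∘ₗ τ P := by ext; simp

/-- Extensionality for linear maps by left multiplication by generators. -/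
lemma gen_ext {V : Type*} [AddCommGroup V] [Module ℂ V] {f g : A P →ₗ[ℂ] V} (h1 : f 1 = g 1)
    (hg : ∀ s x, f x = g x → (f ∘ₗ lm P s) x = (g ∘ₗ lm P s) x) : f = g := by
  ext x
  induction x using A_induction with
  | one => exact h1
  | add x y hx hy => rw [map_add, map_add, hx, hy]
  | smul r x hx => rw [map_smul, map_smul, hx]
  | mul s x hx => exact hg s x hx

/-- The operator `X ↦ Δ(g) X` on the tensor square. -/
def DL : AGen → (A P ⊗[ℂ] A P →ₗ[ℂ] A P ⊗[ℂ] A P)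
  | a => map (lm P a) (lm P a) + map (lm P b ∘ₗ τ P) (lm P c)
  | b => map (lm P a ∘ₗ τ P) (lm P b) + map (lm P b) (lm P d)
  | c => map (lm P c) (lm P a) + map (lm P d ∘ₗ τ P) (lm P c)
  | d => map (lm P c ∘ₗ τ P) (lm P b) + map (lm P d) (lm P d)
  | σ => map (lm P σ) (lm P σ)

lemma comul_lm (s : AGen) : Coalgebra.comul ∘ₗ lm P s = DL P s ∘ₗ Coalgebra.comul := by
  cases s
  exacts [comul_a P, comul_b P, comul_c P, comul_d P, comul_σ P]

lemma comul_gen_mul (s : AGen) (x : A P) :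
    Coalgebra.comul (R := ℂ) (gen P s * x) = DL P s (Coalgebra.comul x) :=
  LinearMap.congr_fun (comul_lm P s) x

lemma comul_τ : Coalgebra.comul ∘ₗ τ P = map (τ P) (τ P) ∘ₗ Coalgebra.comul := by
  refine gen_ext P (by simp [comul_one]) fun s x hx => ?_
  simp only [LinearMap.comp_apply, LinearMap.mulLeft_apply, AlgHom.toLinearMap_apply] at hx ⊢
  rw [comul_gen_mul, map_mul]
  have key : ∀ X : A P ⊗[ℂ] A P, map (τ P) (τ P) (DL P s X) =
      (match s with | b => -1 | c => -1 | _ => (1 : ℂ)) • DL P s (map (τ P) (τ P) X) := by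
    intro X
    induction X using TensorProduct.induction_on with
    | zero => simp
    | tmul u v => cases s <;> simp [DL, neg_tmul, tmul_neg]
    | add X Y hX hY => simp only [map_add, hX, hY, smul_add]
  rw [key, ← hx]
  cases s <;> simp [comul_gen_mul]

variable {P} in
lemma rTensor_comul_map {f : A P →ₗ[ℂ] A P} {F : A P ⊗[ℂ] A P →ₗ[ℂ] A P ⊗[ℂ] A P}
    (h : Coalgebra.comul ∘ₗ f = F ∘ₗ Coalgebra.comul) (g : A P →ₗ[ℂ] A P) (X : A P ⊗[ℂ] A P) :
    LinearMap.rTensor (A P) Coalgebra.comul (map f g X) =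
      map F g (LinearMap.rTensor (A P) Coalgebra.comul X) := by
  induction X using TensorProduct.induction_on with
  | zero => simp
  | tmul u v => simpa using congrArg (· ⊗ₜ[ℂ] g v) (LinearMap.congr_fun h u)
  | add X Y hX hY => simp only [map_add, hX, hY]

variable {P} in
lemma lTensor_comul_map {g : A P →ₗ[ℂ] A P} {G : A P ⊗[ℂ] A P →ₗ[ℂ] A P ⊗[ℂ] A P}
    (h : Coalgebra.comul ∘ₗ g = G ∘ₗ Coalgebra.comul) (f : A P →ₗ[ℂ] A P) (X : A P ⊗[ℂ] A P) :
    LinearMap.lTensor (A P) Coalgebra.comul (map f g X) =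
      map f G (LinearMap.lTensor (A P) Coalgebra.comul X) := by
  induction X using TensorProduct.induction_on with
  | zero => simp
  | tmul u v => simpa using congrArg (f u ⊗ₜ[ℂ] ·) (LinearMap.congr_fun h v)
  | add X Y hX hY => simp only [map_add, hX, hY]

lemma comul_lm_τ (s : AGen) : Coalgebra.comul ∘ₗ (lm P s ∘ₗ τ P) =
    (DL P s ∘ₗ map (τ P) (τ P)) ∘ₗ Coalgebra.comul := by
  rw [← LinearMap.comp_assoc, comul_lm, LinearMap.comp_assoc, comul_τ, LinearMap.comp_assoc]

instance : Coalgebra ℂ (A P) where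
  coassoc := by
    refine gen_ext P (by simp [comul_one]) fun s x hx => ?_
    simp only [LinearMap.comp_apply, LinearMap.mulLeft_apply, LinearEquiv.coe_coe] at hx ⊢
    rw [comul_gen_mul]
    have key : TensorProduct.assoc ℂ _ _ _
        (LinearMap.rTensor (A P) (Coalgebra.comul (R := ℂ)) (DL P s (Coalgebra.comul x))) =
        LinearMap.lTensor (A P) (Coalgebra.comul (R := ℂ)) (DL P s (Coalgebra.comul x)) := by
      cases s <;>
      simp only [DL, LinearMap.add_apply, map_add, rTensor_comul_map (comul_lm P _),
        rTensor_comul_map (comul_lm_τ P _), lTensor_comul_map (comul_lm P _), ← hx] <;>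
      generalize LinearMap.rTensor (A P) (Coalgebra.comul (R := ℂ)) (Coalgebra.comul x) = Z <;>
      induction Z using TensorProduct.induction_on with
      | zero => simp
      | add X Y hX hY =>
        simp only [map_add] at hX hY ⊢
        linear_combination (norm := module) hX + hY
      | tmul U w =>
        induction U using TensorProduct.induction_on with
        | zero => simp
        | add X Y hX hY =>
          simp only [map_add, add_tmul] at hX hY ⊢
          linear_combination (norm := module) hX + hY
        | tmul u v =>
          simp [add_tmul, tmul_add]
          try abel
    exact key
  rTensor_counit_comp_comul := by
    refine gen_ext P (by simp [comul_one, counit_eq]) fun s x hx => ?_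
    simp only [LinearMap.comp_apply, LinearMap.mulLeft_apply] at hx ⊢
    have key : ∀ X : A P ⊗[ℂ] A P, LinearMap.rTensor (A P) (Coalgebra.counit (R := ℂ)) (DL P s X) =
        LinearMap.lTensor ℂ (lm P s) (LinearMap.rTensor (A P) (Coalgebra.counit (R := ℂ)) X) := by
      intro X
      induction X using TensorProduct.induction_on with
      | zero => simp
      | add X Y hX hY => simp only [map_add, hX, hY]
      | tmul u v => cases s <;> simp [DL, counit_eq, counit_parity]
    rw [comul_gen_mul, key, hx]
    simp
  lTensor_counit_comp_comul := by
    refine gen_ext P (by simp [comul_one, counit_eq]) fun s x hx => ?_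
    simp only [LinearMap.comp_apply, LinearMap.mulLeft_apply] at hx ⊢
    have key : ∀ X : A P ⊗[ℂ] A P, LinearMap.lTensor (A P) (Coalgebra.counit (R := ℂ)) (DL P s X) =
        LinearMap.rTensor ℂ (lm P s) (LinearMap.lTensor (A P) (Coalgebra.counit (R := ℂ)) X) := by
      intro X
      induction X using TensorProduct.induction_on with
      | zero => simp
      | add X Y hX hY => simp only [map_add, hX, hY]
      | tmul u v => cases s <;> simp [DL, counit_eq]
    rw [comul_gen_mul, key, hx]
    simp

/-! ### The functionals `k`, `k⁻¹`, `e`, `f` on the quantum supergroup -/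

lemma k_rep : IsARep P P.t 0 0 (-P.t⁻¹) (-1) := by
  have ht := t_ne_zero P
  constructor <;> simp [ht, mul_comm]

/-- The algebra homomorphism `k` with `k(a) = t`, `k(b) = k(c) = 0`, `k(d) = -t⁻¹`,
`k(σ) = -1`. -/
def kHom : A P →ₐ[ℂ] ℂ := liftA (k_rep P)

lemma kinv_rep : IsARep P P.t⁻¹ 0 0 (-P.t) (-1) := by
  have ht := t_ne_zero P
  constructor <;> simp [ht, mul_comm]

/-- The algebra homomorphism `k⁻¹` with `k⁻¹(a) = t⁻¹`, `k⁻¹(b) = k⁻¹(c) = 0`, `k⁻¹(d) = -t`,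
`k⁻¹(σ) = -1`. -/
def kinvHom : A P →ₐ[ℂ] ℂ := liftA (kinv_rep P)

/-- The value `e(b)`. -/
def κ : ℂ := (P.t - P.t⁻¹) / (P.q - P.q⁻¹)

lemma e_rep : IsARep P !![P.t, 0; 0, 1] !![0, κ P; 0, 0] 0 !![-P.t⁻¹, 0; 0, 1]
    !![-1, 0; 0, 1] := by
  have ht := t_ne_zero P
  constructor <;> ext i j <;> fin_cases i <;> fin_cases j <;>
    simp [ht, mul_comm, pow_two, Matrix.mul_apply]

/-- The homomorphism `u ↦ !![k(u), e(u); 0, ε(u)]`. -/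
def eHom : A P →ₐ[ℂ] Matrix (Fin 2) (Fin 2) ℂ := liftA (e_rep P)

/-- The functional `e` with `e(b) = (t - t⁻¹) / (q - q⁻¹)`, zero on the other generators and on
`1`, and `e(uv) = e(u) ε(v) + k(u) e(v)`. -/
def eFun : A P →ₗ[ℂ] ℂ := Matrix.entryLinearMap ℂ ℂ 0 1 ∘ₗ (eHom P).toLinearMap

lemma f_rep : IsARep P !![1, 0; 0, P.t⁻¹] 0 !![0, 1; 0, 0] !![1, 0; 0, -P.t]
    !![1, 0; 0, -1] := by
  have ht := t_ne_zero P
  constructor <;> ext i j <;> fin_cases i <;> fin_cases j <;>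
    simp [ht, mul_comm, pow_two, Matrix.mul_apply]

/-- The homomorphism `u ↦ !![ε(u), f(u); 0, k⁻¹(u)]`. -/
def fHom : A P →ₐ[ℂ] Matrix (Fin 2) (Fin 2) ℂ := liftA (f_rep P)

/-- The functional `f` with `f(c) = 1`, zero on the other generators and on `1`, and
`f(uv) = f(u) k⁻¹(v) + ε(u) f(v)`. -/
def fFun : A P →ₗ[ℂ] ℂ := Matrix.entryLinearMap ℂ ℂ 0 1 ∘ₗ (fHom P).toLinearMap

@[simp] lemma k_a : kHom P ga = P.t := liftA_a _
@[simp] lemma k_b : kHom P gb = 0 := liftA_b _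
@[simp] lemma k_c : kHom P gc = 0 := liftA_c _
@[simp] lemma k_d : kHom P gd = -P.t⁻¹ := liftA_d _
@[simp] lemma k_σ : kHom P gσ = -1 := liftA_σ _
@[simp] lemma kinv_a : kinvHom P ga = P.t⁻¹ := liftA_a _
@[simp] lemma kinv_b : kinvHom P gb = 0 := liftA_b _
@[simp] lemma kinv_c : kinvHom P gc = 0 := liftA_c _
@[simp] lemma kinv_d : kinvHom P gd = -P.t := liftA_d _
@[simp] lemma kinv_σ : kinvHom P gσ = -1 := liftA_σ _

lemma eHom_a : eHom P ga = !![P.t, 0; 0, 1] := liftA_a _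
lemma eHom_b : eHom P gb = !![0, κ P; 0, 0] := liftA_b _
lemma eHom_c : eHom P gc = 0 := liftA_c _
lemma eHom_d : eHom P gd = !![-P.t⁻¹, 0; 0, 1] := liftA_d _
lemma eHom_σ : eHom P gσ = !![-1, 0; 0, 1] := liftA_σ _
lemma fHom_a : fHom P ga = !![1, 0; 0, P.t⁻¹] := liftA_a _
lemma fHom_b : fHom P gb = 0 := liftA_b _
lemma fHom_c : fHom P gc = !![0, 1; 0, 0] := liftA_c _
lemma fHom_d : fHom P gd = !![1, 0; 0, -P.t] := liftA_d _
lemma fHom_σ : fHom P gσ = !![1, 0; 0, -1] := liftA_σ _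

lemma eHom_eq (x : A P) : eHom P x = !![kHom P x, eFun P x; 0, counitHom P x] := by
  suffices h : eHom P x 0 0 = kHom P x ∧ eHom P x 1 0 = 0 ∧ eHom P x 1 1 = counitHom P x by
    ext i j
    fin_cases i <;> fin_cases j <;> simp [h, eFun]
  induction x using A_induction with
  | one => simp
  | add x y hx hy => simp [hx, hy]
  | smul r x hx => simp [hx]
  | mul g x hx => cases g <;> simp [hx, eHom_a, eHom_b, eHom_c, eHom_d, eHom_σ, Matrix.mul_apply]

lemma fHom_eq (x : A P) : fHom P x = !![counitHom P x, fFun P x; 0, kinvHom P x] := by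
  suffices h : fHom P x 0 0 = counitHom P x ∧ fHom P x 1 0 = 0 ∧ fHom P x 1 1 = kinvHom P x by
    ext i j
    fin_cases i <;> fin_cases j <;> simp [h, fFun]
  induction x using A_induction with
  | one => simp
  | add x y hx hy => simp [hx, hy]
  | smul r x hx => simp [hx]
  | mul g x hx => cases g <;> simp [hx, fHom_a, fHom_b, fHom_c, fHom_d, fHom_σ, Matrix.mul_apply]

lemma eFun_mul (x y : A P) :
    eFun P (x * y) = eFun P x * counitHom P y + kHom P x * eFun P y := by
  have h := congrFun (congrFun (eHom_eq P (x * y)) 0) 1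
  rw [map_mul, eHom_eq, eHom_eq] at h
  simp [Matrix.mul_apply] at h
  rw [← h]; ring

lemma fFun_mul (x y : A P) :
    fFun P (x * y) = fFun P x * kinvHom P y + counitHom P x * fFun P y := by
  have h := congrFun (congrFun (fHom_eq P (x * y)) 0) 1
  rw [map_mul, fHom_eq, fHom_eq] at h
  simp [Matrix.mul_apply] at h
  rw [← h]; ring

@[simp] lemma eFun_one : eFun P 1 = 0 := by simp [eFun]
@[simp] lemma fFun_one : fFun P 1 = 0 := by simp [fFun]
@[simp] lemma eFun_a : eFun P ga = 0 := by simp [eFun, eHom]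
@[simp] lemma eFun_b : eFun P gb = κ P := by simp [eFun, eHom]
@[simp] lemma eFun_c : eFun P gc = 0 := by simp [eFun, eHom]
@[simp] lemma eFun_d : eFun P gd = 0 := by simp [eFun, eHom]
@[simp] lemma eFun_σ : eFun P gσ = 0 := by simp [eFun, eHom]
@[simp] lemma fFun_a : fFun P ga = 0 := by simp [fFun, fHom]
@[simp] lemma fFun_b : fFun P gb = 0 := by simp [fFun, fHom]
@[simp] lemma fFun_c : fFun P gc = 1 := by simp [fFun, fHom]
@[simp] lemma fFun_d : fFun P gd = 0 := by simp [fFun, fHom]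
@[simp] lemma fFun_σ : fFun P gσ = 0 := by simp [fFun, fHom]
/-- The dual of the quantum supergroup, an algebra under the product
`(x y)(u) = ∑ x(u₁) y(u₂)` dual to the comultiplication. -/
abbrev D : Type := WithConv (A P →ₗ[ℂ] ℂ)

open WithConv

/-- `k` in the dual algebra. -/
def kD : D P := toConv (kHom P).toLinearMap
/-- `k⁻¹` in the dual algebra. -/
def kinvD : D P := toConv (kinvHom P).toLinearMap
/-- `e` in the dual algebra. -/
def eD : D P := toConv (eFun P)
/-- `f` in the dual algebra. -/
def fD : D P := toConv (fFun P)

/-- Translation of a functional by a generator. -/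
def act (s : AGen) (φ : D P) : D P := toConv (φ.ofConv ∘ₗ lm P s)

/-- Composition of a functional with the parity automorphism. -/
def tw (φ : D P) : D P := toConv (φ.ofConv ∘ₗ τ P)

lemma D_ext {φ ψ : D P} (h : ∀ x, φ.ofConv x = ψ.ofConv x) : φ = ψ :=
  WithConv.ext (LinearMap.ext h)

lemma D_neg_mul (φ ψ : D P) : -φ * ψ = -(φ * ψ) := neg_mul φ ψ
lemma D_mul_neg (φ ψ : D P) : φ * -ψ = -(φ * ψ) := mul_neg φ ψ
lemma D_neg_neg (φ : D P) : - -φ = φ := neg_neg φ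

lemma D_smul_mul (r : ℂ) (φ ψ : D P) : (r • φ) * ψ = r • (φ * ψ) := smul_mul_assoc r φ ψ
lemma D_mul_smul (r : ℂ) (φ ψ : D P) : φ * (r • ψ) = r • (φ * ψ) := mul_smul_comm r φ ψ
lemma D_one_mul (φ : D P) : 1 * φ = φ := one_mul φ
lemma D_mul_one (φ : D P) : φ * 1 = φ := mul_one φ
lemma D_add_mul (φ ψ χ : D P) : (φ + ψ) * χ = φ * χ + ψ * χ := add_mul φ ψ χ
lemma D_mul_add (φ ψ χ : D P) : φ * (ψ + χ) = φ * ψ + φ * χ := mul_add φ ψ χ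

lemma act_mul_aux (φ ψ : D P) (s : AGen) (x : A P) : (act P s (φ * ψ)).ofConv x =
    LinearMap.mul' ℂ ℂ (map φ.ofConv ψ.ofConv (DL P s (Coalgebra.comul x))) := by
  rw [← comul_gen_mul]; rfl

lemma mul_aux (φ ψ : D P) (x : A P) : (φ * ψ).ofConv x =
    LinearMap.mul' ℂ ℂ (map φ.ofConv ψ.ofConv (Coalgebra.comul x)) := rfl

lemma map_aux (φ ψ : D P) (g h : A P →ₗ[ℂ] A P) (X : A P ⊗[ℂ] A P) :
    map φ.ofConv ψ.ofConv (map g h X) = map (φ.ofConv ∘ₗ g) (ψ.ofConv ∘ₗ h) X := by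
  rw [map_comp]; rfl

lemma act_mul_a (φ ψ : D P) :
    act P a (φ * ψ) = act P a φ * act P a ψ + tw P (act P b φ) * act P c ψ := by
  apply D_ext; intro x
  simp only [act_mul_aux, mul_aux, DL, LinearMap.add_apply, map_add, map_aux, ofConv_add]; rfl

lemma act_mul_b (φ ψ : D P) :
    act P b (φ * ψ) = tw P (act P a φ) * act P b ψ + act P b φ * act P d ψ := by
  apply D_ext; intro x
  simp only [act_mul_aux, mul_aux, DL, LinearMap.add_apply, map_add, map_aux, ofConv_add]; rfl

lemma act_mul_c (φ ψ : D P) :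
    act P c (φ * ψ) = act P c φ * act P a ψ + tw P (act P d φ) * act P c ψ := by
  apply D_ext; intro x
  simp only [act_mul_aux, mul_aux, DL, LinearMap.add_apply, map_add, map_aux, ofConv_add]; rfl

lemma act_mul_d (φ ψ : D P) :
    act P d (φ * ψ) = tw P (act P c φ) * act P b ψ + act P d φ * act P d ψ := by
  apply D_ext; intro x
  simp only [act_mul_aux, mul_aux, DL, LinearMap.add_apply, map_add, map_aux, ofConv_add]; rfl

lemma act_mul_σ (φ ψ : D P) : act P σ (φ * ψ) = act P σ φ * act P σ ψ := by
  apply D_ext; intro x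
  simp only [act_mul_aux, mul_aux, DL, map_aux]; rfl

lemma act_one (s : AGen) : act P s 1 = counitHom P (gen P s) • (1 : D P) := by
  apply D_ext; intro x
  change counitHom P (gen P s * x) = counitHom P (gen P s) * counitHom P x
  exact map_mul _ _ _

lemma act_k (s : AGen) : act P s (kD P) = kHom P (gen P s) • kD P := by
  apply D_ext; intro x
  exact map_mul (kHom P) (gen P s) x

lemma act_kinv (s : AGen) : act P s (kinvD P) = kinvHom P (gen P s) • kinvD P := by
  apply D_ext; intro x
  exact map_mul (kinvHom P) (gen P s) x

lemma act_e (s : AGen) : act P s (eD P) =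
    eFun P (gen P s) • (1 : D P) + kHom P (gen P s) • eD P := by
  apply D_ext; intro x
  exact eFun_mul P (gen P s) x

lemma act_f (s : AGen) : act P s (fD P) =
    fFun P (gen P s) • kinvD P + counitHom P (gen P s) • fD P := by
  apply D_ext; intro x
  exact fFun_mul P (gen P s) x

lemma act_neg (s : AGen) (φ : D P) : act P s (-φ) = -act P s φ := rfl
lemma tw_zero : tw P 0 = 0 := rfl
lemma D_zero_mul (φ : D P) : 0 * φ = 0 := zero_mul φ
lemma D_mul_zero (φ : D P) : φ * 0 = 0 := mul_zero φ
lemma tw_neg (φ : D P) : tw P (-φ) = -tw P φ := rfl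
lemma act_add (s : AGen) (φ ψ : D P) : act P s (φ + ψ) = act P s φ + act P s ψ := rfl
lemma act_sub (s : AGen) (φ ψ : D P) : act P s (φ - ψ) = act P s φ - act P s ψ := rfl
lemma act_smul (s : AGen) (r : ℂ) (φ : D P) : act P s (r • φ) = r • act P s φ := rfl

lemma tw_add (φ ψ : D P) : tw P (φ + ψ) = tw P φ + tw P ψ := rfl
lemma tw_smul (r : ℂ) (φ : D P) : tw P (r • φ) = r • tw P φ := rfl

lemma tw_k : tw P (kD P) = kD P := by
  refine D_ext P fun x => ?_
  change kHom P (parity P x) = kHom P x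
  induction x using A_induction with
  | one => simp
  | add x y hx hy => simp [hx, hy]
  | smul r x hx => simp [hx]
  | mul g x hx => cases g <;> simp [hx]

lemma tw_kinv : tw P (kinvD P) = kinvD P := by
  refine D_ext P fun x => ?_
  change kinvHom P (parity P x) = kinvHom P x
  induction x using A_induction with
  | one => simp
  | add x y hx hy => simp [hx, hy]
  | smul r x hx => simp [hx]
  | mul g x hx => cases g <;> simp [hx]

lemma tw_one : tw P 1 = 1 := D_ext P fun x => counit_parity P x

lemma tw_e : tw P (eD P) = -eD P := by
  refine D_ext P fun x => ?_
  change eFun P (parity P x) = -eFun P x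
  induction x using A_induction with
  | one => simp
  | add x y hx hy => simp [hx, hy, add_comm]
  | smul r x hx => simp [hx]
  | mul g x hx => cases g <;> simp [hx, eFun_mul, counit_parity]

lemma tw_f : tw P (fD P) = -fD P := by
  have hk : ∀ x, kinvHom P (parity P x) = kinvHom P x := fun x =>
    LinearMap.congr_fun (congrArg ofConv (tw_kinv P)) x
  refine D_ext P fun x => ?_
  change fFun P (parity P x) = -fFun P x
  induction x using A_induction with
  | one => simp
  | add x y hx hy => simp [hx, hy, add_comm]
  | smul r x hx => simp [hx]
  | mul g x hx => cases g <;> simp [hx, fFun_mul, hk]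

lemma D_zero {φ : D P} (h1 : φ.ofConv 1 = 0) (c : AGen → ℂ) (h : ∀ s, act P s φ = c s • φ) :
    φ = 0 := by
  refine D_ext P fun x => ?_
  change φ.ofConv x = 0
  induction x using A_induction with
  | one => exact h1
  | add x y hx hy => rw [map_add, hx, hy, add_zero]
  | smul r x hx => rw [map_smul, hx, smul_zero]
  | mul s x hx =>
    have := LinearMap.congr_fun (congrArg ofConv (h s)) x
    change φ.ofConv (gen P s * x) = c s * φ.ofConv x at this
    rw [this, hx, mul_zero]

lemma mul_at_one (φ ψ : D P) : (φ * ψ).ofConv 1 = φ.ofConv 1 * ψ.ofConv 1 := by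
  rw [mul_aux, comul_one]; simp

lemma kD_one : (kD P).ofConv 1 = 1 := map_one (kHom P)
lemma kinvD_one : (kinvD P).ofConv 1 = 1 := map_one (kinvHom P)
lemma eD_one : (eD P).ofConv 1 = 0 := eFun_one P
lemma fD_one : (fD P).ofConv 1 = 0 := fFun_one P
lemma oneD_one : (1 : D P).ofConv 1 = 1 := map_one (counitHom P)

lemma q_eq : P.q = -P.t ^ 2 := by rw [P.t_sq, neg_neg]

lemma kD_mul_kinvD : kD P * kinvD P = 1 := by
  have ht := t_ne_zero P
  rw [← sub_eq_zero]
  refine D_zero P (by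
      simp only [ofConv_sub, ofConv_add, ofConv_smul, LinearMap.sub_apply, LinearMap.add_apply,
        LinearMap.smul_apply, mul_at_one, kD_one, kinvD_one, oneD_one]
      simp)
    (fun | a => 1 | b => 0 | c => 0 | d => 1 | σ => 1) fun s => ?_
  cases s <;>
  simp [act_sub, D_neg_mul, D_mul_neg, D_smul_mul, D_mul_smul, D_one_mul,
    D_mul_one, D_add_mul, D_mul_add, D_neg_neg, tw_neg, tw_zero,
    D_zero_mul, D_mul_zero, act_mul_a, act_mul_b, act_mul_c, act_mul_d, act_mul_σ, act_one, act_k, act_kinv,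
    smul_smul, ht, mul_comm, tw_smul, tw_k]

lemma kinvD_mul_kD : kinvD P * kD P = 1 := by
  have ht := t_ne_zero P
  rw [← sub_eq_zero]
  refine D_zero P (by
      simp only [ofConv_sub, ofConv_add, ofConv_smul, LinearMap.sub_apply, LinearMap.add_apply,
        LinearMap.smul_apply, mul_at_one, kD_one, kinvD_one, oneD_one]
      simp)
    (fun | a => 1 | b => 0 | c => 0 | d => 1 | σ => 1) fun s => ?_
  cases s <;>
  simp [act_sub, D_neg_mul, D_mul_neg, D_smul_mul, D_mul_smul, D_one_mul,
    D_mul_one, D_add_mul, D_mul_add, D_neg_neg, tw_neg, tw_zero,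
    D_zero_mul, D_mul_zero, act_mul_a, act_mul_b, act_mul_c, act_mul_d, act_mul_σ, act_one, act_k, act_kinv,
    smul_smul, ht, mul_comm, tw_smul, tw_k]

lemma kD_mul_eD : kD P * eD P = P.q • (eD P * kD P) := by
  have ht := t_ne_zero P
  rw [← sub_eq_zero]
  refine D_zero P (by
      simp only [ofConv_sub, ofConv_add, ofConv_smul, LinearMap.sub_apply, LinearMap.add_apply,
        LinearMap.smul_apply, mul_at_one, kD_one, eD_one]
      simp)
    (fun | a => P.t ^ 2 | b => 0 | c => 0 | d => (P.t ^ 2)⁻¹ | σ => 1) fun s => ?_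
  cases s <;>
  simp [act_sub, act_add, act_neg, D_neg_mul, D_mul_neg, D_smul_mul, D_mul_smul, D_one_mul,
    D_mul_one, D_add_mul, D_mul_add, D_neg_neg, tw_neg, tw_zero,
    D_zero_mul, D_mul_zero, act_smul, act_mul_a, act_mul_b, act_mul_c, act_mul_d, act_mul_σ, act_k, act_e,
    smul_smul, tw_smul, tw_k, tw_e, tw_one, tw_add, q_eq] 
  all_goals (try match_scalars) <;> field_simp <;> ring

lemma kD_mul_fD : kD P * fD P = P.q⁻¹ • (fD P * kD P) := by
  have ht := t_ne_zero P
  have hk := kD_mul_kinvD P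
  have hk' := kinvD_mul_kD P
  rw [← sub_eq_zero]
  refine D_zero P (by
      simp only [ofConv_sub, ofConv_add, ofConv_smul, LinearMap.sub_apply, LinearMap.add_apply,
        LinearMap.smul_apply, mul_at_one, kD_one, fD_one]
      simp)
    (fun | a => P.t | b => 0 | c => 0 | d => -P.t⁻¹ | σ => -1) fun s => ?_
  cases s <;>
  simp [act_sub, act_add, act_neg, D_neg_mul, D_mul_neg, D_smul_mul, D_mul_smul, D_one_mul,
    D_mul_one, D_add_mul, D_mul_add, D_neg_neg, tw_neg, tw_zero,
    D_zero_mul, D_mul_zero, act_smul, act_mul_a, act_mul_b, act_mul_c, act_mul_d, act_mul_σ, act_k, act_f,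
    smul_smul, tw_smul, tw_k, tw_f, tw_kinv, tw_add, q_eq, hk, hk'] 
  all_goals (try match_scalars) <;> field_simp <;> ring

lemma eD_mul_kinvD : eD P * kinvD P = P.q • (kinvD P * eD P) := by
  calc eD P * kinvD P = kinvD P * (kD P * eD P) * kinvD P := by
        rw [← mul_assoc, kinvD_mul_kD, one_mul]
    _ = P.q • (kinvD P * eD P) := by
        rw [kD_mul_eD, D_mul_smul, D_smul_mul, mul_assoc, mul_assoc, kD_mul_kinvD, mul_one]

lemma eD_fD : eD P * fD P + fD P * eD P = (P.q - P.q⁻¹)⁻¹ • (kD P - kinvD P) := by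
  have ht := t_ne_zero P
  rw [← sub_eq_zero]
  refine D_zero P (by
      simp only [ofConv_sub, ofConv_add, ofConv_smul, LinearMap.sub_apply, LinearMap.add_apply,
        LinearMap.smul_apply, mul_at_one, eD_one, fD_one, kD_one, kinvD_one]
      simp)
    (fun | a => P.t | b => 0 | c => 0 | d => -P.t⁻¹ | σ => -1) fun s => ?_
  cases s <;>
  simp [act_sub, act_add, act_neg, D_neg_mul, D_mul_neg, D_smul_mul, D_mul_smul, D_one_mul,
    D_mul_one, D_add_mul, D_mul_add, D_neg_neg, tw_neg, tw_zero,
    D_zero_mul, D_mul_zero, act_smul, act_mul_a, act_mul_b, act_mul_c, act_mul_d, act_mul_σ, act_k,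
    act_kinv, act_e, act_f, smul_smul, tw_smul, tw_k, tw_f, tw_kinv, tw_add, tw_e, tw_one, κ]
  case c => rw [eD_mul_kinvD, q_eq]; match_scalars; field_simp; ring
  all_goals module

/-! ### The quantized enveloping algebra -/

/-- The generators of the quantized enveloping algebra. -/
inductive UGen
  | k | kinv | e | f

open UGen in
/-- The defining relations of the quantized enveloping algebra. -/
inductive URel : FreeAlgebra ℂ UGen → FreeAlgebra ℂ UGen → Prop
  | k_kinv : URel (.ι ℂ k * .ι ℂ kinv) 1
  | kinv_k : URel (.ι ℂ kinv * .ι ℂ k) 1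
  | kek : URel (.ι ℂ k * .ι ℂ e * .ι ℂ kinv) (P.q • .ι ℂ e)
  | kfk : URel (.ι ℂ k * .ι ℂ f * .ι ℂ kinv) (P.q⁻¹ • .ι ℂ f)
  | ef : URel (.ι ℂ e * .ι ℂ f + .ι ℂ f * .ι ℂ e)
      ((P.q - P.q⁻¹)⁻¹ • (.ι ℂ k - .ι ℂ kinv))

/-- The quantized enveloping algebra `U_q(osp(1,2))`. -/
def U : Type := RingQuot (URel P)

instance : Ring (U P) := inferInstanceAs (Ring (RingQuot (URel P)))
instance : Algebra ℂ (U P) := inferInstanceAs (Algebra ℂ (RingQuot (URel P)))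

/-- The generators, as elements of the quantized enveloping algebra. -/
def ugen (g : UGen) : U P := RingQuot.mkAlgHom ℂ (URel P) (.ι ℂ g)

/-- The counit of the quantized enveloping algebra: `k^{±1} ↦ 1`, `e, f ↦ 0`. -/
def counitU : U P →ₐ[ℂ] ℂ :=
  RingQuot.liftAlgHom ℂ ⟨FreeAlgebra.lift ℂ (fun
    | .k => 1
    | .kinv => 1
    | .e => 0
    | .f => 0), by rintro _ _ (_ | _ | _ | _ | _) <;> simp⟩

/-- The dual pairing of the quantized enveloping algebra with the quantum supergroup, as the
algebra homomorphism `U → A*` that sends `k^{±1}`, `e`, `f` to the functionals above. -/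
def pairing : U P →ₐ[ℂ] D P :=
  RingQuot.liftAlgHom ℂ ⟨FreeAlgebra.lift ℂ (fun
    | .k => kD P
    | .kinv => kinvD P
    | .e => eD P
    | .f => fD P), by
      rintro _ _ (_ | _ | _ | _ | _)
      · simpa using kD_mul_kinvD P
      · simpa using kinvD_mul_kD P
      · simp only [map_mul, FreeAlgebra.lift_ι_apply, map_smul]
        rw [kD_mul_eD, D_smul_mul, mul_assoc, kD_mul_kinvD, mul_one]
      · simp only [map_mul, FreeAlgebra.lift_ι_apply, map_smul]
        rw [kD_mul_fD, D_smul_mul, mul_assoc, kD_mul_kinvD, mul_one]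
      · simp only [map_mul, map_add, map_sub, FreeAlgebra.lift_ι_apply, map_smul]
        exact eD_fD P⟩

/-- The right action `R_x(u) = ∑ x(u₁) u₂` of the quantized enveloping algebra. -/
def R (x : U P) : A P →ₗ[ℂ] A P :=
  (TensorProduct.lid ℂ (A P)).toLinearMap ∘ₗ
    LinearMap.rTensor (A P) (pairing P x).ofConv ∘ₗ Coalgebra.comul

/-- The left action `L_x(u) = ∑ (-1)^{p(x) p(u₁)} x(u₂) u₁` of the quantized enveloping algebra.
Since `x(u₂) = 0` for homogeneous `x`, `u₂` of different parity, the sign is the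
sign `(-1)^{p(u₂) p(u₁)}` of the graded flip of `∑ u₁ ⊗ u₂`. -/
def L (x : U P) : A P →ₗ[ℂ] A P :=
  (TensorProduct.lid ℂ (A P)).toLinearMap ∘ₗ
    LinearMap.rTensor (A P) (pairing P x).ofConv ∘ₗ
    (GradedTensorProduct.of ℂ (grading P) (grading P)).symm.toLinearMap ∘ₗ
    (GradedTensorProduct.comm (grading P) (grading P)).toLinearMap ∘ₗ
    (comulHom P).toLinearMap

/-- The `(1, k)`-primitive element `x_{αβ} = α e + β f k`. -/
def xElt (α β : ℂ) : U P := α • ugen P .e + β • (ugen P .f * ugen P .k)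

/-! ### The bicomodules of matrix elements -/

/-- The left subcomodule `V_ℓ σ^s` for `ℓ = N / 2`: the span of the
elements `a^{ℓ-i} c^{ℓ+i} σ^s`, `-ℓ ≤ i ≤ ℓ`. -/
def V (N s : ℕ) : Submodule ℂ (A P) :=
  Submodule.span ℂ (Set.range fun j : Fin (N + 1) =>
    ga ^ (N - (j : ℕ)) * gc ^ (j : ℕ) * gσ ^ s)

/-- The bicomodule `M_ℓ σ^s` for `ℓ = N / 2`: the span of the matrix elements of the left comodule
`V_ℓ σ^s`, that is, of the elements `m_{ij} σ^s` with `Δ(ξ_i σ^s) = ∑ m_{ij} σ^s ⊗ ξ_j σ^s`.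
Written without choosing a basis `ξ_i`: the span of all
`(id ⊗ φ)(Δ v)` with `v ∈ V_ℓ σ^s` and `φ` a linear functional. -/
def M (N s : ℕ) : Submodule ℂ (A P) :=
  Submodule.span ℂ {w | ∃ v ∈ V P N s, ∃ φ : A P →ₗ[ℂ] ℂ,
    w = TensorProduct.rid ℂ (A P) (LinearMap.lTensor (A P) φ (Coalgebra.comul v))}

/-- The space of `(x, y)`-spherical functions in a subspace `W`: the elements `u ∈ W` that are right
`x`-invariant, `R_x(u) = ε(x) u`, and left `y`-invariant, `L_y(u) = ε(y) u`. -/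
def sphericalFunctions (x y : U P) (W : Submodule ℂ (A P)) : Submodule ℂ (A P) :=
  W ⊓ LinearMap.eqLocus (R P x) (counitU P x • LinearMap.id) ⊓
    LinearMap.eqLocus (L P y) (counitU P y • LinearMap.id)

/-- The element `ρ₁` of `M₁ σ`. -/
def rhoOne (α β α' β' : ℂ) : A P :=
  (ga ^ 2 - (α'⁻¹ * β' * P.t * (1 - P.q)) • gb ^ 2
    + (α * β⁻¹ * P.t * (1 - P.q)⁻¹) • gc ^ 2
    - (α * β⁻¹ * α'⁻¹ * β' * P.q) • gd ^ 2) * gσ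

end QuantumOSp

/-! ### Askey–Wilson polynomials -/

/-- The `q`-shifted factorial `(a; q)_m`. -/
def qShiftedFactorial (a q : ℂ) (m : ℕ) : ℂ := ∏ j ∈ Finset.range m, (1 - a * q ^ j)

open Polynomial in
/-- The Askey-Wilson polynomial `p_n(x; a, b, c, d | q)` in the variable `x = cos θ`. The numerator
factor `(a e^{iθ}, a e^{-iθ}; q)_k` of the terminating series is
`∏_{j < k} (1 - 2 a x q^j + a² q^{2j})`. -/
def askeyWilson (n : ℕ) (a b c d q : ℂ) : ℂ[X] :=
  C ((a ^ n)⁻¹ * (qShiftedFactorial (a * b) q n * qShiftedFactorial (a * c) q n *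
      qShiftedFactorial (a * d) q n)) *
    ∑ k ∈ Finset.range (n + 1),
      C (qShiftedFactorial ((q ^ n)⁻¹) q k *
          qShiftedFactorial (q ^ ((n : ℤ) - 1) * a * b * c * d) q k * q ^ k /
          (qShiftedFactorial (a * b) q k * qShiftedFactorial (a * c) q k *
            qShiftedFactorial (a * d) q k * qShiftedFactorial q q k)) *
        ∏ j ∈ Finset.range k, (1 - C (2 * a * q ^ j) * X + C (a ^ 2 * q ^ (2 * j)))

end

noncomputable section

namespace QuantumOSp

variable (P : QuantumParameter)

open AGen TensorProduct WithConv

local notation "ga" => gen P AGen.a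
local notation "gb" => gen P AGen.b
local notation "gc" => gen P AGen.c
local notation "gd" => gen P AGen.d
local notation "gσ" => gen P AGen.σ

/-! ### Translation operators on the quantum supergroup -/

/-! The counit kills x_{αβ} and its functional is odd. So the spherical conditions are kernel
conditions for two commuting operators: `RX`, which translates through the first leg of the
comultiplication, and `LX`, which translates through the second (`mem_sphericalFunctions`). The
products a^m c^i with m + i = N are highest weight vectors for the second-leg action. Applying
powers of f to them gives vectors w_{ij} that span the matrix elements (`M_eq`) and are independent,
by their weights under both copies of k (`el_eq_zero`).

Uniqueness: in these coordinates `RX` couples each row only to its two neighbours, and `LX` does the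
same for columns. The coefficients of a spherical element are therefore determined by the corner C 0
0 (`spherical_eq_zero`), and the spherical functions in M_n σ^n form a space of dimension at most
one.

Existence: both operators are twisted derivations, and the four coefficients of ρ₁ are such that
left multiplication by ρ₁ preserves both kernels (`RX_rhoOne_mul`, `LX_rhoOne_mul`). Hence every
polynomial in ρ₁ is spherical. It remains to see that the Askey–Wilson polynomial of degree n lands
in M_n σ^n and is not zero.

A Clebsch–Gordan argument, in which σ = ad + tbc produces the lower terms, shows that a polynomial
of degree at most n in ρ₁ lies in the sum of the M_k σ^k with k ≤ n (`aeval_rhoOne_eq_sum`). A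
Casimir operator separates these spaces (`eq_zero_of_sum_M`). `RX` and `LX` preserve each of them,
so every component of p_n(ρ₁/2t) is itself spherical.

Now restrict to the torus a ↦ z, d ↦ z⁻¹. With z² = tZ the element ρ₁/2t becomes (Z + Z⁻¹)/2, and a
spherical element of M_k σ^k becomes a Laurent polynomial in Z. The diagonal recurrence for its
coefficients (`coeff_diag`) says that this is an eigenfunction of a second order q-difference
operator, with eigenvalue χ_k = q^{-k} - q^{k+1} (`torusCoeff_succ`, `laurent_difference`). The
Askey–Wilson polynomial p_n is an eigenfunction of the same operator with eigenvalue χ_n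
(`aw_difference`). The χ_k are distinct, so the components with k < n restrict to zero on infinitely
many points (`laurent_eq_zero_of_sum`). Their corner coefficients then vanish, and with them the
components (`aeval_aw_mem_M`). Nonvanishing of p_n(ρ₁/2t) is seen at Z = t, where the hypergeometric
sum has a single nonzero term. -/

/-- The operator `u ↦ ∑ φ(u₁) u₂`. -/
def ra : D P →ₗ[ℂ] (A P →ₗ[ℂ] A P) where
  toFun φ := (TensorProduct.lid ℂ (A P)).toLinearMap ∘ₗ
    LinearMap.rTensor (A P) φ.ofConv ∘ₗ Coalgebra.comul
  map_add' φ ψ := by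
    ext u; simp [LinearMap.rTensor_add]
  map_smul' r φ := by
    ext u; simp [LinearMap.rTensor_smul]

/-- The operator `u ↦ ∑ u₁ φ(u₂)`. -/
def la : D P →ₗ[ℂ] (A P →ₗ[ℂ] A P) where
  toFun φ := (TensorProduct.rid ℂ (A P)).toLinearMap ∘ₗ
    LinearMap.lTensor (A P) φ.ofConv ∘ₗ Coalgebra.comul
  map_add' φ ψ := by
    ext u; simp [LinearMap.lTensor_add]
  map_smul' r φ := by
    ext u; simp [LinearMap.lTensor_smul]

lemma ra_apply (φ : D P) (u : A P) : ra P φ u =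
    TensorProduct.lid ℂ (A P) (LinearMap.rTensor (A P) φ.ofConv (Coalgebra.comul u)) := rfl

lemma la_apply (φ : D P) (u : A P) : la P φ u =
    TensorProduct.rid ℂ (A P) (LinearMap.lTensor (A P) φ.ofConv (Coalgebra.comul u)) := rfl

lemma lid_rTensor_map (φ : A P →ₗ[ℂ] ℂ) (g h : A P →ₗ[ℂ] A P) (X : A P ⊗[ℂ] A P) :
    TensorProduct.lid ℂ (A P) (LinearMap.rTensor (A P) φ (map g h X)) =
      h (TensorProduct.lid ℂ (A P) (LinearMap.rTensor (A P) (φ ∘ₗ g) X)) := by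
  induction X using TensorProduct.induction_on with
  | zero => simp
  | tmul u v => simp
  | add X Y hX hY => simp only [map_add, hX, hY]

lemma rid_lTensor_map (φ : A P →ₗ[ℂ] ℂ) (g h : A P →ₗ[ℂ] A P) (X : A P ⊗[ℂ] A P) :
    TensorProduct.rid ℂ (A P) (LinearMap.lTensor (A P) φ (map g h X)) =
      g (TensorProduct.rid ℂ (A P) (LinearMap.lTensor (A P) (φ ∘ₗ h) X)) := by
  induction X using TensorProduct.induction_on with
  | zero => simp
  | tmul u v => simp
  | add X Y hX hY => simp only [map_add, hX, hY]

section generator_formulas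
variable (φ : D P) (u : A P)

lemma ra_a : ra P φ (ga * u) = ga * ra P (act P a φ) u + gc * ra P (tw P (act P b φ)) u := by
  simp only [ra_apply, comul_gen_mul, DL, LinearMap.add_apply, map_add, lid_rTensor_map]; rfl
lemma ra_b : ra P φ (gb * u) = gb * ra P (tw P (act P a φ)) u + gd * ra P (act P b φ) u := by
  simp only [ra_apply, comul_gen_mul, DL, LinearMap.add_apply, map_add, lid_rTensor_map]; rfl
lemma ra_c : ra P φ (gc * u) = ga * ra P (act P c φ) u + gc * ra P (tw P (act P d φ)) u := by
  simp only [ra_apply, comul_gen_mul, DL, LinearMap.add_apply, map_add, lid_rTensor_map]; rfl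
lemma ra_d : ra P φ (gd * u) = gb * ra P (tw P (act P c φ)) u + gd * ra P (act P d φ) u := by
  simp only [ra_apply, comul_gen_mul, DL, LinearMap.add_apply, map_add, lid_rTensor_map]; rfl
lemma ra_σ : ra P φ (gσ * u) = gσ * ra P (act P σ φ) u := by
  simp only [ra_apply, comul_gen_mul, DL, lid_rTensor_map]; rfl

lemma la_a : la P φ (ga * u) =
    ga * la P (act P a φ) u + gb * parity P (la P (act P c φ) u) := by
  simp only [la_apply, comul_gen_mul, DL, LinearMap.add_apply, map_add, rid_lTensor_map]; rfl
lemma la_b : la P φ (gb * u) =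
    ga * parity P (la P (act P b φ) u) + gb * la P (act P d φ) u := by
  simp only [la_apply, comul_gen_mul, DL, LinearMap.add_apply, map_add, rid_lTensor_map]; rfl
lemma la_c : la P φ (gc * u) =
    gc * la P (act P a φ) u + gd * parity P (la P (act P c φ) u) := by
  simp only [la_apply, comul_gen_mul, DL, LinearMap.add_apply, map_add, rid_lTensor_map]; rfl
lemma la_d : la P φ (gd * u) =
    gc * parity P (la P (act P b φ) u) + gd * la P (act P d φ) u := by
  simp only [la_apply, comul_gen_mul, DL, LinearMap.add_apply, map_add, rid_lTensor_map]; rfl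
lemma la_σ : la P φ (gσ * u) = gσ * la P (act P σ φ) u := by
  simp only [la_apply, comul_gen_mul, DL, rid_lTensor_map]; rfl

lemma ra_at_one : ra P φ 1 = φ.ofConv 1 • 1 := by
  rw [ra_apply, comul_one]; simp
lemma la_at_one : la P φ 1 = φ.ofConv 1 • 1 := by
  rw [la_apply, comul_one]; simp

end generator_formulas

/-! ### The two translation actions and their compatibility -/

lemma ra_one : ra P 1 = LinearMap.id := by
  ext u
  rw [ra_apply, show (1 : D P).ofConv = Coalgebra.counit from rfl,
    Coalgebra.rTensor_counit_comul]
  simp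

lemma la_one : la P 1 = LinearMap.id := by
  ext u
  rw [la_apply, show (1 : D P).ofConv = Coalgebra.counit from rfl,
    Coalgebra.lTensor_counit_comul]
  simp

/-- Coassociativity. The factor φ sees the first leg and acts first, so `ra` reverses products,
while `la` below preserves them. -/
lemma ra_mul (φ ψ : D P) (u : A P) : ra P (φ * ψ) u = ra P ψ (ra P φ u) := by
  have h := Coalgebra.coassoc_apply (R := ℂ) u
  have key : ∀ X : A P ⊗[ℂ] A P, ra P ψ (TensorProduct.lid ℂ (A P)
      (LinearMap.rTensor (A P) φ.ofConv X)) =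
      TensorProduct.lid ℂ (A P) (map φ.ofConv ((TensorProduct.lid ℂ (A P)).toLinearMap ∘ₗ
        LinearMap.rTensor (A P) ψ.ofConv) (LinearMap.lTensor (A P) Coalgebra.comul X)) := by
    intro X
    induction X using TensorProduct.induction_on with
    | zero => simp
    | tmul u v => simp [ra_apply]
    | add X Y hX hY => simp only [map_add, hX, hY]
  have key2 : ∀ X : A P ⊗[ℂ] A P, TensorProduct.lid ℂ (A P)
      (LinearMap.rTensor (A P) (φ * ψ).ofConv X) =
      TensorProduct.lid ℂ (A P) (map φ.ofConv ((TensorProduct.lid ℂ (A P)).toLinearMap ∘ₗ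
        LinearMap.rTensor (A P) ψ.ofConv) (TensorProduct.assoc ℂ _ _ _
          (LinearMap.rTensor (A P) Coalgebra.comul X))) := by
    intro X
    induction X using TensorProduct.induction_on with
    | zero => simp
    | tmul u v =>
      simp only [LinearMap.rTensor_tmul, mul_aux]
      generalize Coalgebra.comul (R := ℂ) u = Y
      induction Y using TensorProduct.induction_on with
      | zero => simp
      | tmul u v => simpa [mul_smul] using smul_comm _ _ _
      | add X Y hX hY => simp only [map_add, hX, hY, add_tmul]
    | add X Y hX hY => simp only [map_add, hX, hY]
  rw [ra_apply P φ, key, ra_apply, key2, h]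

lemma la_mul (φ ψ : D P) (u : A P) : la P (φ * ψ) u = la P φ (la P ψ u) := by
  have h := Coalgebra.coassoc_apply (R := ℂ) u
  have key : ∀ X : A P ⊗[ℂ] A P, la P φ (TensorProduct.rid ℂ (A P)
      (LinearMap.lTensor (A P) ψ.ofConv X)) =
      TensorProduct.rid ℂ (A P) (LinearMap.lTensor (A P) (LinearMap.mul' ℂ ℂ ∘ₗ
        map φ.ofConv ψ.ofConv) (TensorProduct.assoc ℂ _ _ _
          (LinearMap.rTensor (A P) Coalgebra.comul X))) := by
    intro X
    induction X using TensorProduct.induction_on with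
    | zero => simp
    | tmul u v =>
      simp only [LinearMap.rTensor_tmul, LinearMap.lTensor_tmul, TensorProduct.rid_tmul, map_smul,
        la_apply]
      generalize Coalgebra.comul (R := ℂ) u = Y
      induction Y using TensorProduct.induction_on with
      | zero => simp
      | tmul u v => simp [smul_smul, mul_comm]
      | add X Y hX hY => simp only [map_add, hX, hY, add_tmul, smul_add]
    | add X Y hX hY => simp only [map_add, hX, hY]
  rw [la_apply P ψ, key, h, la_apply]
  congr 1
  rw [← LinearMap.lTensor_comp_apply]
  rfl

/-- Coassociativity again: the two operators use the outer legs of the iterated coproduct. This lets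
formulas for the first-leg action pass through powers of `LF`. -/
lemma ra_la_comm (φ ψ : D P) (u : A P) : ra P φ (la P ψ u) = la P ψ (ra P φ u) := by
  have h := Coalgebra.coassoc_apply (R := ℂ) u
  have key : ∀ X : A P ⊗[ℂ] A P, ra P φ (TensorProduct.rid ℂ (A P)
      (LinearMap.lTensor (A P) ψ.ofConv X)) =
      TensorProduct.lid ℂ (A P) (map φ.ofConv ((TensorProduct.rid ℂ (A P)).toLinearMap ∘ₗ
        LinearMap.lTensor (A P) ψ.ofConv) (TensorProduct.assoc ℂ _ _ _
          (LinearMap.rTensor (A P) Coalgebra.comul X))) := by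
    intro X
    induction X using TensorProduct.induction_on with
    | zero => simp
    | tmul u v =>
      simp only [LinearMap.rTensor_tmul, LinearMap.lTensor_tmul, TensorProduct.rid_tmul, map_smul,
        ra_apply]
      generalize Coalgebra.comul (R := ℂ) u = Y
      induction Y using TensorProduct.induction_on with
      | zero => simp
      | tmul u v => simp [smul_smul, mul_comm]
      | add X Y hX hY => simp only [map_add, hX, hY, add_tmul, smul_add]
    | add X Y hX hY => simp only [map_add, hX, hY]
  have key2 : ∀ X : A P ⊗[ℂ] A P, la P ψ (TensorProduct.lid ℂ (A P)
      (LinearMap.rTensor (A P) φ.ofConv X)) =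
      TensorProduct.lid ℂ (A P) (map φ.ofConv ((TensorProduct.rid ℂ (A P)).toLinearMap ∘ₗ
        LinearMap.lTensor (A P) ψ.ofConv) (LinearMap.lTensor (A P) Coalgebra.comul X)) := by
    intro X
    induction X using TensorProduct.induction_on with
    | zero => simp
    | tmul u v => simp [la_apply]
    | add X Y hX hY => simp only [map_add, hX, hY]
  rw [la_apply P ψ u, key, ra_apply P φ u, key2, h]

/-- A functional is recovered from its translation operator, so values of convolution products can
be computed by composing operators. -/
lemma counit_ra (φ : D P) (u : A P) : counitHom P (ra P φ u) = φ.ofConv u := by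
  have : (φ * 1).ofConv u = counitHom P (ra P φ u) := by
    rw [mul_aux, ra_apply]
    generalize Coalgebra.comul (R := ℂ) u = Y
    induction Y using TensorProduct.induction_on with
    | zero => simp
    | tmul u v => simp; left; rfl
    | add X Y hX hY => simp only [map_add, hX, hY]
  rw [← this, D_mul_one]

lemma counit_la (φ : D P) (u : A P) : counitHom P (la P φ u) = φ.ofConv u := by
  have : (1 * φ).ofConv u = counitHom P (la P φ u) := by
    rw [mul_aux, la_apply]
    generalize Coalgebra.comul (R := ℂ) u = Y
    induction Y using TensorProduct.induction_on with
    | zero => simp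
    | tmul u v => simp [mul_comm, ← counit_eq]
    | add X Y hX hY => simp only [map_add, hX, hY]
  rw [← this, D_one_mul]

/-! ### The generators acting through either leg -/

/-- The action of the generators `e`, `f`, `k`, `k⁻¹` through the first leg. -/
abbrev RE : A P →ₗ[ℂ] A P := ra P (eD P)
/-- The action of `f` through the first leg. -/
abbrev RF : A P →ₗ[ℂ] A P := ra P (fD P)
/-- The action of `k` through the first leg. -/
abbrev RK : A P →ₗ[ℂ] A P := ra P (kD P)
/-- The action of `k⁻¹` through the first leg. -/
abbrev RKi : A P →ₗ[ℂ] A P := ra P (kinvD P)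
/-- The action of `e` through the second leg. -/
abbrev LE : A P →ₗ[ℂ] A P := la P (eD P)
/-- The action of `f` through the second leg. -/
abbrev LF : A P →ₗ[ℂ] A P := la P (fD P)
/-- The action of `k` through the second leg. -/
abbrev LK : A P →ₗ[ℂ] A P := la P (kD P)
/-- The action of `k⁻¹` through the second leg. -/
abbrev LKi : A P →ₗ[ℂ] A P := la P (kinvD P)

/-- Left multiplication by a generator intertwines the translation operators in the way that the
coproducts of `e`, `f`, `k` prescribe. -/
lemma translate_mul (u : A P) :
    (RE P (ga * u) = P.t • (ga * RE P u) + κ P • (gc * u) ∧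
     RE P (gb * u) = κ P • (gd * u) - P.t • (gb * RE P u) ∧
     RE P (gc * u) = P.t⁻¹ • (gc * RE P u) ∧
     RE P (gd * u) = -P.t⁻¹ • (gd * RE P u) ∧
     RE P (gσ * u) = -(gσ * RE P u)) ∧
    (RF P (ga * u) = ga * RF P u ∧
     RF P (gb * u) = -(gb * RF P u) ∧
     RF P (gc * u) = ga * RKi P u - gc * RF P u ∧
     RF P (gd * u) = gb * RKi P u + gd * RF P u ∧
     RF P (gσ * u) = gσ * RF P u) ∧
    (RK P (ga * u) = P.t • (ga * RK P u) ∧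
     RK P (gb * u) = P.t • (gb * RK P u) ∧
     RK P (gc * u) = -P.t⁻¹ • (gc * RK P u) ∧
     RK P (gd * u) = -P.t⁻¹ • (gd * RK P u) ∧
     RK P (gσ * u) = -(gσ * RK P u)) ∧
    (RKi P (ga * u) = P.t⁻¹ • (ga * RKi P u) ∧
     RKi P (gb * u) = P.t⁻¹ • (gb * RKi P u) ∧
     RKi P (gc * u) = -P.t • (gc * RKi P u) ∧
     RKi P (gd * u) = -P.t • (gd * RKi P u) ∧
     RKi P (gσ * u) = -(gσ * RKi P u)) ∧
    (LE P (ga * u) = P.t • (ga * LE P u) ∧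
     LE P (gb * u) = κ P • (ga * parity P u) - P.t⁻¹ • (gb * LE P u) ∧
     LE P (gc * u) = P.t • (gc * LE P u) ∧
     LE P (gd * u) = κ P • (gc * parity P u) - P.t⁻¹ • (gd * LE P u) ∧
     LE P (gσ * u) = -(gσ * LE P u)) ∧
    (LF P (ga * u) = ga * LF P u + gb * parity P (LKi P u) ∧
     LF P (gb * u) = gb * LF P u ∧
     LF P (gc * u) = gc * LF P u + gd * parity P (LKi P u) ∧
     LF P (gd * u) = gd * LF P u ∧
     LF P (gσ * u) = gσ * LF P u) ∧
    (LK P (ga * u) = P.t • (ga * LK P u) ∧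
     LK P (gb * u) = -P.t⁻¹ • (gb * LK P u) ∧
     LK P (gc * u) = P.t • (gc * LK P u) ∧
     LK P (gd * u) = -P.t⁻¹ • (gd * LK P u) ∧
     LK P (gσ * u) = -(gσ * LK P u)) ∧
    (LKi P (ga * u) = P.t⁻¹ • (ga * LKi P u) ∧
     LKi P (gb * u) = -P.t • (gb * LKi P u) ∧
     LKi P (gc * u) = P.t⁻¹ • (gc * LKi P u) ∧
     LKi P (gd * u) = -P.t • (gd * LKi P u) ∧
     LKi P (gσ * u) = -(gσ * LKi P u)) := by
  have hz : tw P 0 = 0 := rfl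
  refine ⟨⟨?_, ?_, ?_, ?_, ?_⟩, ⟨?_, ?_, ?_, ?_, ?_⟩, ⟨?_, ?_, ?_, ?_, ?_⟩, ⟨?_, ?_, ?_, ?_, ?_⟩,
    ⟨?_, ?_, ?_, ?_, ?_⟩, ⟨?_, ?_, ?_, ?_, ?_⟩, ⟨?_, ?_, ?_, ?_, ?_⟩, ⟨?_, ?_, ?_, ?_, ?_⟩⟩
  all_goals
    simp [ra_a, ra_b, ra_c, ra_d, ra_σ, la_a, la_b, la_c, la_d, la_σ, act_e, act_f, act_k,
      act_kinv, tw_e, tw_f, tw_k, tw_kinv, tw_one, tw_add, tw_smul, tw_neg, tw_zero, ra_one, la_one,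
      mul_add, add_comm, sub_eq_add_neg]

@[simp] lemma RE_at_one : RE P 1 = 0 := by rw [ra_at_one, eD_one, zero_smul]
@[simp] lemma RF_at_one : RF P 1 = 0 := by rw [ra_at_one, fD_one, zero_smul]
@[simp] lemma RK_at_one : RK P 1 = 1 := by rw [ra_at_one, kD_one, one_smul]
@[simp] lemma LE_at_one : LE P 1 = 0 := by rw [la_at_one, eD_one, zero_smul]
@[simp] lemma LF_at_one : LF P 1 = 0 := by rw [la_at_one, fD_one, zero_smul]
@[simp] lemma LK_at_one : LK P 1 = 1 := by rw [la_at_one, kD_one, one_smul]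
@[simp] lemma LKi_at_one : LKi P 1 = 1 := by rw [la_at_one, kinvD_one, one_smul]

/-- The graded flip followed by pairing with an odd functional. -/
lemma L_eq_of_odd (x : U P) (hx : tw P (pairing P x) = -pairing P x) (u : A P) :
    L P x u = parity P (la P (pairing P x) u) := by
  set φ := pairing P x with hφ
  have hodd : ∀ v : A P, parity P v = v → φ.ofConv v = 0 := by
    intro v hv
    have h1 := LinearMap.congr_fun (congrArg ofConv hx) v
    change φ.ofConv (parity P v) = -φ.ofConv v at h1
    rw [hv] at h1
    linear_combination h1 / 2
  -- Only odd u₂ pair nontrivially with φ, and for odd u₂ the sign of the graded flip is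
  -- (-1)^{p(u₁)}, that is, the parity automorphism applied to u₁.
  have key : ∀ X : A P ⊗[ℂ] A P, TensorProduct.lid ℂ (A P) (LinearMap.rTensor (A P) φ.ofConv
      ((GradedTensorProduct.of ℂ (grading P) (grading P)).symm
        (GradedTensorProduct.comm (grading P) (grading P)
          (GradedTensorProduct.of ℂ (grading P) (grading P) X)))) =
      parity P (TensorProduct.rid ℂ (A P) (LinearMap.lTensor (A P) φ.ofConv X)) := by
    intro X
    induction X using TensorProduct.induction_on with
    | zero => simp
    | add X Y hX hY => simp only [map_add, hX, hY]
    | tmul u v =>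
      have hom : ∀ i j, ∀ u ∈ grading P i, ∀ v ∈ grading P j,
          TensorProduct.lid ℂ (A P) (LinearMap.rTensor (A P) φ.ofConv
          ((GradedTensorProduct.of ℂ (grading P) (grading P)).symm
          (GradedTensorProduct.comm (grading P) (grading P)
          (GradedTensorProduct.of ℂ (grading P) (grading P) (u ⊗ₜ v))))) =
          parity P (TensorProduct.rid ℂ (A P) (LinearMap.lTensor (A P) φ.ofConv (u ⊗ₜ v))) := by
        intro i j u hu v hv
        have hc := GradedTensorProduct.comm_coe_tmul_coe (R := ℂ) (grading P) (grading P)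
          ⟨u, hu⟩ ⟨v, hv⟩
        change GradedTensorProduct.comm (grading P) (grading P)
          (GradedTensorProduct.of ℂ (grading P) (grading P) (u ⊗ₜ v)) =
          (-1 : ℤˣ) ^ (j * i) • (GradedTensorProduct.of ℂ (grading P) (grading P) (v ⊗ₜ u)) at hc
        rw [hc]
        obtain rfl | rfl := zmod_two_cases j
        · rw [zero_mul, uzpow_zero, one_smul]
          simp [hodd v ((mem_zero P).1 hv)]
        · obtain rfl | rfl := zmod_two_cases i
          · rw [mul_zero, uzpow_zero, one_smul]
            simp [(mem_zero P).1 hu]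
          · rw [mul_one, uzpow_one, Units.neg_smul, one_smul]
            simp [(mem_one P).1 hu]
      have hu : u = (2⁻¹ : ℂ) • (u + parity P u) + (2⁻¹ : ℂ) • (u - parity P u) := by module
      have hv : v = (2⁻¹ : ℂ) • (v + parity P v) + (2⁻¹ : ℂ) • (v - parity P v) := by module
      rw [hu, hv, add_tmul, tmul_add, tmul_add]
      simp only [map_add]
      rw [hom 0 0 _ (even_mem P u) _ (even_mem P v), hom 0 1 _ (even_mem P u) _ (odd_mem P v),
        hom 1 0 _ (odd_mem P u) _ (even_mem P v), hom 1 1 _ (odd_mem P u) _ (odd_mem P v)]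
  exact key (Coalgebra.comul u)

/-! ### Symmetric `t`-numbers -/

/-- From t⁴ = q²: a root of unity t would make q one as well. -/
lemma t_pow_ne_one {n : ℕ} (hn : 0 < n) : P.t ^ n ≠ 1 := by
  intro h
  apply P.q_pow_ne_one (2 * n) (by omega)
  have : P.q ^ (2 * n) = (P.t ^ n) ^ 4 := by
    rw [q_eq, (even_two_mul n).neg_pow, ← pow_mul, ← pow_mul]; congr 1; ring
  rw [this, h, one_pow]

lemma t_zpow_ne_one {n : ℤ} (hn : n ≠ 0) : P.t ^ n ≠ 1 := by
  intro h
  obtain h0 | h0 := lt_or_gt_of_ne hn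
  · obtain ⟨m, hm⟩ := Int.eq_ofNat_of_zero_le (show 0 ≤ -n by omega)
    apply t_pow_ne_one P (n := m) (by omega)
    rw [← zpow_natCast, ← hm, zpow_neg, h, inv_one]
  · obtain ⟨m, rfl⟩ := Int.eq_ofNat_of_zero_le h0.le
    exact t_pow_ne_one P (n := m) (by omega) (by simpa using h)

lemma t_sub_inv_ne_zero : P.t - P.t⁻¹ ≠ 0 := by
  intro h
  have ht := t_ne_zero P
  apply t_pow_ne_one P (n := 2) (by omega)
  field_simp at h
  linear_combination h

lemma t_zpow_sub_ne_zero {m : ℤ} (hm : m ≠ 0) : P.t ^ m - P.t ^ (-m) ≠ 0 := by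
  intro h
  have ht := t_ne_zero P
  apply t_zpow_ne_one P (n := 2 * m) (by omega)
  rw [zpow_neg, sub_eq_zero] at h
  rw [two_mul, zpow_add₀ ht]
  nth_rw 1 [h]
  exact inv_mul_cancel₀ (zpow_ne_zero _ ht)

/-- The symmetric `t`-number `[m] = (t^m - t^{-m}) / (t - t^{-1})`. -/
def br (m : ℤ) : ℂ := (P.t ^ m - P.t ^ (-m)) / (P.t - P.t⁻¹)

@[simp] lemma br_zero : br P 0 = 0 := by simp [br]
lemma br_ne_zero {m : ℤ} (hm : m ≠ 0) : br P m ≠ 0 :=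
  div_ne_zero (t_zpow_sub_ne_zero P hm) (t_sub_inv_ne_zero P)

/-- This recursion matches the twisted Leibniz rules for prepending an a; its mirror `br_succ'`
matches prepending a c under `RF`. -/
lemma br_succ (m : ℤ) : br P (m + 1) = P.t * br P m + P.t ^ (-m) := by
  have ht := t_ne_zero P
  have h := t_sub_inv_ne_zero P
  rw [br, br, div_eq_iff h, add_mul, mul_assoc, div_mul_cancel₀ _ h, neg_add, zpow_add₀ ht,
    zpow_add₀ ht, zpow_one, zpow_neg_one]
  ring

lemma br_succ' (m : ℤ) : br P (m + 1) = P.t⁻¹ * br P m + P.t ^ m := by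
  have ht := t_ne_zero P
  have h := t_sub_inv_ne_zero P
  rw [br, br, div_eq_iff h, add_mul, mul_assoc, div_mul_cancel₀ _ h, neg_add, zpow_add₀ ht,
    zpow_add₀ ht, zpow_one, zpow_neg_one]
  ring

lemma q_sub_inv_ne_zero : P.q - P.q⁻¹ ≠ 0 := by
  have hq := P.q_ne_zero
  intro h
  apply P.q_pow_ne_one 2 (by omega)
  field_simp at h
  linear_combination h

lemma κ_ne_zero : κ P ≠ 0 := div_ne_zero (t_sub_inv_ne_zero P) (q_sub_inv_ne_zero P)

/-! ### The comodules `V` -/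

lemma ca (u : A P) : gc * (ga * u) = P.t⁻¹ • (ga * (gc * u)) := by
  rw [← mul_assoc, ← mul_assoc, (gen_rep P).ac, smul_mul_assoc, smul_smul,
    inv_mul_cancel₀ (t_ne_zero P), one_smul]

lemma c_mul_a_pow (m : ℕ) (u : A P) :
    gc * (ga ^ m * u) = P.t ^ (-(m : ℤ)) • (ga ^ m * (gc * u)) := by
  induction m with
  | zero => simp
  | succ m ih =>
    rw [pow_succ', mul_assoc, ca, ih, mul_smul_comm, smul_smul, mul_assoc]
    congr 1
    push_cast
    rw [neg_add, zpow_add₀ (t_ne_zero P), zpow_neg_one, mul_comm]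

/-- The vector `a^m c^i`. -/
def xi (m i : ℕ) : A P := ga ^ m * gc ^ i

lemma xi_zero_zero : xi P 0 0 = 1 := by simp [xi]
lemma a_mul_xi (m i : ℕ) : ga * xi P m i = xi P (m + 1) i := by
  rw [xi, xi, pow_succ', mul_assoc]
lemma c_mul_xi (m i : ℕ) : gc * xi P m i = P.t ^ (-(m : ℤ)) • xi P m (i + 1) := by
  rw [xi, xi, c_mul_a_pow, ← pow_succ']
lemma c_mul_xi_zero (i : ℕ) : gc * xi P 0 i = xi P 0 (i + 1) := by
  simp [c_mul_xi]

/-- Induction along the vectors `a^m c^i`. -/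
lemma xi_induction {p : ℕ → ℕ → Prop} (h0 : p 0 0) (hc : ∀ i, p 0 i → p 0 (i + 1))
    (ha : ∀ m i, p m i → p (m + 1) i) (m i : ℕ) : p m i := by
  induction m with
  | zero => induction i with
    | zero => exact h0
    | succ i ih => exact hc i ih
  | succ m ih => exact ha m i ih

/-- The weight `(-1)^i t^{N - 2i}`. -/
def wt (N i : ℕ) : ℂ := (-1) ^ i * P.t ^ ((N : ℤ) - 2 * i)

lemma wt_ne_zero (N i : ℕ) : wt P N i ≠ 0 :=
  mul_ne_zero (pow_ne_zero _ (by norm_num)) (zpow_ne_zero _ (t_ne_zero P))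

lemma wt_succ (N i : ℕ) : wt P N (i + 1) = P.q⁻¹ * wt P N i := by
  have ht := t_ne_zero P
  rw [wt, wt, pow_succ, q_eq]
  rw [show (N : ℤ) - 2 * (i + 1 : ℕ) = (N - 2 * i) - 2 by push_cast; ring, zpow_sub₀ ht]
  rw [zpow_ofNat]
  field_simp

lemma RK_xi (m i : ℕ) : RK P (xi P m i) = wt P (m + i) i • xi P m i := by
  have ht := t_ne_zero P
  obtain ⟨-, -, ⟨h1, -, h3, -⟩, -⟩ := translate_mul P (xi P m i)
  induction m, i using xi_induction with
  | h0 => simp [xi_zero_zero, wt]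
  | hc i ih =>
    obtain ⟨-, -, ⟨-, -, h, -⟩, -⟩ := translate_mul P (xi P 0 i)
    rw [← c_mul_xi_zero, h, ih, mul_smul_comm, smul_smul]
    · congr 1
      simp only [wt]
      push_cast
      rw [show (0 : ℤ) + (i + 1) - 2 * (i + 1) = (0 + i - 2 * i) + (-1) by ring, zpow_add₀ ht,
        zpow_neg_one, pow_succ]
      ring
    all_goals simp [translate_mul]
  | ha m i ih =>
    obtain ⟨-, -, ⟨h, -⟩, -⟩ := translate_mul P (xi P m i)
    rw [← a_mul_xi, h, ih, mul_smul_comm, smul_smul]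
    · congr 1
      simp only [wt]
      push_cast
      rw [show (m : ℤ) + 1 + i - 2 * i = (m + i - 2 * i) + 1 by ring, zpow_add₀ ht, zpow_one]
      ring
    all_goals simp [translate_mul]

lemma RKi_RK (u : A P) : RKi P (RK P u) = u := by
  rw [← ra_mul, kD_mul_kinvD, ra_one, LinearMap.id_apply]

lemma LKi_LK (u : A P) : LKi P (LK P u) = u := by
  rw [← la_mul, kinvD_mul_kD, la_one, LinearMap.id_apply]

lemma RKi_xi (m i : ℕ) : RKi P (xi P m i) = (wt P (m + i) i)⁻¹ • xi P m i := by
  have h := RKi_RK P (xi P m i)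
  rw [RK_xi, map_smul] at h
  rw [← h, smul_smul, inv_mul_cancel₀ (wt_ne_zero P _ _), one_smul, h]

/-- e acts as a twisted derivation that annihilates c and turns an a into c. Moving that c past the
remaining a's produces the powers of t that add up to a t-number. -/
lemma RE_xi (m i : ℕ) : RE P (xi P m i) = (κ P * br P m) • xi P (m - 1) (i + 1) := by
  have ht := t_ne_zero P
  induction m, i using xi_induction with
  | h0 => simp [xi_zero_zero]
  | hc i ih =>
    obtain ⟨⟨-, -, h, -⟩, -⟩ := translate_mul P (xi P 0 i)
    rw [← c_mul_xi_zero, h, ih]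
    simp
  | ha m i ih =>
    obtain ⟨⟨h, -⟩, -⟩ := translate_mul P (xi P m i)
    rw [← a_mul_xi, h, ih, c_mul_xi, add_tsub_cancel_right, mul_smul_comm]
    push_cast
    rw [br_succ]
    rcases m with _ | m
    · simp
    · rw [a_mul_xi, Nat.add_sub_cancel, smul_smul, smul_smul, ← add_smul]
      congr 1
      push_cast
      ring

lemma RF_xi (m i : ℕ) : RF P (xi P m i) = ((-1) ^ (i + 1) * br P i) • xi P (m + 1) (i - 1) := by
  have ht := t_ne_zero P
  induction m, i using xi_induction with
  | h0 => simp [xi_zero_zero]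
  | hc i ih =>
    obtain ⟨-, ⟨-, -, h, -⟩, -⟩ := translate_mul P (xi P 0 i)
    rw [← c_mul_xi_zero, h, ih, RKi_xi, mul_smul_comm, mul_smul_comm, a_mul_xi, c_mul_xi,
      add_tsub_cancel_right]
    have hw : (wt P (0 + i) i)⁻¹ = (-1) ^ i * P.t ^ (i : ℤ) := by
      rw [wt, mul_inv, ← zpow_neg, ← inv_pow, inv_neg_one]
      congr 2
      push_cast
      ring
    rw [hw]
    push_cast
    rw [br_succ']
    rcases i with _ | i
    · simp
    · rw [Nat.add_sub_cancel, smul_smul, ← sub_smul]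
      congr 1
      push_cast
      simp only [Nat.cast_zero, zero_add, Int.reduceNeg, zpow_neg_one, pow_succ]
      ring
  | ha m i ih =>
    obtain ⟨-, ⟨h, -⟩, -⟩ := translate_mul P (xi P m i)
    rw [← a_mul_xi, h, ih, mul_smul_comm, a_mul_xi]

/-- The second-leg action of e kills a and c, so every a^m c^i is a highest weight vector for that
action. -/
lemma LE_xi (m i : ℕ) : LE P (xi P m i) = 0 := by
  induction m, i using xi_induction with
  | h0 => simp [xi_zero_zero]
  | hc i ih =>
    obtain ⟨-, -, -, -, ⟨-, -, h, -⟩, -⟩ := translate_mul P (xi P 0 i)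
    rw [← c_mul_xi_zero, h, ih, mul_zero, smul_zero]
  | ha m i ih =>
    obtain ⟨-, -, -, -, ⟨h, -⟩, -⟩ := translate_mul P (xi P m i)
    rw [← a_mul_xi, h, ih, mul_zero, smul_zero]

lemma LK_xi (m i : ℕ) : LK P (xi P m i) = wt P (m + i) 0 • xi P m i := by
  have ht := t_ne_zero P
  induction m, i using xi_induction with
  | h0 => simp [xi_zero_zero, wt]
  | hc i ih =>
    obtain ⟨-, -, -, -, -, -, ⟨-, -, h, -⟩, -⟩ := translate_mul P (xi P 0 i)
    rw [← c_mul_xi_zero, h, ih, mul_smul_comm, smul_smul]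
    congr 1
    simp [wt, zpow_add₀ ht, mul_comm]
  | ha m i ih =>
    obtain ⟨-, -, -, -, -, -, ⟨h, -⟩, -⟩ := translate_mul P (xi P m i)
    rw [← a_mul_xi, h, ih, mul_smul_comm, smul_smul]
    congr 1
    simp [wt, zpow_add₀ ht]
    ring

/-! ### The weight vectors -/

/-- The weight vector `f^j . a^m c^i` of the bicomodule of matrix elements. -/
def w (m i j : ℕ) : A P := ((LF P) ^ j) (xi P m i)

@[simp] lemma w_zero (m i : ℕ) : w P m i 0 = xi P m i := by simp [w]

lemma LF_w (m i j : ℕ) : LF P (w P m i j) = w P m i (j + 1) := by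
  rw [w, w, pow_succ']; rfl

/-- The two actions commute, so first-leg formulas known for j = 0 hold for every j with the same
constants. -/
lemma ra_w (φ : D P) (m i j : ℕ) : ra P φ (w P m i j) = ((LF P) ^ j) (ra P φ (xi P m i)) := by
  induction j with
  | zero => simp
  | succ j ih => rw [← LF_w, ra_la_comm, ih, pow_succ']; rfl

lemma RE_w (m i j : ℕ) : RE P (w P m i j) = (κ P * br P m) • w P (m - 1) (i + 1) j := by
  rw [ra_w, RE_xi, map_smul]; rfl

lemma RF_w (m i j : ℕ) :
    RF P (w P m i j) = ((-1) ^ (i + 1) * br P i) • w P (m + 1) (i - 1) j := by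
  rw [ra_w, RF_xi, map_smul]; rfl

lemma RK_w (m i j : ℕ) : RK P (w P m i j) = wt P (m + i) i • w P m i j := by
  rw [ra_w, RK_xi, map_smul]; rfl

lemma RKi_w (m i j : ℕ) : RKi P (w P m i j) = (wt P (m + i) i)⁻¹ • w P m i j := by
  rw [ra_w, RKi_xi, map_smul]; rfl

lemma LK_w (m i j : ℕ) : LK P (w P m i j) = wt P (m + i) j • w P m i j := by
  induction j with
  | zero => rw [w_zero, LK_xi]
  | succ j ih =>
    rw [← LF_w, ← la_mul, kD_mul_fD, map_smul, LinearMap.smul_apply, la_mul, ih, map_smul,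
      smul_smul, wt_succ]

lemma LKi_w (m i j : ℕ) : LKi P (w P m i j) = (wt P (m + i) j)⁻¹ • w P m i j := by
  have h := LKi_LK P (w P m i j)
  rw [LK_w, map_smul] at h
  rw [← h, smul_smul, inv_mul_cancel₀ (wt_ne_zero P _ _), one_smul, h]

/-- The structure constant of the raising operator. -/
def ec (N j : ℕ) : ℂ := κ P * (-1) ^ (j + 1) * br P j * br P (N + 1 - j)

/-- This is the recursion that ef + fe = (k - k⁻¹)/(q - q⁻¹) forces on the raising constants; the
minus sign comes from the anticommutator. -/
lemma ec_succ (N j : ℕ) : ec P N (j + 1) =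
    (P.q - P.q⁻¹)⁻¹ * (wt P N j - (wt P N j)⁻¹) - ec P N j := by
  have ht := t_ne_zero P
  have h1 := t_sub_inv_ne_zero P
  have h2 := q_sub_inv_ne_zero P
  have e1 : (-1 : ℂ) ^ (j + 1 + 1) = (-1) ^ j := by rw [pow_add, pow_add]; norm_num
  have hw : (wt P N j)⁻¹ = (-1) ^ j * (P.t ^ ((N : ℤ) - 2 * j))⁻¹ := by
    rw [wt, mul_inv, ← inv_pow, inv_neg_one]
  rw [hw, ec, ec, wt, e1, pow_succ, κ]
  generalize (-1 : ℂ) ^ j = s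
  rw [br, br, br, br]
  push_cast
  have hN : P.t ^ (N : ℤ) ≠ 0 := zpow_ne_zero _ ht
  have hj : P.t ^ (j : ℤ) ≠ 0 := zpow_ne_zero _ ht
  have a1 : P.t ^ ((N : ℤ) + 1 - (j + 1)) = P.t ^ (N : ℤ) / P.t ^ (j : ℤ) := by
    rw [← zpow_sub₀ ht]; congr 1; ring
  have a2 : P.t ^ ((N : ℤ) + 1 - j) = P.t * P.t ^ (N : ℤ) / P.t ^ (j : ℤ) := by
    rw [zpow_sub₀ ht, zpow_add₀ ht, zpow_one]; ring
  have a3 : P.t ^ ((j : ℤ) + 1) = P.t * P.t ^ (j : ℤ) := by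
    rw [zpow_add₀ ht, zpow_one]; ring
  have a4 : P.t ^ ((N : ℤ) - 2 * j) = P.t ^ (N : ℤ) / (P.t ^ (j : ℤ)) ^ 2 := by
    rw [zpow_sub₀ ht, mul_comm (2 : ℤ), zpow_mul]; norm_cast
  simp only [zpow_neg, a1, a2, a3, a4]
  generalize P.t ^ (N : ℤ) = X at *
  generalize P.t ^ (j : ℤ) = Y at *
  generalize hd : P.q - P.q⁻¹ = D at *
  have h3 : P.t ^ 2 - 1 ≠ 0 := by
    intro h; apply h1; field_simp; linear_combination h
  field_simp
  ring

/-- The highest weight computation: e is moved past one f at a time until it reaches a^m c^i, which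
it kills. -/
lemma LE_w (m i j : ℕ) : LE P (w P m i j) = ec P (m + i) j • w P m i (j - 1) := by
  induction j with
  | zero => rw [w_zero, LE_xi]; simp [ec]
  | succ j ih =>
    have h : LE P (LF P (w P m i j)) = (P.q - P.q⁻¹)⁻¹ • (LK P (w P m i j) - LKi P (w P m i j)) -
        LF P (LE P (w P m i j)) := by
      rw [← la_mul, ← la_mul, eq_sub_iff_add_eq, ← LinearMap.add_apply, ← map_add, eD_fD]
      simp
    rw [← LF_w, h, ih, LK_w, LKi_w, map_smul, LF_w, Nat.add_sub_cancel, ec_succ]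
    rcases j with _ | j
    · simp only [ec]; simp [smul_smul, ← sub_smul]
    · rw [Nat.add_sub_cancel]; simp only [smul_smul, ← sub_smul]

/-! ### Parity, and the matrix elements of the left coaction -/

lemma parity_la (φ : D P) (u : A P) : parity P (la P (tw P φ) u) = la P φ (parity P u) := by
  have h := LinearMap.congr_fun (comul_τ P) u
  simp only [LinearMap.comp_apply, AlgHom.toLinearMap_apply] at h
  rw [la_apply, la_apply, h, rid_lTensor_map]
  rfl

lemma parity_xi (m i : ℕ) : parity P (xi P m i) = (-1 : ℂ) ^ i • xi P m i := by
  simp only [xi, map_mul, map_pow, parity_a, parity_c, neg_pow (gc) i]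
  rw [Algebra.smul_def, map_pow, map_neg, map_one]
  exact ((Commute.neg_one_right _).pow_right i).left_comm _

lemma parity_w (m i j : ℕ) : parity P (w P m i j) = (-1 : ℂ) ^ (i + j) • w P m i j := by
  induction j with
  | zero => simp [parity_xi]
  | succ j ih =>
    have h := parity_la P (fD P) (w P m i j)
    rw [tw_f, map_neg, LinearMap.neg_apply, map_neg, ih, map_smul, LF_w] at h
    rw [← neg_inj, h, ← add_assoc, pow_succ]
    simp

lemma LF_pow_eq (j : ℕ) : (LF P) ^ j = la P (fD P ^ j) := by
  induction j with
  | zero => rw [pow_zero, pow_zero, la_one]; rfl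
  | succ j ih => ext u; rw [pow_succ', pow_succ', la_mul, ← ih]; rfl

/-- The value of `f^j` at `a^m c^j`. -/
def fval (j : ℕ) : ℂ := ∏ l ∈ Finset.range j, ((-1) ^ l * br P (l + 1))

lemma fval_ne_zero (j : ℕ) : fval P j ≠ 0 :=
  Finset.prod_ne_zero_iff.2 fun l _ => mul_ne_zero (pow_ne_zero _ (by norm_num))
    (br_ne_zero P (by omega))

lemma counit_xi (m i : ℕ) : counitHom P (xi P m i) = if i = 0 then 1 else 0 := by
  simp [xi, zero_pow_eq]

/-- The functionals f^j are dual, up to the nonzero `fval`, to the basis a^{N-l} c^l: each f turns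
one c into an a, and the counit kills whatever c is left. -/
lemma fD_pow_xi (j m l : ℕ) : (fD P ^ j).ofConv (xi P m l) = if j = l then fval P j else 0 := by
  induction j generalizing m l with
  | zero =>
    rw [pow_zero]
    refine (counit_xi P m l).trans ?_
    simp [fval, eq_comm]
  | succ j ih =>
    rw [pow_succ', ← counit_ra, ra_mul, counit_ra, RF_xi, map_smul, ih]
    rcases l with _ | l
    · simp
    · rw [Nat.add_sub_cancel]
      by_cases h : j = l
      · subst h
        simp only [if_true, fval, Finset.prod_range_succ]
        push_cast
        rw [pow_add, pow_add]
        simp [mul_comm]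
      · simp [h]

/-- The left coaction on `V` is through matrix elements. -/
lemma exists_matrix_elements (m i : ℕ) : ∃ μ : ℕ → A P, ∀ φ : D P, la P φ (xi P m i) =
    ∑ l ∈ Finset.range (m + i + 1), φ.ofConv (xi P (m + i - l) l) • μ l := by
  have step : ∀ (N : ℕ) (u u' x y : A P),
      (∀ φ : D P, la P φ u' = x * la P (act P a φ) u + y * parity P (la P (act P c φ) u)) →
      (∃ μ : ℕ → A P, ∀ φ : D P, la P φ u =
        ∑ l ∈ Finset.range (N + 1), φ.ofConv (xi P (N - l) l) • μ l) →
      ∃ μ : ℕ → A P, ∀ φ : D P, la P φ u' =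
        ∑ l ∈ Finset.range (N + 2), φ.ofConv (xi P (N + 1 - l) l) • μ l := by
    rintro N u u' x y h ⟨μ, hμ⟩
    -- Multiplying a^{N-l} c^l by a keeps l. Multiplying by c raises l by one and costs the power of
    -- t from moving c past the a's. The two `if`s remove the indices at which there is no such
    -- term.
    refine ⟨fun l => (if l = N + 1 then 0 else x * μ l) + (if l = 0 then 0 else
      P.t ^ (-((N + 1 - l : ℕ) : ℤ)) • (y * parity P (μ (l - 1)))), fun φ => ?_⟩
    simp only [smul_add, Finset.sum_add_distrib]
    rw [h, Finset.sum_range_succ, hμ, hμ, Finset.sum_range_succ' _ (N + 1)]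
    simp only [if_true, smul_zero, add_zero, Nat.succ_ne_zero, if_false, Finset.mul_sum, map_sum,
      map_smul, mul_smul_comm, Nat.add_sub_cancel]
    congr 1
    · refine Finset.sum_congr rfl fun l hl => ?_
      have hl' := Finset.mem_range.1 hl
      rw [if_neg (by omega), show N + 1 - l = (N - l) + 1 by omega, ← a_mul_xi]
      rfl
    · refine Finset.sum_congr rfl fun l hl => ?_
      rw [show N + 1 - (l + 1) = N - l by omega, smul_smul]
      congr 1
      change φ.ofConv (gc * xi P (N - l) l) = _
      rw [c_mul_xi, map_smul, smul_eq_mul, mul_comm]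
  induction m, i using xi_induction with
  | h0 =>
    refine ⟨fun _ => 1, fun φ => ?_⟩
    simp [xi_zero_zero, la_at_one]
  | hc i ih =>
    have := step (0 + i) (xi P 0 i) (xi P 0 (i + 1)) gc gd
      (fun φ => by rw [← c_mul_xi_zero, la_c]) ih
    simpa [add_assoc] using this
  | ha m i ih =>
    have := step (m + i) (xi P m i) (xi P (m + 1) i) ga gb
      (fun φ => by rw [← a_mul_xi, la_a]) ih
    rw [show m + 1 + i = m + i + 1 by omega]
    exact this

/-- The unknown matrix elements of the coaction are identified by testing on f^l: each is w m i l
divided by `fval`. -/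
lemma la_xi (φ : D P) (m i : ℕ) : la P φ (xi P m i) =
    ∑ l ∈ Finset.range (m + i + 1), (φ.ofConv (xi P (m + i - l) l) * (fval P l)⁻¹) • w P m i l := by
  obtain ⟨μ, hμ⟩ := exists_matrix_elements P m i
  rw [hμ]
  refine Finset.sum_congr rfl fun l hl => ?_
  have : w P m i l = fval P l • μ l := by
    rw [w, LF_pow_eq, hμ, Finset.sum_eq_single l]
    · rw [fD_pow_xi, if_pos rfl]
    · intro b _ hb
      rw [fD_pow_xi, if_neg (Ne.symm hb), zero_smul]
    · intro h; exact absurd hl h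
  rw [this, smul_smul, mul_assoc, inv_mul_cancel₀ (fval_ne_zero P l), mul_one]

/-- The lowering string from a^m c^i stops after m + i steps, because f^j vanishes on all words
a^{N-l} c^l with l < j. -/
lemma w_eq_zero {m i j : ℕ} (h : m + i < j) : w P m i j = 0 := by
  rw [w, LF_pow_eq, la_xi]
  refine Finset.sum_eq_zero fun l hl => ?_
  have := Finset.mem_range.1 hl
  rw [fD_pow_xi, if_neg (by omega), zero_mul, zero_smul]

/-! ### The group-like element `σ` -/

lemma ba (u : A P) : gb * (ga * u) = P.t⁻¹ • (ga * (gb * u)) := by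
  rw [← mul_assoc, ← mul_assoc, (gen_rep P).ab, smul_mul_assoc, smul_smul,
    inv_mul_cancel₀ (t_ne_zero P), one_smul]

lemma da (u : A P) : gd * (ga * u) = ga * (gd * u) - (P.t⁻¹ - P.t) • (gb * (gc * u)) := by
  simp only [← mul_assoc]
  rw [← smul_mul_assoc, ← (gen_rep P).ad_da, sub_mul, sub_sub_cancel]

lemma bc_eq (u : A P) : P.t • (gb * (gc * u)) = gσ * u - ga * (gd * u) := by
  rw [← (gen_rep P).ad_bc, add_mul, smul_mul_assoc, mul_assoc, mul_assoc, add_sub_cancel_left]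

/-- σ = ad + tbc plays the role of a quantum determinant: it commutes with the even generators and
anticommutes with the odd ones. This is checked on generators by reordering monomials. -/
lemma σ_mul (u : A P) : gσ * u = parity P u * gσ := by
  have h := gen_rep P
  have ht := t_ne_zero P
  have ba : gb * ga = P.t⁻¹ • (ga * gb) := by rw [h.ab, smul_smul, inv_mul_cancel₀ ht, one_smul]
  have ca : gc * ga = P.t⁻¹ • (ga * gc) := by rw [h.ac, smul_smul, inv_mul_cancel₀ ht, one_smul]
  have cb : gc * gb = -(gb * gc) := by rw [h.bc, neg_neg]
  have db : gd * gb = -P.t⁻¹ • (gb * gd) := by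
    rw [h.bd, smul_smul, neg_mul_neg, inv_mul_cancel₀ ht, one_smul]
  have dc : gd * gc = -P.t⁻¹ • (gc * gd) := by
    rw [h.cd, smul_smul, neg_mul_neg, inv_mul_cancel₀ ht, one_smul]
  have da : gd * ga = ga * gd - (P.t⁻¹ - P.t) • (gb * gc) := by rw [← h.ad_da, sub_sub_cancel]
  induction u using A_induction with
  | one => simp
  | add x y hx hy => simp [mul_add, hx, hy, add_mul]
  | smul r x hx => simp [hx]
  | mul g x hx =>
    suffices hg : gσ * gen P g = parity P (gen P g) * gσ by
      rw [← mul_assoc, hg, mul_assoc, hx, map_mul, mul_assoc]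
    have aux : ∀ x y z : A P, (x * y) * z = x * (y * z) := mul_assoc
    cases g
    case σ => simp
    all_goals
      rw [← h.ad_bc]
      simp only [add_mul, smul_mul_assoc, aux, mul_add, parity_a, parity_b, parity_c, parity_d,
        neg_mul, mul_smul_comm]
    · rw [da, ca, mul_sub, mul_smul_comm, mul_smul_comm, smul_smul, mul_inv_cancel₀ ht, one_smul,
        ← aux gb, ba, smul_mul_assoc, aux]
      module
    · rw [db, cb, mul_neg, mul_smul_comm, ← aux gb ga, ba, smul_mul_assoc, aux]
      module
    · rw [dc, mul_smul_comm, ← aux gc ga, ca, smul_mul_assoc, aux, ← aux gc gb, cb, neg_mul, aux]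
      module
    · rw [h.cd, mul_smul_comm, ← aux gb gd, h.bd, smul_mul_assoc, aux, ← aux gd ga, da, sub_mul,
        smul_mul_assoc, aux, aux]
      rw [h.cd, mul_smul_comm, ← aux gb gd, h.bd, smul_mul_assoc, aux]
      match_scalars <;> field_simp <;> ring

lemma σ_σ (u : A P) : gσ * (gσ * u) = u := by
  rw [← mul_assoc, ← pow_two, (gen_rep P).σσ, one_mul]

lemma σ_pow_σ_pow (s : ℕ) (u : A P) : gσ ^ s * (gσ ^ s * u) = u := by
  rw [← mul_assoc, ← pow_add, ← two_mul, pow_mul, (gen_rep P).σσ, one_pow, one_mul]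

lemma xi_mul_σ_pow (m i s : ℕ) :
    xi P m i * gσ ^ s = ((-1 : ℂ) ^ i) ^ s • (gσ ^ s * xi P m i) := by
  have h : xi P m i * gσ = (-1 : ℂ) ^ i • (gσ * xi P m i) := by
    rw [σ_mul, parity_xi, smul_mul_assoc, smul_smul, ← mul_pow]; norm_num
  induction s with
  | zero => simp
  | succ s ih =>
    rw [pow_succ, ← mul_assoc, ih, smul_mul_assoc, mul_assoc, h, mul_smul_comm, smul_smul,
      mul_assoc, ← pow_succ]

lemma la_σ_pow (φ : D P) (s : ℕ) (u : A P) :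
    la P φ (gσ ^ s * u) = gσ ^ s * la P ((act P σ)^[s] φ) u := by
  induction s generalizing φ with
  | zero => simp
  | succ s ih => rw [pow_succ', mul_assoc, la_σ, ih, mul_assoc, Function.iterate_succ_apply]

lemma act_σ_act_σ (φ : D P) : act P σ (act P σ φ) = φ := by
  refine D_ext P fun x => ?_
  change φ.ofConv (gσ * (gσ * x)) = _
  rw [σ_σ]

lemma act_σ_iterate (s : ℕ) (φ : D P) : (act P σ)^[s] ((act P σ)^[s] φ) = φ :=
  Function.LeftInverse.iterate (act_σ_act_σ P) s φ

/-! ### Coordinates on the bicomodules of matrix elements -/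

/-- The linear combination of the weight vectors with given coefficients. -/
def el (N : ℕ) : (ℕ → ℕ → ℂ) →ₗ[ℂ] A P where
  toFun C := ∑ i ∈ Finset.range (N + 1), ∑ j ∈ Finset.range (N + 1), C i j • w P (N - i) i j
  map_add' C C' := by simp [add_smul, Finset.sum_add_distrib]
  map_smul' r C := by simp [mul_smul, Finset.smul_sum]

lemma el_apply (N : ℕ) (C : ℕ → ℕ → ℂ) : el P N C =
    ∑ i ∈ Finset.range (N + 1), ∑ j ∈ Finset.range (N + 1), C i j • w P (N - i) i j := rfl

lemma w_mem_range_el {m i j : ℕ} : w P m i j ∈ LinearMap.range (el P (m + i)) := by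
  by_cases h : m + i < j
  · rw [w_eq_zero P h]; exact zero_mem _
  · refine ⟨fun i' j' => if i' = i ∧ j' = j then 1 else 0, ?_⟩
    rw [el_apply, Finset.sum_eq_single i, Finset.sum_eq_single j]
    · simp
    · intro b _ hb; simp [hb]
    · intro hj; simp at hj; omega
    · intro b _ hb; simp [hb]
    · intro hi; simp at hi

/-- Reduces the basis-free definition to coordinates: `la_xi` gives one inclusion, and w = f^j . a^m
c^i gives the other. -/
lemma M_eq (N s : ℕ) : M P N s = (LinearMap.range (el P N)).map (LinearMap.mulLeft ℂ (gσ ^ s)) := by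
  apply le_antisymm
  · rw [M, Submodule.span_le]
    rintro _ ⟨v, hv, φ, rfl⟩
    change la P (toConv φ) v ∈ _
    generalize toConv φ = ψ
    induction hv using Submodule.span_induction with
    | zero => rw [map_zero]; exact zero_mem _
    | add x y _ _ hx hy => rw [map_add]; exact add_mem hx hy
    | smul r x _ hx => rw [map_smul]; exact Submodule.smul_mem _ _ hx
    | mem x hx =>
      obtain ⟨⟨j, hj⟩, rfl⟩ := hx
      change la P ψ (xi P (N - j) j * gσ ^ s) ∈ _
      rw [xi_mul_σ_pow, map_smul, la_σ_pow, la_xi]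
      refine Submodule.smul_mem _ _ (Submodule.mem_map_of_mem (Submodule.sum_mem _ fun l _ =>
        Submodule.smul_mem _ _ ?_))
      have := w_mem_range_el P (m := N - j) (i := j) (j := l)
      rwa [Nat.sub_add_cancel (by omega)] at this
  · rintro _ ⟨_, ⟨C, rfl⟩, rfl⟩
    rw [el_apply, map_sum]
    refine Submodule.sum_mem _ fun i hi => ?_
    rw [map_sum]
    refine Submodule.sum_mem _ fun j _ => ?_
    rw [map_smul]
    refine Submodule.smul_mem _ _ (Submodule.subset_span ?_)
    have hi' := Finset.mem_range.1 hi
    -- The functional f^j is twisted in advance by σ^s, because `la_σ_pow` twists once more and the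
    -- twist by σ is an involution. The scalar undoes the sign from moving σ^s to the left.
    refine ⟨((-1 : ℂ) ^ i) ^ s • (xi P (N - i) i * gσ ^ s), Submodule.smul_mem _ _
      (Submodule.subset_span ⟨⟨i, hi'⟩, rfl⟩), ((act P σ)^[s] (fD P ^ j)).ofConv, ?_⟩
    change _ = la P ((act P σ)^[s] (fD P ^ j)) _
    rw [xi_mul_σ_pow, smul_smul, ← mul_pow, ← mul_pow]
    norm_num
    rw [la_σ_pow, act_σ_iterate, ← LF_pow_eq]
    rfl

/-! ### Linear independence of the weight vectors -/

/-- Eigenvectors with distinct eigenvalues are independent. -/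
lemma eq_zero_of_sum_eigenvectors {ι E : Type*} [AddCommGroup E] [Module ℂ E] (T : E →ₗ[ℂ] E)
    (μ : ι → ℂ) (v : ι → E) (hv : ∀ i, T (v i) = μ i • v i) (s : Finset ι)
    (hμ : ∀ i ∈ s, ∀ j ∈ s, μ i = μ j → i = j) (hs : ∑ i ∈ s, v i = 0) : ∀ i ∈ s, v i = 0 := by
  classical
  induction s using Finset.induction_on generalizing v with
  | empty => simp
  | insert k s hk ih =>
    have h1 : ∑ i ∈ s, (μ i - μ k) • v i = 0 := by
      have h2 := congrArg T hs
      rw [map_sum, map_zero, Finset.sum_insert hk] at h2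
      rw [Finset.sum_insert hk] at hs
      simp only [hv] at h2
      simp only [sub_smul, Finset.sum_sub_distrib, ← Finset.smul_sum]
      rw [eq_neg_of_add_eq_zero_right hs, eq_neg_of_add_eq_zero_right h2]
      simp
    have h3 := ih (fun i => (μ i - μ k) • v i)
      (fun i => by rw [map_smul, hv, smul_comm])
      (fun i hi j hj => hμ i (Finset.mem_insert_of_mem hi) j (Finset.mem_insert_of_mem hj)) h1
    have h4 : ∀ i ∈ s, v i = 0 := by
      intro i hi
      rcases smul_eq_zero.1 (h3 i hi) with h | h
      · exfalso
        apply hk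
        rw [← hμ i (Finset.mem_insert_of_mem hi) k (Finset.mem_insert_self _ _)
          (sub_eq_zero.1 h)]
        exact hi
      · exact h
    intro i hi
    rcases Finset.mem_insert.1 hi with rfl | hi
    · rwa [Finset.sum_insert hk, Finset.sum_eq_zero h4, add_zero] at hs
    · exact h4 i hi

lemma q_pow_inj {m n : ℕ} (h : P.q ^ m = P.q ^ n) : m = n := by
  have key : ∀ m n : ℕ, m < n → P.q ^ m ≠ P.q ^ n := by
    intro m n hmn h
    apply P.q_pow_ne_one (n - m) (by omega)
    apply mul_left_cancel₀ (pow_ne_zero m P.q_ne_zero)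
    rw [← pow_add, Nat.add_sub_cancel' hmn.le, mul_one, h]
  rcases lt_trichotomy m n with h' | h' | h'
  · exact absurd h (key _ _ h')
  · exact h'
  · exact absurd h.symm (key _ _ h')

lemma wt_eq (N i : ℕ) : wt P N i = (P.q⁻¹) ^ i * wt P N 0 := by
  induction i with
  | zero => simp
  | succ i ih => rw [wt_succ, ih, pow_succ']; ring

/-- `RF` lowers the exponent of c one step at a time, down to a power of a, on which the counit is
1. -/
lemma xi_ne_zero (m i : ℕ) : xi P m i ≠ 0 := by
  induction i generalizing m with
  | zero =>
    intro h
    have := counit_xi P m 0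
    rw [h, map_zero] at this
    simp at this
  | succ i ih =>
    intro h
    have h1 := RF_xi P m (i + 1)
    rw [h, map_zero, Nat.add_sub_cancel] at h1
    rcases smul_eq_zero.1 h1.symm with h2 | h2
    · exact mul_ne_zero (pow_ne_zero _ (by norm_num)) (br_ne_zero P (by omega)) h2
    · exact ih _ h2

lemma ec_ne_zero {N j : ℕ} (h0 : 0 < j) (h1 : j ≤ N) : ec P N j ≠ 0 := by
  refine mul_ne_zero (mul_ne_zero (mul_ne_zero (κ_ne_zero P) (pow_ne_zero _ (by norm_num)))
    (br_ne_zero P (by omega))) (br_ne_zero P (by omega))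

/-- Inside the string `LE` climbs back to a^m c^i with nonzero constants. -/
lemma w_ne_zero {m i j : ℕ} (h : j ≤ m + i) : w P m i j ≠ 0 := by
  induction j with
  | zero => rw [w_zero]; exact xi_ne_zero P m i
  | succ j ih =>
    intro h0
    have h1 := LE_w P m i (j + 1)
    rw [h0, map_zero, Nat.add_sub_cancel] at h1
    rcases smul_eq_zero.1 h1.symm with h2 | h2
    · exact ec_ne_zero P (by omega) h h2
    · exact ih (by omega) h2

lemma LK_pow_w (m i j s : ℕ) : ((LK P) ^ s) (w P m i j) = wt P (m + i) j ^ s • w P m i j := by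
  induction s with
  | zero => simp
  | succ s ih =>
    rw [pow_succ', Module.End.mul_apply, ih, map_smul, LK_w, smul_smul, ← pow_succ]

lemma el_eq_zero {N : ℕ} {C : ℕ → ℕ → ℂ} (h : el P N C = 0) {i j : ℕ} (hi : i ≤ N) (hj : j ≤ N) :
    C i j = 0 := by
  -- On w_{ij} the first-leg k contributes q^{-i} and the second-leg k contributes q^{-j}. Taking
  -- the latter to the power N + 1 gives the exponent j(N+1) + i, whose digits in base N + 1 recover
  -- the pair (i, j).
  have key := eq_zero_of_sum_eigenvectors (ι := ℕ × ℕ) (RK P ∘ₗ (LK P) ^ (N + 1))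
    (fun x => wt P (N - x.1 + x.1) x.2 ^ (N + 1) * wt P (N - x.1 + x.1) x.1)
    (fun x => C x.1 x.2 • w P (N - x.1) x.1 x.2)
    (fun x => by
      rw [map_smul, LinearMap.comp_apply, LK_pow_w, map_smul, RK_w, smul_smul, smul_smul, smul_smul]
      congr 1; ring)
    (Finset.range (N + 1) ×ˢ Finset.range (N + 1))
    (by
      rintro ⟨i, j⟩ hij ⟨i', j'⟩ hij' he
      simp only [Finset.mem_product, Finset.mem_range] at hij hij'
      simp only [Nat.sub_add_cancel (Nat.lt_succ_iff.1 hij.1),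
        Nat.sub_add_cancel (Nat.lt_succ_iff.1 hij'.1)] at he
      rw [wt_eq P N j, wt_eq P N i, wt_eq P N j', wt_eq P N i'] at he
      have hw := wt_ne_zero P N 0
      have hw' := pow_ne_zero (N + 1) hw
      rw [mul_pow, mul_pow] at he
      have he2 : (P.q⁻¹) ^ (j * (N + 1) + i) = (P.q⁻¹) ^ (j' * (N + 1) + i') := by
        rw [pow_add, pow_add, pow_mul, pow_mul]
        apply mul_right_cancel₀ (mul_ne_zero hw' hw)
        linear_combination he
      rw [inv_pow, inv_pow, inv_inj] at he2
      have he3 := q_pow_inj P he2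
      have hj : j = j' := by
        have h1 : (j * (N + 1) + i) / (N + 1) = j := by
          rw [mul_comm, Nat.mul_add_div (by omega), Nat.div_eq_of_lt hij.1, add_zero]
        have h2 : (j' * (N + 1) + i') / (N + 1) = j' := by
          rw [mul_comm, Nat.mul_add_div (by omega), Nat.div_eq_of_lt hij'.1, add_zero]
        rw [← h1, ← h2, he3]
      subst hj
      ext
      · simpa using he3
      · rfl)
    (by rw [Finset.sum_product]; exact h)
    (i, j) (by simp; omega)
  rcases smul_eq_zero.1 key with h | h
  · exact h
  · exact absurd h (w_ne_zero P (by simp only; omega))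

/-! ### The twisted primitive elements -/

/-- The right action of `x_{αβ}`. -/
def RX (α β : ℂ) : A P →ₗ[ℂ] A P := α • RE P + β • (RK P ∘ₗ RF P)

/-- The unsigned left action of `x_{αβ}`. -/
def LX (α β : ℂ) : A P →ₗ[ℂ] A P := α • LE P + β • (LF P ∘ₗ LK P)

lemma pairing_xElt (α β : ℂ) : pairing P (xElt P α β) = α • eD P + β • (fD P * kD P) := by
  have hp : ∀ g, pairing P (ugen P g) = UGen.rec (kD P) (kinvD P) (eD P) (fD P) g := by
    intro g
    simp only [pairing, ugen]
    refine (RingQuot.liftAlgHom_mkAlgHom_apply ..).trans ?_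
    cases g <;> simp
  rw [xElt, map_add, map_smul, map_smul, map_mul, hp, hp, hp]

lemma counitU_xElt (α β : ℂ) : counitU P (xElt P α β) = 0 := by
  have hp : ∀ g, counitU P (ugen P g) = UGen.rec 1 1 0 0 g := by
    intro g
    simp only [counitU, ugen]
    refine (RingQuot.liftAlgHom_mkAlgHom_apply ..).trans ?_
    cases g <;> simp
  rw [xElt, map_add, map_smul, map_smul, map_mul, hp, hp, hp]
  simp

/-- The product fk acts as `RK ∘ RF` because first-leg translation reverses products; on the other
side it acts as `LF ∘ LK`. -/
lemma R_xElt (α β : ℂ) : R P (xElt P α β) = RX P α β := by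
  change ra P (pairing P (xElt P α β)) = _
  rw [pairing_xElt]
  ext u
  simp [RX, ra_mul]

lemma tw_mul_k (φ : D P) : tw P (φ * kD P) = tw P φ * kD P := by
  refine D_ext P fun u => ?_
  conv_rhs => rw [← counit_la, la_mul, counit_la]
  change (φ * kD P).ofConv (parity P u) = φ.ofConv (parity P (la P (kD P) u))
  rw [← counit_la, la_mul, counit_la, ← parity_la, tw_k]

lemma L_xElt (α β : ℂ) (u : A P) : L P (xElt P α β) u = parity P (LX P α β u) := by
  rw [L_eq_of_odd, pairing_xElt]
  · congr 1
    simp [LX, la_mul]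
  · rw [pairing_xElt, tw_add, tw_smul, tw_smul, tw_mul_k, tw_e, tw_f, D_neg_mul]
    module

/-- The counit of x_{αβ} is zero, so both conditions say that an operator vanishes. The outer parity
in L is invertible and drops out. -/
lemma mem_sphericalFunctions (α β α' β' : ℂ) (W : Submodule ℂ (A P)) (u : A P) :
    u ∈ sphericalFunctions P (xElt P α β) (xElt P α' β') W ↔
      u ∈ W ∧ RX P α β u = 0 ∧ LX P α' β' u = 0 := by
  simp only [sphericalFunctions, Submodule.mem_inf, LinearMap.mem_eqLocus, counitU_xElt, R_xElt,
    L_xElt, zero_smul, LinearMap.zero_apply, and_assoc]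
  have : parity P (LX P α' β' u) = 0 ↔ LX P α' β' u = 0 :=
    ⟨fun h => by rw [← parity_parity P (LX P α' β' u), h, map_zero], fun h => by rw [h, map_zero]⟩
  rw [this]

lemma RX_σ (α β : ℂ) (u : A P) : RX P α β (gσ * u) = -(gσ * RX P α β u) := by
  simp [RX, translate_mul, mul_add]
  abel

lemma LX_σ (α β : ℂ) (u : A P) : LX P α β (gσ * u) = -(gσ * LX P α β u) := by
  simp [LX, translate_mul, mul_add]
  abel

lemma RX_σ_pow (α β : ℂ) (s : ℕ) (u : A P) :
    RX P α β (gσ ^ s * u) = (-1 : ℂ) ^ s • (gσ ^ s * RX P α β u) := by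
  induction s with
  | zero => simp
  | succ s ih =>
    rw [pow_succ', mul_assoc, RX_σ, ih, mul_smul_comm, pow_succ', mul_assoc]
    simp

lemma LX_σ_pow (α β : ℂ) (s : ℕ) (u : A P) :
    LX P α β (gσ ^ s * u) = (-1 : ℂ) ^ s • (gσ ^ s * LX P α β u) := by
  induction s with
  | zero => simp
  | succ s ih =>
    rw [pow_succ', mul_assoc, LX_σ, ih, mul_smul_comm, pow_succ', mul_assoc]
    simp

/-- e raises the row index and f lowers it. The two terms that would leave the range 0..N carry the
factor [0] = 0. -/
lemma RX_el (α β : ℂ) (N : ℕ) (C : ℕ → ℕ → ℂ) : RX P α β (el P N C) = el P N (fun p j =>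
    (if p = 0 then 0 else α * (κ P * br P (N - p + 1)) * C (p - 1) j) +
    (if p = N then 0 else β * ((-1) ^ p * br P (p + 1) * wt P N p) * C (p + 1) j)) := by
  have hl : ∀ i ∈ Finset.range (N + 1), ∀ j, RX P α β (C i j • w P (N - i) i j) =
      (α * (κ P * br P (N - i)) * C i j) • w P (N - (i + 1)) (i + 1) j +
      (β * ((-1) ^ (i + 1) * br P i * wt P N (i - 1)) * C i j) • w P (N - (i - 1)) (i - 1) j := by
    intro i hi j
    have hi' : i ≤ N := Nat.lt_succ_iff.1 (Finset.mem_range.1 hi)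
    rw [map_smul, RX, LinearMap.add_apply, LinearMap.smul_apply, LinearMap.smul_apply,
      LinearMap.comp_apply, RE_w, RF_w, map_smul, RK_w]
    rcases i with _ | i
    · simp [smul_smul, mul_comm, mul_left_comm]
    · rw [Nat.add_sub_cancel, show N - (i + 1) + 1 + i = N by omega,
        show N - (i + 1) + 1 = N - i by omega, Nat.sub_sub, Nat.cast_sub hi']
      push_cast
      module
  rw [el_apply, el_apply, map_sum]
  simp only [map_sum]
  rw [Finset.sum_congr rfl fun i hi => Finset.sum_congr rfl fun j _ => hl i hi j]
  simp only [add_smul, Finset.sum_add_distrib]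
  congr 1
  · rw [Finset.sum_range_succ]
    simp only [sub_self, br_zero, mul_zero, zero_mul, zero_smul, Finset.sum_const_zero]
    rw [Finset.sum_range_succ' _ N]
    simp only [zero_smul, if_true, Finset.sum_const_zero, Nat.succ_ne_zero, if_false,
      Nat.add_sub_cancel]
    refine congrArg (· + (0 : A P)) (Finset.sum_congr rfl fun i _ => Finset.sum_congr rfl fun j _ => ?_)
    push_cast
    rw [show (N : ℤ) - (i + 1) + 1 = N - i by ring]
  · rw [Finset.sum_range_succ']
    simp only [Nat.cast_zero, br_zero, mul_zero, zero_mul, zero_smul, Finset.sum_const_zero]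
    rw [Finset.sum_range_succ _ N]
    simp only [zero_smul, if_true, Finset.sum_const_zero, Nat.add_sub_cancel]
    refine congrArg (· + (0 : A P)) (Finset.sum_congr rfl fun i hi => Finset.sum_congr rfl fun j _ => ?_)
    rw [if_neg (Finset.mem_range.1 hi).ne, pow_succ, pow_succ]
    push_cast
    congr 2
    ring

/-- The same for the column index. The boundary terms vanish because w with j = N + 1 is zero and
the raising constant at j = 0 is zero. -/
lemma LX_el (α β : ℂ) (N : ℕ) (C : ℕ → ℕ → ℂ) : LX P α β (el P N C) = el P N (fun i p =>
    (if p = 0 then 0 else β * wt P N (p - 1) * C i (p - 1)) +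
    (if p = N then 0 else α * ec P N (p + 1) * C i (p + 1))) := by
  rw [el_apply, el_apply, map_sum]
  refine Finset.sum_congr rfl fun i hi => ?_
  have hi' : i ≤ N := Nat.lt_succ_iff.1 (Finset.mem_range.1 hi)
  have hl : ∀ j, LX P α β (C i j • w P (N - i) i j) =
      (β * wt P N j * C i j) • w P (N - i) i (j + 1) +
      (α * ec P N j * C i j) • w P (N - i) i (j - 1) := by
    intro j
    rw [map_smul, LX, LinearMap.add_apply, LinearMap.smul_apply, LinearMap.smul_apply,
      LinearMap.comp_apply, LE_w, LK_w, map_smul, LF_w, Nat.sub_add_cancel hi']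
    module
  simp only [map_sum, hl, add_smul, Finset.sum_add_distrib]
  congr 1
  · rw [Finset.sum_range_succ, Finset.sum_range_succ' _ N, w_eq_zero P (by omega)]
    simp
  · rw [Finset.sum_range_succ', Finset.sum_range_succ _ N]
    simp only [if_true, zero_smul, Nat.add_sub_cancel, add_zero]
    have : ec P N 0 = 0 := by simp [ec]
    rw [this]
    simp only [mul_zero, zero_mul, zero_smul, add_zero]
    exact Finset.sum_congr rfl fun j hj => by rw [if_neg (Finset.mem_range.1 hj).ne]

/-! ### Coefficients of spherical functions -/

section coefficients
variable {P} {α β α' β' : ℂ} {N : ℕ} {C : ℕ → ℕ → ℂ}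

lemma RX_coeff (h : RX P α β (el P N C) = 0) {p j : ℕ} (hp : p ≤ N) (hj : j ≤ N) :
    (if p = 0 then 0 else α * (κ P * br P (N - p + 1)) * C (p - 1) j) +
    (if p = N then 0 else β * ((-1) ^ p * br P (p + 1) * wt P N p) * C (p + 1) j) = 0 := by
  rw [RX_el] at h
  exact el_eq_zero P h hp hj

lemma LX_coeff (h : LX P α β (el P N C) = 0) {i p : ℕ} (hi : i ≤ N) (hp : p ≤ N) :
    (if p = 0 then 0 else β * wt P N (p - 1) * C i (p - 1)) +
    (if p = N then 0 else α * ec P N (p + 1) * C i (p + 1)) = 0 := by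
  rw [LX_el] at h
  exact el_eq_zero P h hi hp

lemma RX_const_ne_zero (hβ : β ≠ 0) (p : ℕ) :
    β * ((-1) ^ p * br P (p + 1) * wt P N p) ≠ 0 :=
  mul_ne_zero hβ (mul_ne_zero (mul_ne_zero (pow_ne_zero _ (by norm_num))
    (br_ne_zero P (by omega))) (wt_ne_zero P _ _))

/-- The equation in row 0 has only one neighbour, row 1, so row 1 vanishes; the recurrence in steps
of two then kills all odd rows. -/
lemma coeff_odd (hβ : β ≠ 0) (h : RX P α β (el P N C) = 0) {l j : ℕ} (hl : 2 * l + 1 ≤ N)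
    (hj : j ≤ N) : C (2 * l + 1) j = 0 := by
  induction l with
  | zero =>
    have := RX_coeff h (p := 0) (by omega) hj
    rw [if_pos rfl, if_neg (by omega), zero_add] at this
    exact (mul_eq_zero.1 this).resolve_left (RX_const_ne_zero hβ 0)
  | succ l ih =>
    have := RX_coeff h (p := 2 * l + 2) (by omega) hj
    rw [if_neg (by omega), if_neg (by omega), show 2 * l + 2 - 1 = 2 * l + 1 by omega,
      ih (by omega), mul_zero, zero_add] at this
    exact (mul_eq_zero.1 this).resolve_left (RX_const_ne_zero hβ _)

lemma coeff_eq_zero_left (hβ : β ≠ 0) (h : RX P α β (el P N C) = 0) {i j : ℕ} (hi : i ≤ N)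
    (hj : j ≤ N) (h0 : C 0 j = 0) : C i j = 0 := by
  obtain ⟨l, rfl | rfl⟩ : ∃ l, i = 2 * l ∨ i = 2 * l + 1 := ⟨i / 2, by omega⟩
  · induction l with
    | zero => exact h0
    | succ l ih =>
      have := RX_coeff h (p := 2 * l + 1) (by omega) hj
      rw [if_neg (by omega), if_neg (by omega), show 2 * l + 1 - 1 = 2 * l by omega,
        ih (by omega), mul_zero, zero_add] at this
      exact (mul_eq_zero.1 this).resolve_left (RX_const_ne_zero hβ _)
  · exact coeff_odd hβ h hi hj

lemma coeff_eq_zero_right (hα : α ≠ 0) (h : LX P α β (el P N C) = 0) {i j : ℕ} (hi : i ≤ N)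
    (hj : j ≤ N) (h0 : C i 0 = 0) : C i j = 0 := by
  induction j using Nat.strong_induction_on with
  | _ j ih =>
    rcases j with _ | j
    · exact h0
    · have := LX_coeff h hi (p := j) (by omega)
      rw [if_neg (show j ≠ N by omega)] at this
      have h1 : (if j = 0 then 0 else β * wt P N (j - 1) * C i (j - 1)) = 0 := by
        split_ifs with hj0
        · rfl
        · rw [ih (j - 1) (by omega) (by omega), mul_zero]
      rw [h1, zero_add] at this
      exact (mul_eq_zero.1 this).resolve_left
        (mul_ne_zero hα (ec_ne_zero P (by omega) (by omega)))

/-- The uniqueness statement: `LX` propagates the vanishing of the corner along row 0, and `RX` from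
row 0 to all the others. -/
lemma spherical_eq_zero (hβ : β ≠ 0) (hα' : α' ≠ 0) (hR : RX P α β (el P N C) = 0)
    (hL : LX P α' β' (el P N C) = 0) (h0 : C 0 0 = 0) : el P N C = 0 := by
  rw [el_apply]
  refine Finset.sum_eq_zero fun i hi => Finset.sum_eq_zero fun j hj => ?_
  rw [Finset.mem_range, Nat.lt_succ_iff] at hi hj
  rw [coeff_eq_zero_left hβ hR hi hj (coeff_eq_zero_right hα' hL (Nat.zero_le _) hj h0), zero_smul]

/-- One row equation and one column equation share the off-diagonal coefficient C (2l) (2l+2).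
Eliminating it links consecutive diagonal coefficients. The parameters enter only through the
normalized ratio, so they disappear. -/
lemma coeff_diag {n : ℕ} (hβ : β ≠ 0) (hα' : α' ≠ 0)
    (hv : α'⁻¹ * β' * α * β⁻¹ = 1) (hR : RX P α β (el P (2 * n) C) = 0)
    (hL : LX P α' β' (el P (2 * n) C) = 0) {l : ℕ} (hl : l < n) :
    br P (2 * l + 2) ^ 2 * br P (2 * n - 2 * l - 1) * C (2 * l + 2) (2 * l + 2) =
      P.q * br P (2 * n - 2 * l) * C (2 * l) (2 * l) := by
  have h1 := RX_coeff hR (p := 2 * l + 1) (j := 2 * l + 2) (by omega) (by omega)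
  have h2 := LX_coeff hL (i := 2 * l) (p := 2 * l + 1) (by omega) (by omega)
  rw [if_neg (by omega), if_neg (by omega)] at h1 h2
  rw [show 2 * l + 1 - 1 = 2 * l by omega] at h1 h2
  have hv' : β' * α = α' * β := by
    field_simp at hv
    exact hv
  have hw : wt P (2 * n) (2 * l) = P.q * wt P (2 * n) (2 * l + 1) := by
    rw [wt_succ, ← mul_assoc, mul_inv_cancel₀ P.q_ne_zero, one_mul]
  rw [hw, ec] at h2
  have e1 : (-1 : ℂ) ^ (2 * l + 1) = -1 := by rw [pow_succ, pow_mul]; norm_num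
  have e2 : (-1 : ℂ) ^ (2 * l + 1 + 1 + 1) = -1 := by rw [pow_succ, pow_succ, e1]; norm_num
  rw [e1] at h1
  rw [e2] at h2
  push_cast at h1 h2
  rw [show (2 * (n : ℤ) - (2 * l + 1) + 1) = 2 * n - 2 * l by ring,
    show (2 * (l : ℤ) + 1 + 1) = 2 * l + 2 by ring] at h1
  rw [show (2 * (n : ℤ) + 1 - (2 * l + 1 + 1)) = 2 * n - 2 * l - 1 by ring,
    show (2 * (l : ℤ) + 1 + 1) = 2 * l + 2 by ring] at h2
  rw [show 2 * l + 1 + 1 = 2 * l + 2 by ring] at h1 h2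
  have hwt := wt_ne_zero P (2 * n) (2 * l + 1)
  generalize wt P (2 * n) (2 * l + 1) = W at *
  generalize br P (2 * l + 2) = B at *
  generalize br P (2 * n - 2 * l - 1) = B1 at *
  generalize br P (2 * n - 2 * l) = B2 at *
  have hk := κ_ne_zero P
  generalize κ P = K at *
  generalize C (2 * l) (2 * l + 2) = Y at *
  have hne : α' * β * W ≠ 0 := mul_ne_zero (mul_ne_zero hα' hβ) hwt
  apply mul_left_cancel₀ hne
  linear_combination (-α' * B * B1) * h1 - α * B2 * h2 + P.q * W * B2 * C (2 * l) (2 * l) * hv'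

end coefficients

/-! ### Restriction to the torus -/

lemma torus_rep {z : ℂ} (hz : z ≠ 0) : IsARep P z 0 0 z⁻¹ 1 := by
  constructor <;> simp [hz]

/-- The character `a ↦ z`, `d ↦ z⁻¹`, `σ ↦ 1`, `b, c ↦ 0`. -/
def torus {z : ℂ} (hz : z ≠ 0) : A P →ₐ[ℂ] ℂ := liftA (torus_rep P hz)

section torus
variable {P} {z : ℂ} (hz : z ≠ 0)

@[simp] lemma torus_a : torus P hz ga = z := liftA_a _
@[simp] lemma torus_b : torus P hz gb = 0 := liftA_b _
@[simp] lemma torus_c : torus P hz gc = 0 := liftA_c _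
@[simp] lemma torus_d : torus P hz gd = z⁻¹ := liftA_d _
@[simp] lemma torus_σ : torus P hz gσ = 1 := liftA_σ _

/-- The character of the torus as an element of the dual algebra. -/
def torusD : D P := toConv (torus P hz).toLinearMap

lemma act_torus (s : AGen) : act P s (torusD hz) = torus P hz (gen P s) • torusD hz := by
  apply D_ext; intro x
  exact map_mul (torus P hz) (gen P s) x

lemma tw_torus : tw P (torusD hz) = torusD hz := by
  refine D_ext P fun x => ?_
  change torus P hz (parity P x) = torus P hz x
  induction x using A_induction with
  | one => simp
  | add x y hx hy => simp [hx, hy]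
  | smul r x hx => simp [hx]
  | mul g x hx => cases g <;> simp [hx]

lemma ra_torus_xi (m i : ℕ) : ra P (torusD hz) (xi P m i) = z ^ ((m : ℤ) - i) • xi P m i := by
  induction m, i using xi_induction with
  | h0 =>
    rw [xi_zero_zero, ra_at_one]
    simp [show (torusD hz).ofConv 1 = 1 from map_one (torus P hz)]
  | hc i ih =>
    rw [← c_mul_xi_zero, ra_c, act_torus, act_torus, torus_c, torus_d, tw_smul, tw_torus]
    simp only [map_smul, LinearMap.smul_apply, ih, zero_smul, map_zero, LinearMap.zero_apply,
      mul_zero, zero_add, mul_smul_comm,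
      smul_smul]
    congr 1
    rw [mul_comm, ← zpow_sub_one₀ hz]
    congr 1
    push_cast
    ring
  | ha m i ih =>
    rw [← a_mul_xi, ra_a, act_torus, act_torus, torus_a, torus_b, tw_smul, tw_torus]
    simp only [map_smul, LinearMap.smul_apply, ih, zero_smul, map_zero, LinearMap.zero_apply,
      mul_zero, add_zero, mul_smul_comm,
      smul_smul]
    congr 1
    rw [mul_comm, ← zpow_add_one₀ hz]
    congr 1
    push_cast
    ring

/-- The torus scales a^m c^i by z^{m-i}, and the value is that scalar times f^j(a^m c^i). So only
diagonal vectors survive. -/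
lemma torus_w (m i j : ℕ) : torus P hz (w P m i j) =
    if i = j then fval P i * z ^ ((m : ℤ) - i) else 0 := by
  rw [w, LF_pow_eq]
  change (torusD hz).ofConv _ = _
  rw [← counit_ra, ra_la_comm, counit_la, ra_torus_xi, map_smul, fD_pow_xi]
  by_cases h : i = j
  · subst h; simp [mul_comm]
  · simp [h, Ne.symm h]

lemma torus_el (N : ℕ) (C : ℕ → ℕ → ℂ) : torus P hz (el P N C) =
    ∑ i ∈ Finset.range (N + 1), C i i * fval P i * z ^ ((N : ℤ) - 2 * i) := by
  rw [el_apply, map_sum]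
  refine Finset.sum_congr rfl fun i hi => ?_
  have hi' : i ≤ N := Nat.lt_succ_iff.1 (Finset.mem_range.1 hi)
  rw [map_sum, Finset.sum_eq_single i]
  · rw [map_smul, torus_w, if_pos rfl, Nat.cast_sub hi', smul_eq_mul, mul_assoc]
    congr 3; ring
  · intro j _ hj
    rw [map_smul, torus_w, if_neg (Ne.symm hj), smul_zero]
  · intro h; exact absurd hi h

end torus

/-! ### The `q`-difference equation -/

/-- The Laurent polynomial `∑ G_l Z^{n - 2l}`. -/
def laurent (n : ℕ) (G : ℕ → ℂ) (Z : ℂ) : ℂ :=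
  ∑ l ∈ Finset.range (n + 1), G l * Z ^ ((n : ℤ) - 2 * l)

/-- The eigenvalue `q^{-n} - q^{n+1}` of the `q`-difference operator. -/
def chi (n : ℕ) : ℂ := (P.q ^ n)⁻¹ - P.q ^ (n + 1)

lemma sum_range_even (n : ℕ) (h : ℕ → ℂ) (hodd : ∀ l < n, h (2 * l + 1) = 0) :
    ∑ i ∈ Finset.range (2 * n + 1), h i = ∑ l ∈ Finset.range (n + 1), h (2 * l) := by
  induction n with
  | zero => simp
  | succ n ih =>
    rw [show 2 * (n + 1) + 1 = 2 * n + 1 + 1 + 1 by ring, Finset.sum_range_succ,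
      Finset.sum_range_succ, ih fun l hl => hodd l (by omega), hodd n (by omega), add_zero,
      Finset.sum_range_succ _ (n + 1)]
    rfl

/-- The coefficients of the restriction to the torus of a spherical function. -/
def torusCoeff (n : ℕ) (C : ℕ → ℕ → ℂ) (l : ℕ) : ℂ :=
  C (2 * l) (2 * l) * fval P (2 * l) * P.t ^ ((n : ℤ) - 2 * l)

section restriction
variable {P} {α β α' β' : ℂ} {n : ℕ} {C : ℕ → ℕ → ℂ}

/-- Only even indices contribute, so only powers of z² occur; z² = tZ then makes this a Laurent
polynomial in Z, with the powers of t absorbed in `torusCoeff`. -/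
lemma torus_spherical (hβ : β ≠ 0) (hR : RX P α β (el P (2 * n) C) = 0) {z Z : ℂ} (hz : z ≠ 0)
    (hZ : z ^ 2 = P.t * Z) : torus P hz (el P (2 * n) C) = laurent n (torusCoeff P n C) Z := by
  rw [torus_el, sum_range_even]
  · refine Finset.sum_congr rfl fun l _ => ?_
    rw [torusCoeff, mul_assoc, mul_assoc, mul_assoc, ← mul_zpow, ← hZ, ← zpow_natCast, ← zpow_mul]
    congr 3
    push_cast
    ring
  · intro l hl
    rw [coeff_odd hβ hR (by omega) (by omega), zero_mul, zero_mul]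

/-- This is `coeff_diag` with the t-numbers written out. The first bracket is q^{-n}(1 - q^{2l+2})(1
+ q^{2n-2l-1}), and the second is q^{-n}(1 + q^{2l+1})(q^{2n-2l} - 1). -/
lemma torusCoeff_succ (hβ : β ≠ 0) (hα' : α' ≠ 0)
    (hv : α'⁻¹ * β' * α * β⁻¹ = 1) (hR : RX P α β (el P (2 * n) C) = 0)
    (hL : LX P α' β' (el P (2 * n) C) = 0) {l : ℕ} (hl : l < n) :
    torusCoeff P n C (l + 1) *
        (P.q ^ ((n : ℤ) - 2 * l - 1) - P.q ^ (2 * (l : ℤ) + 2 - n) + chi P n) +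
      torusCoeff P n C l * (P.q ^ ((n : ℤ) - 2 * l) - P.q ^ (2 * (l : ℤ) + 1 - n) - chi P n) = 0 := by
  have ht := t_ne_zero P
  have hq := P.q_ne_zero
  have h := coeff_diag hβ hα' hv hR hL hl
  have hf : fval P (2 * (l + 1)) = -fval P (2 * l) * br P (2 * l + 1) * br P (2 * l + 2) := by
    rw [fval, fval, show 2 * (l + 1) = 2 * l + 1 + 1 by ring, Finset.prod_range_succ,
      Finset.prod_range_succ, pow_succ, pow_mul]
    push_cast
    rw [show 2 * (l : ℤ) + 1 + 1 = 2 * l + 2 by ring]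
    norm_num
  have hne : br P (2 * l + 2) ≠ 0 := br_ne_zero P (by omega)
  have h' : br P (2 * l + 2) * br P (2 * n - 2 * l - 1) * torusCoeff P n C (l + 1) =
      br P (2 * n - 2 * l) * br P (2 * l + 1) * torusCoeff P n C l := by
    rw [torusCoeff, torusCoeff, hf]
    have e : P.t ^ ((n : ℤ) - 2 * (l + 1 : ℕ)) = -P.q⁻¹ * P.t ^ ((n : ℤ) - 2 * l) := by
      rw [show (n : ℤ) - 2 * (l + 1 : ℕ) = (n - 2 * l) - 2 by push_cast; ring, zpow_sub₀ ht,
        zpow_ofNat, P.t_sq]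
      field_simp
    rw [e]
    have h2 : br P (2 * l + 2) ^ 2 * br P (2 * n - 2 * l - 1) * C (2 * (l + 1)) (2 * (l + 1)) =
      P.q * br P (2 * n - 2 * l) * C (2 * l) (2 * l) := h
    field_simp
    linear_combination fval P (2 * l) * br P (2 * l + 1) * h2
  have hT := t_sub_inv_ne_zero P
  have b : ∀ m : ℤ, br P m * (P.t - P.t⁻¹) * P.t ^ m = P.t ^ (2 * m) - 1 := by
    intro m
    rw [br, div_mul_cancel₀ _ hT, sub_mul, ← zpow_add₀ ht, ← zpow_add₀ ht, neg_add_cancel,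
      zpow_zero, two_mul]
  -- Since t² = -q, the parity of m decides the sign of q^m; the odd indices give the factors with a
  -- plus sign.
  have t2 : ∀ m : ℤ, P.t ^ (2 * m) = (-1) ^ m * P.q ^ m := by
    intro m
    rw [zpow_mul, zpow_ofNat, P.t_sq, ← mul_zpow, neg_one_mul]
  have s1 : ∀ m : ℤ, Even m → P.t ^ (2 * m) = P.q ^ m := by
    intro m hm; rw [t2, hm.neg_one_zpow, one_mul]
  have s2 : ∀ m : ℤ, Odd m → P.t ^ (2 * m) = -P.q ^ m := by
    intro m hm; rw [t2, hm.neg_one_zpow, neg_one_mul]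
  have b1 := b (2 * l + 2)
  have b2 := b (2 * n - 2 * l - 1)
  have b3 := b (2 * n - 2 * l)
  have b4 := b (2 * l + 1)
  rw [s1 _ ⟨l + 1, by ring⟩] at b1
  rw [s2 _ ⟨n - l - 1, by ring⟩] at b2
  rw [s1 _ ⟨n - l, by ring⟩] at b3
  rw [s2 _ ⟨l, by ring⟩] at b4
  have e1 : P.t ^ (2 * (l : ℤ) + 2) * P.t ^ (2 * (n : ℤ) - 2 * l - 1) = P.t ^ (2 * (n : ℤ) + 1) := by
    rw [← zpow_add₀ ht]; congr 1; ring
  have e2 : P.t ^ (2 * (n : ℤ) - 2 * l) * P.t ^ (2 * (l : ℤ) + 1) = P.t ^ (2 * (n : ℤ) + 1) := by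
    rw [← zpow_add₀ ht]; congr 1; ring
  have key : (P.q ^ (2 * (l : ℤ) + 2) - 1) * (-P.q ^ (2 * (n : ℤ) - 2 * l - 1) - 1) *
      torusCoeff P n C (l + 1) = (P.q ^ (2 * (n : ℤ) - 2 * l) - 1) * (-P.q ^ (2 * (l : ℤ) + 1) - 1) *
      torusCoeff P n C l := by
    rw [← b1, ← b2, ← b3, ← b4]
    generalize torusCoeff P n C (l + 1) = G1 at *
    generalize torusCoeff P n C l = G0 at *
    linear_combination (P.t - P.t⁻¹) ^ 2 * P.t ^ (2 * (n : ℤ) + 1) * h' +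
      (br P (2 * l + 2) * br P (2 * n - 2 * l - 1) * (P.t - P.t⁻¹) ^ 2 * G1) * e1 -
      (br P (2 * n - 2 * l) * br P (2 * l + 1) * (P.t - P.t⁻¹) ^ 2 * G0) * e2
  have z1 : P.q ^ (2 * (l : ℤ) + 2) = (P.q ^ l) ^ 2 * P.q ^ 2 := by
    rw [zpow_add₀ hq, mul_comm (2 : ℤ), zpow_mul]; norm_cast
  have z2 : P.q ^ (2 * (n : ℤ) - 2 * l - 1) = (P.q ^ n) ^ 2 / (P.q ^ l) ^ 2 / P.q := by
    rw [zpow_sub₀ hq, zpow_sub₀ hq, mul_comm (2 : ℤ), zpow_mul, mul_comm (2 : ℤ), zpow_mul]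
    norm_cast
    rw [pow_one]
  have z3 : P.q ^ (2 * (n : ℤ) - 2 * l) = (P.q ^ n) ^ 2 / (P.q ^ l) ^ 2 := by
    rw [zpow_sub₀ hq, mul_comm (2 : ℤ), zpow_mul, mul_comm (2 : ℤ), zpow_mul]; norm_cast
  have z4 : P.q ^ (2 * (l : ℤ) + 1) = (P.q ^ l) ^ 2 * P.q := by
    rw [zpow_add₀ hq, mul_comm (2 : ℤ), zpow_mul]; norm_cast; rw [pow_one]
  have z5 : P.q ^ ((n : ℤ) - 2 * l - 1) = P.q ^ n / (P.q ^ l) ^ 2 / P.q := by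
    rw [zpow_sub₀ hq, zpow_sub₀ hq, mul_comm (2 : ℤ), zpow_mul]; norm_cast; rw [pow_one]
  have z6 : P.q ^ (2 * (l : ℤ) + 2 - n) = (P.q ^ l) ^ 2 * P.q ^ 2 / P.q ^ n := by
    rw [zpow_sub₀ hq, z1]; norm_cast
  have z7 : P.q ^ ((n : ℤ) - 2 * l) = P.q ^ n / (P.q ^ l) ^ 2 := by
    rw [zpow_sub₀ hq, mul_comm (2 : ℤ), zpow_mul]; norm_cast
  have z8 : P.q ^ (2 * (l : ℤ) + 1 - n) = (P.q ^ l) ^ 2 * P.q / P.q ^ n := by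
    rw [zpow_sub₀ hq, z4]; norm_cast
  rw [z1, z2, z3, z4] at key
  rw [z5, z6, z7, z8, chi, pow_succ P.q n]
  have hX := pow_ne_zero n hq
  have hY := pow_ne_zero l hq
  generalize P.q ^ n = X at *
  generalize P.q ^ l = Y at *
  generalize torusCoeff P n C (l + 1) = G1 at *
  generalize torusCoeff P n C l = G0 at *
  field_simp at key ⊢
  linear_combination key

end restriction

/-- Compare coefficients: G l contributes to the exponents n - 2l + 2 and n - 2l with factors E l
and F l. The contributions of consecutive l cancel by hypothesis, and at the two ends E 0 = 0 and F
n = 0. -/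
lemma laurent_difference {n : ℕ} {G : ℕ → ℂ}
    (hG : ∀ l < n, G (l + 1) *
        (P.q ^ ((n : ℤ) - 2 * l - 1) - P.q ^ (2 * (l : ℤ) + 2 - n) + chi P n) +
      G l * (P.q ^ ((n : ℤ) - 2 * l) - P.q ^ (2 * (l : ℤ) + 1 - n) - chi P n) = 0)
    {Z : ℂ} (hZ : Z ≠ 0) :
    (1 + P.q * Z ^ 2) * laurent n G (P.q * Z) - (Z ^ 2 + P.q) * laurent n G (P.q⁻¹ * Z) =
      chi P n * ((1 - Z ^ 2) * laurent n G Z) := by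
  have hq := P.q_ne_zero
  set E : ℕ → ℂ := fun l => P.q ^ ((n : ℤ) - 2 * l + 1) - P.q ^ (2 * (l : ℤ) - n) + chi P n with hE
  set F : ℕ → ℂ := fun l => P.q ^ ((n : ℤ) - 2 * l) - P.q ^ (2 * (l : ℤ) + 1 - n) - chi P n with hF
  have hE0 : E 0 = 0 := by
    simp only [hE, chi, Nat.cast_zero, mul_zero, sub_zero, zero_sub, zpow_neg]
    norm_cast; ring
  have hFn : F n = 0 := by
    simp only [hF, chi]
    rw [show (n : ℤ) - 2 * n = -n by ring, show 2 * (n : ℤ) + 1 - n = n + 1 by ring, zpow_neg]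
    norm_cast; ring
  have hEF : ∀ l < n, G (l + 1) * E (l + 1) + G l * F l = 0 := by
    intro l hl
    have := hG l hl
    simp only [hE, hF]
    push_cast
    rw [show (n : ℤ) - 2 * (l + 1) + 1 = n - 2 * l - 1 by ring,
      show 2 * ((l : ℤ) + 1) - n = 2 * l + 2 - n by ring]
    exact this
  have h1 : (1 + P.q * Z ^ 2) * laurent n G (P.q * Z) - (Z ^ 2 + P.q) * laurent n G (P.q⁻¹ * Z) -
      chi P n * ((1 - Z ^ 2) * laurent n G Z) =
      ∑ l ∈ Finset.range (n + 1), (G l * E l * Z ^ ((n : ℤ) - 2 * l + 2) +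
        G l * F l * Z ^ ((n : ℤ) - 2 * l)) := by
    simp only [laurent, Finset.mul_sum]
    rw [← Finset.sum_sub_distrib, ← Finset.sum_sub_distrib]
    refine Finset.sum_congr rfl fun l _ => ?_
    have y1 : P.q ^ ((n : ℤ) - 2 * l + 1) = P.q ^ ((n : ℤ) - 2 * l) * P.q := by
      rw [zpow_add₀ hq, zpow_one]
    have y2 : P.q ^ (2 * (l : ℤ) - n) = (P.q ^ ((n : ℤ) - 2 * l))⁻¹ := by
      rw [← zpow_neg]; congr 1; ring
    have y3 : P.q ^ (2 * (l : ℤ) + 1 - n) = (P.q ^ ((n : ℤ) - 2 * l))⁻¹ * P.q := by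
      rw [← zpow_neg, ← zpow_add_one₀ hq]; congr 1; ring
    simp only [hE, hF]
    rw [mul_zpow, mul_zpow, inv_zpow, y1, y2, y3, zpow_add₀ hZ, zpow_ofNat]
    ring
  rw [← sub_eq_zero, h1, Finset.sum_add_distrib, Finset.sum_range_succ', Finset.sum_range_succ _ n,
    hE0, hFn, mul_zero, zero_mul, mul_zero, zero_mul, add_zero, add_zero, ← Finset.sum_add_distrib]
  refine Finset.sum_eq_zero fun l hl => ?_
  rw [show (n : ℤ) - 2 * ((l + 1 : ℕ) : ℤ) + 2 = n - 2 * l by push_cast; ring, ← add_mul,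
    hEF l (Finset.mem_range.1 hl), zero_mul]

/-- A Laurent polynomial that vanishes at infinitely many points has leading coefficient zero. -/
lemma laurent_leading {n : ℕ} {G : ℕ → ℂ} {S : Set ℂ} (hS : S.Infinite) (h0 : ∀ Z ∈ S, Z ≠ 0)
    (h : ∀ Z ∈ S, laurent n G Z = 0) : G 0 = 0 := by
  open Polynomial in
  -- Multiplying by Z^n clears the negative exponents, and G 0 becomes the coefficient of degree 2n.
  let p : ℂ[X] := ∑ l ∈ Finset.range (n + 1), Polynomial.C (G l) * X ^ (2 * n - 2 * l)
  have hp : p = 0 := by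
    refine Polynomial.eq_zero_of_infinite_isRoot p (hS.mono fun Z hZ => ?_)
    have hZ0 := h0 Z hZ
    have : p.eval Z = Z ^ n * laurent n G Z := by
      simp only [p, Polynomial.eval_finsetSum, laurent, Finset.mul_sum]
      refine Finset.sum_congr rfl fun l hl => ?_
      have hl' := Nat.lt_succ_iff.1 (Finset.mem_range.1 hl)
      rw [Polynomial.eval_mul, Polynomial.eval_C, Polynomial.eval_pow, Polynomial.eval_X,
        mul_left_comm, ← zpow_natCast Z n, ← zpow_add₀ hZ0, ← zpow_natCast]
      congr 2
      rw [Nat.cast_sub (by omega)]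
      push_cast
      ring
    change p.eval Z = 0
    rw [this, h Z hZ, mul_zero]
  have hc : p.coeff (2 * n) = G 0 := by
    simp only [p, Polynomial.finsetSum_coeff, Polynomial.coeff_C_mul_X_pow]
    rw [Finset.sum_eq_single 0]
    · simp
    · intro l hl hl0
      have hl' := Nat.lt_succ_iff.1 (Finset.mem_range.1 hl)
      rw [if_neg (by omega)]
    · simp
  rw [← hc, hp, Polynomial.coeff_zero]

/-! ### Words in the generators and the Clebsch–Gordan decomposition -/

/-- The span of the words of length `N` in `a, b, c, d`. -/
def words : ℕ → Submodule ℂ (A P)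
  | 0 => Submodule.span ℂ {1}
  | N + 1 => (words N).map (lm P a) ⊔ ((words N).map (lm P b) ⊔
      ((words N).map (lm P c) ⊔ (words N).map (lm P d)))

variable {P} in
lemma words_succ_le {N : ℕ} {W : Submodule ℂ (A P)} : words P (N + 1) ≤ W ↔
    ∀ u ∈ words P N, ga * u ∈ W ∧ gb * u ∈ W ∧ gc * u ∈ W ∧ gd * u ∈ W := by
  simp only [words, sup_le_iff, Submodule.map_le_iff_le_comap]
  constructor
  · rintro ⟨h1, h2, h3, h4⟩ u hu
    exact ⟨h1 hu, h2 hu, h3 hu, h4 hu⟩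
  · intro h
    exact ⟨fun u hu => (h u hu).1, fun u hu => (h u hu).2.1, fun u hu => (h u hu).2.2.1,
      fun u hu => (h u hu).2.2.2⟩

variable {P} in
lemma mul_mem_words {N : ℕ} {u : A P} (hu : u ∈ words P N) : ga * u ∈ words P (N + 1) ∧
    gb * u ∈ words P (N + 1) ∧ gc * u ∈ words P (N + 1) ∧ gd * u ∈ words P (N + 1) :=
  words_succ_le.1 le_rfl u hu

lemma one_mem_words : (1 : A P) ∈ words P 0 := Submodule.subset_span rfl

variable {P} in
/-- Criterion for the spaces of words to be stable under an operator. -/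
lemma words_stable {T : A P →ₗ[ℂ] A P} (h1 : T 1 ∈ words P 0)
    (h : ∀ N, ∀ u ∈ words P N, T u ∈ words P N → T (ga * u) ∈ words P (N + 1) ∧
      T (gb * u) ∈ words P (N + 1) ∧ T (gc * u) ∈ words P (N + 1) ∧ T (gd * u) ∈ words P (N + 1))
    (N : ℕ) : ∀ u ∈ words P N, T u ∈ words P N := by
  induction N with
  | zero =>
    change words P 0 ≤ (words P 0).comap T
    rw [show words P 0 = Submodule.span ℂ {1} from rfl, Submodule.span_le,
      Set.singleton_subset_iff]
    exact h1
  | succ N ih =>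
    change words P (N + 1) ≤ (words P (N + 1)).comap T
    exact words_succ_le.2 fun u hu => h N u hu (ih u hu)

section stability
variable {P} {N : ℕ} {u : A P}

lemma parity_mem_words (hu : u ∈ words P N) : parity P u ∈ words P N := by
  refine words_stable (T := τ P) (by simpa using one_mem_words P) (fun N u _ h => ?_) N u hu
  simpa using mul_mem_words h

lemma LKi_mem_words (hu : u ∈ words P N) : LKi P u ∈ words P N := by
  refine words_stable (T := LKi P) (by simpa using one_mem_words P) (fun N u _ h => ?_) N u hu
  obtain ⟨-, -, -, -, -, -, -, h1, h2, h3, h4, -⟩ := translate_mul P u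
  obtain ⟨k1, k2, k3, k4⟩ := mul_mem_words h
  rw [h1, h2, h3, h4]
  exact ⟨Submodule.smul_mem _ _ k1, Submodule.smul_mem _ _ k2, Submodule.smul_mem _ _ k3,
    Submodule.smul_mem _ _ k4⟩

lemma LF_mem_words (hu : u ∈ words P N) : LF P u ∈ words P N := by
  refine words_stable (T := LF P) (by simp) (fun N u hu h => ?_) N u hu
  obtain ⟨-, -, -, -, -, ⟨h1, h2, h3, h4, -⟩, -⟩ := translate_mul P u
  obtain ⟨k1, k2, k3, k4⟩ := mul_mem_words h
  obtain ⟨-, l2, -, l4⟩ := mul_mem_words (parity_mem_words (LKi_mem_words hu))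
  rw [h1, h2, h3, h4]
  exact ⟨add_mem k1 l2, k2, add_mem k3 l4, k4⟩

lemma RE_mem_words (hu : u ∈ words P N) : RE P u ∈ words P N := by
  refine words_stable (T := RE P) (by simp) (fun N u hu h => ?_) N u hu
  obtain ⟨⟨h1, h2, h3, h4, -⟩, -⟩ := translate_mul P u
  obtain ⟨k1, k2, k3, k4⟩ := mul_mem_words h
  obtain ⟨-, -, l3, l4⟩ := mul_mem_words hu
  rw [h1, h2, h3, h4]
  exact ⟨add_mem (Submodule.smul_mem _ _ k1) (Submodule.smul_mem _ _ l3),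
    sub_mem (Submodule.smul_mem _ _ l4) (Submodule.smul_mem _ _ k2),
    Submodule.smul_mem _ _ k3, Submodule.smul_mem _ _ k4⟩

end stability

lemma xi_mem_words (m i : ℕ) : xi P m i ∈ words P (m + i) := by
  induction m, i using xi_induction with
  | h0 => rw [xi_zero_zero]; exact one_mem_words P
  | hc i ih =>
    rw [← c_mul_xi_zero]
    exact (mul_mem_words ih).2.2.1
  | ha m i ih =>
    rw [← a_mul_xi, show m + 1 + i = m + i + 1 by ring]
    exact (mul_mem_words ih).1

/-- The lower order terms in the words of length `N`. -/
def lower : ℕ → Submodule ℂ (A P)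
  | 0 => ⊥
  | 1 => ⊥
  | N + 2 => (words P N).map (lm P σ)

/-- The bicomodule of matrix elements together with the lower order terms. -/
def matrixLower (N : ℕ) : Submodule ℂ (A P) := LinearMap.range (el P N) ⊔ lower P N

lemma w_mem_matrixLower (m i j : ℕ) : w P m i j ∈ matrixLower P (m + i) :=
  Submodule.mem_sup_left (w_mem_range_el P)

lemma σ_mul_mem_matrixLower {N : ℕ} {u : A P} (hu : u ∈ words P N) :
    gσ * u ∈ matrixLower P (N + 2) :=
  Submodule.mem_sup_right (Submodule.mem_map_of_mem (f := lm P σ) hu)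

variable {P} in
lemma matrixLower_stable {T : A P →ₗ[ℂ] A P} (N : ℕ)
    (h1 : ∀ m i j, m + i = N → T (w P m i j) ∈ matrixLower P N)
    (h2 : ∀ N, ∀ u ∈ words P N, T u ∈ words P N)
    (h3 : ∀ u, T (gσ * u) = gσ * T u ∨ T (gσ * u) = -(gσ * T u)) :
    ∀ u ∈ matrixLower P N, T u ∈ matrixLower P N := by
  change matrixLower P N ≤ (matrixLower P N).comap T
  refine sup_le ?_ ?_
  · rintro _ ⟨C, rfl⟩
    rw [el_apply]
    refine Submodule.sum_mem _ fun i hi => Submodule.sum_mem _ fun j _ =>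
      Submodule.smul_mem _ _ ?_
    have := Finset.mem_range.1 hi
    exact h1 _ _ _ (by omega)
  · rcases N with _ | _ | N
    · exact bot_le
    · exact bot_le
    · rintro _ ⟨u, hu, rfl⟩
      have := σ_mul_mem_matrixLower P (h2 N u hu)
      change T (gσ * u) ∈ matrixLower P (N + 2)
      rcases h3 u with h | h <;> rw [h]
      · exact this
      · exact neg_mem this

lemma LF_mem_matrixLower {N : ℕ} {u : A P} (hu : u ∈ matrixLower P N) :
    LF P u ∈ matrixLower P N := by
  refine matrixLower_stable N (fun m i j h => ?_) (fun N u => LF_mem_words) (fun u => ?_) u hu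
  · rw [LF_w, ← h]; exact w_mem_matrixLower P m i _
  · left; simp [translate_mul]

lemma RE_mem_matrixLower {N : ℕ} {u : A P} (hu : u ∈ matrixLower P N) :
    RE P u ∈ matrixLower P N := by
  refine matrixLower_stable N (fun m i j h => ?_) (fun N u => RE_mem_words) (fun u => ?_) u hu
  · rw [RE_w]
    rcases m with _ | m
    · simp
    · rw [← h, Nat.add_sub_cancel, show m + 1 + i = m + (i + 1) by ring]
      exact Submodule.smul_mem _ _ (w_mem_matrixLower P m (i + 1) j)
  · right; simp [translate_mul]

/-! ### Multiplying matrix elements by generators -/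

lemma LF_a_pow (m : ℕ) : LF P (xi P m 0) = br P m • (gb * xi P (m - 1) 0) := by
  induction m with
  | zero => simp [xi_zero_zero]
  | succ m ih =>
    obtain ⟨-, -, -, -, -, ⟨h, -⟩, -⟩ := translate_mul P (xi P m 0)
    have hk := LKi_w P m 0 0
    rw [w_zero] at hk
    rw [← a_mul_xi, h, ih, hk, map_smul, parity_xi, Nat.add_sub_cancel]
    push_cast
    rw [br_succ]
    have hw : (wt P (m + 0) 0)⁻¹ = P.t ^ (-(m : ℤ)) := by simp [wt]
    rw [hw]
    rcases m with _ | m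
    · simp
    · have hab : ga * (gb * xi P m 0) = P.t • (gb * xi P (m + 1) 0) := by
        rw [← a_mul_xi, ba, smul_smul, mul_inv_cancel₀ (t_ne_zero P), one_smul]
      rw [Nat.add_sub_cancel, mul_smul_comm, hab]
      simp only [pow_zero, one_smul, mul_smul_comm]
      module

/-- Normal ordering da and using σ = ad + tbc. This is where the lower order terms with a factor σ
arise. -/
lemma d_mul_xi (m i : ℕ) : gd * xi P (m + 1) i =
    gσ * xi P m i - P.t ^ (-(m : ℤ) - 1) • (gb * xi P m (i + 1)) := by
  have ht := t_ne_zero P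
  have h1 := bc_eq P (xi P m i)
  rw [← a_mul_xi, da, zpow_sub_one₀ ht]
  rw [c_mul_xi, mul_smul_comm] at h1 ⊢
  linear_combination (norm := module) h1

/-- For i = 0, applying f to a^{m+1} gives a nonzero multiple of b a^m. To raise i, apply e to b
a^{m+1} c^i: modulo lower terms the result is a multiple of b a^m c^{i+1}, and the two contributions
add up to the nonzero constant κ[m+2]. -/
lemma b_mul_xi_mem (i m : ℕ) : gb * xi P m i ∈ matrixLower P (m + i + 1) := by
  induction i generalizing m with
  | zero =>
    have h := LF_mem_matrixLower P (w_mem_matrixLower P (m + 1) 0 0)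
    rw [w_zero, LF_a_pow, Nat.add_sub_cancel,
      Submodule.smul_mem_iff _ (br_ne_zero P (by omega))] at h
    exact h
  | succ i ih =>
    have h := RE_mem_matrixLower P (ih (m + 1))
    obtain ⟨⟨-, hb, -⟩, -⟩ := translate_mul P (xi P (m + 1) i)
    rw [hb, RE_xi, Nat.add_sub_cancel, d_mul_xi, mul_smul_comm] at h
    rw [show m + 1 + i + 1 = m + i + 2 by ring] at h
    have h2 := σ_mul_mem_matrixLower P (xi_mem_words P m i)
    have h3 := sub_mem (Submodule.smul_mem _ (κ P) h2) h
    have h4 : κ P • (gσ * xi P m i) - (κ P • (gσ * xi P m i - P.t ^ (-(m : ℤ) - 1) •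
        (gb * xi P m (i + 1))) - P.t • (κ P * br P (m + 1 : ℕ)) • (gb * xi P m (i + 1))) =
        (κ P * br P (m + 1 + 1)) • (gb * xi P m (i + 1)) := by
      rw [br_succ P (m + 1), neg_add, ← sub_eq_add_neg]
      push_cast
      module
    rw [h4, Submodule.smul_mem_iff _ (mul_ne_zero (κ_ne_zero P) (br_ne_zero P (by omega)))] at h3
    exact h3

lemma d_mul_xi_mem (i m : ℕ) : gd * xi P m i ∈ matrixLower P (m + i + 1) := by
  rcases m with _ | m
  · have h := RE_mem_matrixLower P (b_mul_xi_mem P i 0)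
    obtain ⟨⟨-, hb, -⟩, -⟩ := translate_mul P (xi P 0 i)
    rw [hb, RE_xi] at h
    simp only [Nat.cast_zero, br_zero, mul_zero, zero_smul, smul_zero, sub_zero] at h
    exact (Submodule.smul_mem_iff _ (κ_ne_zero P)).1 h
  · rw [d_mul_xi]
    refine sub_mem ?_ (Submodule.smul_mem _ _ ?_)
    · rw [show m + 1 + i + 1 = m + i + 2 by ring]
      exact σ_mul_mem_matrixLower P (xi_mem_words P m i)
    · rw [show m + 1 + i + 1 = m + (i + 1) + 1 by ring]
      exact b_mul_xi_mem P (i + 1) m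

/-- Induction along the string. By the twisted Leibniz rule, a times f.w is f.(a w) up to a multiple
of b w, and likewise for c with d; b and d need no correction. -/
lemma gen_mul_w_mem (m i j : ℕ) : ga * w P m i j ∈ matrixLower P (m + i + 1) ∧
    gb * w P m i j ∈ matrixLower P (m + i + 1) ∧ gc * w P m i j ∈ matrixLower P (m + i + 1) ∧
    gd * w P m i j ∈ matrixLower P (m + i + 1) := by
  induction j with
  | zero =>
    simp only [w_zero]
    refine ⟨?_, b_mul_xi_mem P i m, ?_, d_mul_xi_mem P i m⟩
    · rw [a_mul_xi, ← w_zero, show m + i + 1 = m + 1 + i by ring]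
      exact w_mem_matrixLower P _ _ _
    · rw [c_mul_xi, ← w_zero, add_assoc]
      exact Submodule.smul_mem _ _ (w_mem_matrixLower P _ _ _)
  | succ j ih =>
    obtain ⟨ha, hb, hc, hd⟩ := ih
    obtain ⟨-, -, -, -, -, ⟨h1, h2, h3, h4, -⟩, -⟩ := translate_mul P (w P m i j)
    rw [LF_w, LKi_w, map_smul, parity_w, smul_smul, mul_smul_comm] at h1 h3
    rw [LF_w] at h2 h4
    refine ⟨?_, ?_, ?_, ?_⟩
    · rw [← sub_eq_iff_eq_add] at h1
      rw [← h1]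
      exact sub_mem (LF_mem_matrixLower P ha) (Submodule.smul_mem _ _ hb)
    · rw [← h2]; exact LF_mem_matrixLower P hb
    · rw [← sub_eq_iff_eq_add] at h3
      rw [← h3]
      exact sub_mem (LF_mem_matrixLower P hc) (Submodule.smul_mem _ _ hd)
    · rw [← h4]; exact LF_mem_matrixLower P hd

lemma gen_mul_σ (s : AGen) (u : A P) : gen P s * (gσ * u) = gσ * (parity P (gen P s) * u) := by
  rw [← mul_assoc, ← mul_assoc, σ_mul, parity_parity]

lemma gen_mul_mem {N : ℕ} {u : A P} (hu : u ∈ matrixLower P N) :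
    ga * u ∈ matrixLower P (N + 1) ∧ gb * u ∈ matrixLower P (N + 1) ∧
    gc * u ∈ matrixLower P (N + 1) ∧ gd * u ∈ matrixLower P (N + 1) := by
  have key : ∀ s, (∀ m i j, gen P s * w P m i j ∈ matrixLower P (m + i + 1)) →
      (∀ N, ∀ u ∈ words P N, parity P (gen P s) * u ∈ words P (N + 1)) →
      gen P s * u ∈ matrixLower P (N + 1) := by
    intro s h1 h2
    suffices h : matrixLower P N ≤ (matrixLower P (N + 1)).comap (lm P s) from h hu
    refine sup_le ?_ ?_
    · rintro _ ⟨C, rfl⟩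
      rw [el_apply]
      refine Submodule.sum_mem _ fun i hi => Submodule.sum_mem _ fun j _ =>
        Submodule.smul_mem _ _ ?_
      have := h1 (N - i) i j
      rwa [Nat.sub_add_cancel (Nat.lt_succ_iff.1 (Finset.mem_range.1 hi))] at this
    · rcases N with _ | _ | N
      · exact bot_le
      · exact bot_le
      · rintro _ ⟨u, hu, rfl⟩
        change gen P s * (gσ * u) ∈ matrixLower P (N + 2 + 1)
        rw [gen_mul_σ]
        exact σ_mul_mem_matrixLower P (h2 N u hu)
  refine ⟨key a (fun m i j => (gen_mul_w_mem P m i j).1) fun N u hu => ?_,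
    key b (fun m i j => (gen_mul_w_mem P m i j).2.1) fun N u hu => ?_,
    key c (fun m i j => (gen_mul_w_mem P m i j).2.2.1) fun N u hu => ?_,
    key d (fun m i j => (gen_mul_w_mem P m i j).2.2.2) fun N u hu => ?_⟩
  · rw [parity_a]; exact (mul_mem_words hu).1
  · rw [parity_b, neg_mul]; exact neg_mem (mul_mem_words hu).2.1
  · rw [parity_c, neg_mul]; exact neg_mem (mul_mem_words hu).2.2.1
  · rw [parity_d]; exact (mul_mem_words hu).2.2.2

/-- The Clebsch–Gordan step: a word of length N is a matrix element of the top bicomodule plus σ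
times a combination of words of length N - 2. -/
lemma words_le_matrixLower (N : ℕ) : words P N ≤ matrixLower P N := by
  induction N with
  | zero =>
    rw [show words P 0 = Submodule.span ℂ {1} from rfl, Submodule.span_le,
      Set.singleton_subset_iff]
    have := w_mem_matrixLower P 0 0 0
    rwa [w_zero, xi_zero_zero] at this
  | succ N ih => exact words_succ_le.2 fun u hu => gen_mul_mem P (ih hu)

/-- Iterating the previous decomposition. The power of σ matches at each stage because σ² = 1 gives
σ^{n+1} σ = σ^n. -/
lemma exists_sum_of_mem_words (n : ℕ) : ∀ u ∈ words P (2 * n), ∃ v : ℕ → A P,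
    (∀ k, v k ∈ M P (2 * k) k) ∧ gσ ^ n * u = ∑ k ∈ Finset.range (n + 1), v k := by
  have hel : ∀ n C, gσ ^ n * el P (2 * n) C ∈ M P (2 * n) n := fun n C => by
    rw [M_eq]; exact ⟨_, ⟨C, rfl⟩, rfl⟩
  induction n with
  | zero =>
    intro u hu
    obtain ⟨_, ⟨C, rfl⟩, y, hy, rfl⟩ := Submodule.mem_sup.1 (words_le_matrixLower P _ hu)
    have hy0 : y = 0 := hy
    exact ⟨fun k => if k = 0 then el P 0 C else 0, fun k => by
      dsimp only
      split_ifs with h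
      · subst h; simpa using hel 0 C
      · exact zero_mem _, by simp [hy0]⟩
  | succ n ih =>
    intro u hu
    obtain ⟨_, ⟨C, rfl⟩, _, ⟨y, hy, rfl⟩, rfl⟩ :=
      Submodule.mem_sup.1 (words_le_matrixLower P (2 * n + 2) hu)
    obtain ⟨v, hv, hs⟩ := ih y hy
    refine ⟨fun k => if k = n + 1 then gσ ^ (n + 1) * el P (2 * (n + 1)) C else v k, fun k => ?_, ?_⟩
    · simp only
      split_ifs with h
      · subst h; exact hel _ C
      · exact hv k
    · rw [Finset.sum_range_succ, if_pos rfl, mul_add, add_comm]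
      congr 1
      rw [Finset.sum_congr rfl fun k hk => if_neg (Finset.mem_range.1 hk).ne, ← hs]
      change gσ ^ (n + 1) * (gσ * y) = _
      rw [pow_succ, mul_assoc, σ_σ]

/-! ### The Casimir operator -/

/-- The action of the normalized `Z/2`-Casimir element through the first leg. -/
def scasimir : A P →ₗ[ℂ] A P :=
  ((P.q - P.q⁻¹) * (1 + P.q)) • (RE P ∘ₗ RF P) - P.q • RK P + RKi P

/-- Apart from the sign (-1)^i the eigenvalue depends only on m + i, so the square is a scalar on
all matrix elements of one bicomodule. Squaring also removes the sign that σ introduces. -/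
lemma scasimir_w (m i j : ℕ) : scasimir P (w P m i j) =
    ((-1) ^ i * (P.t ^ ((m : ℤ) + i + 2) + P.t ^ (-((m : ℤ) + i)))) • w P m i j := by
  have ht := t_ne_zero P
  have h1 := t_sub_inv_ne_zero P
  have h2 := q_sub_inv_ne_zero P
  have hc : ((P.q - P.q⁻¹) * (1 + P.q)) * ((-1) ^ (i + 1) * br P i * (κ P * br P (m + 1))) -
      P.q * wt P (m + i) i + (wt P (m + i) i)⁻¹ =
      (-1) ^ i * (P.t ^ ((m : ℤ) + i + 2) + P.t ^ (-((m : ℤ) + i))) := by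
    have hw : (wt P (m + i) i)⁻¹ = (-1) ^ i * (P.t ^ ((m + i : ℕ) - 2 * i : ℤ))⁻¹ := by
      rw [wt, mul_inv, ← inv_pow, inv_neg_one]
    rw [hw, wt, pow_succ, κ]
    generalize (-1 : ℂ) ^ i = s
    rw [br, br]
    push_cast
    have hm : P.t ^ (m : ℤ) ≠ 0 := zpow_ne_zero _ ht
    have hi : P.t ^ (i : ℤ) ≠ 0 := zpow_ne_zero _ ht
    have a1 : P.t ^ ((m : ℤ) + i - 2 * i) = P.t ^ (m : ℤ) / P.t ^ (i : ℤ) := by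
      rw [← zpow_sub₀ ht]; congr 1; ring
    have a2 : P.t ^ ((m : ℤ) + i + 2) = P.t ^ (m : ℤ) * P.t ^ (i : ℤ) * P.t ^ 2 := by
      rw [zpow_add₀ ht, zpow_add₀ ht, zpow_ofNat]
    have a3 : P.t ^ ((m : ℤ) + 1) = P.t ^ (m : ℤ) * P.t := zpow_add_one₀ ht _
    have a4 : P.t ^ ((m : ℤ) + i) = P.t ^ (m : ℤ) * P.t ^ (i : ℤ) := zpow_add₀ ht _ _
    simp only [zpow_neg, a1, a2, a3, a4]
    generalize P.t ^ (m : ℤ) = X at *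
    generalize P.t ^ (i : ℤ) = Y at *
    generalize hd : P.q - P.q⁻¹ = D at *
    have h3 : P.t ^ 2 - 1 ≠ 0 := by
      intro h; apply h1; field_simp; linear_combination h
    rw [q_eq]
    field_simp
    ring
  rw [scasimir, LinearMap.add_apply, LinearMap.sub_apply, LinearMap.smul_apply,
    LinearMap.smul_apply, LinearMap.comp_apply, RF_w, map_smul, RE_w, RK_w, RKi_w, ← hc,
    Nat.add_sub_cancel]
  rcases i with _ | i
  · simp only [Nat.cast_zero, br_zero]; module
  · rw [Nat.add_sub_cancel]; push_cast; module

lemma scasimir_σ (u : A P) : scasimir P (gσ * u) = -(gσ * scasimir P u) := by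
  simp [scasimir, translate_mul, mul_add, mul_sub]
  abel

/-- The Casimir operator. -/
def casimir : A P →ₗ[ℂ] A P := scasimir P ∘ₗ scasimir P

lemma casimir_σ_pow (s : ℕ) (u : A P) : casimir P (gσ ^ s * u) = gσ ^ s * casimir P u := by
  induction s with
  | zero => simp
  | succ s ih =>
    rw [pow_succ', mul_assoc, casimir, LinearMap.comp_apply, scasimir_σ, map_neg, scasimir_σ,
      neg_neg, mul_assoc]
    congr 1

lemma scasimir_eigenvalue (n : ℕ) :
    P.t ^ (2 * (n : ℤ) + 2) + P.t ^ (-(2 * (n : ℤ))) = (-1) ^ n * chi P n := by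
  have ht := t_ne_zero P
  have hq := P.q_ne_zero
  have h : P.t ^ (2 * (n : ℤ)) = (-1) ^ n * P.q ^ n := by
    rw [zpow_mul, zpow_ofNat, P.t_sq, zpow_natCast, neg_pow]
  rw [zpow_add₀ ht, zpow_neg, h, zpow_ofNat, P.t_sq, chi, mul_inv, ← inv_pow, inv_neg_one]
  ring

lemma casimir_M {n : ℕ} {u : A P} (hu : u ∈ M P (2 * n) n) : casimir P u = chi P n ^ 2 • u := by
  rw [M_eq] at hu
  obtain ⟨_, ⟨C, rfl⟩, rfl⟩ := hu
  change casimir P (gσ ^ n * _) = chi P n ^ 2 • (gσ ^ n * _)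
  rw [casimir_σ_pow, ← mul_smul_comm, el_apply, map_sum, Finset.smul_sum]
  congr 1
  refine Finset.sum_congr rfl fun i hi => ?_
  rw [map_sum, Finset.smul_sum]
  refine Finset.sum_congr rfl fun j _ => ?_
  have hi' : i ≤ 2 * n := Nat.lt_succ_iff.1 (Finset.mem_range.1 hi)
  have e : ((2 * n - i : ℕ) : ℤ) + i = 2 * n := by omega
  have hs : (-1 : ℂ) ^ i * (-1) ^ i * ((-1) ^ n * (-1) ^ n) = 1 := by
    rw [← mul_pow, ← mul_pow]; norm_num
  rw [map_smul, casimir, LinearMap.comp_apply, scasimir_w, map_smul, scasimir_w, e,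
    scasimir_eigenvalue]
  simp only [smul_smul]
  congr 1
  linear_combination C i j * chi P n ^ 2 * hs

/-! ### Separation of the eigenvalues -/

lemma q_pow_ne_neg_one (n : ℕ) : P.q ^ n ≠ -1 := by
  intro h
  rcases Nat.eq_zero_or_pos n with rfl | hn
  · norm_num at h
  · apply P.q_pow_ne_one (2 * n) (by omega)
    rw [mul_comm, pow_mul, h]; norm_num

/-- The difference of the squares is, up to a unit, (q^m - q^n)(q^m + q^n)(q^{m+n+1} - 1)(q^{m+n+1}
+ 1); when m ≠ n, no factor vanishes because q is not a root of unity. -/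
lemma chi_sq_inj {m n : ℕ} (h : chi P m ^ 2 = chi P n ^ 2) : m = n := by
  have hq := P.q_ne_zero
  have h1 : (P.q ^ m - P.q ^ n) * (P.q ^ m + P.q ^ n) * (P.q ^ (m + n + 1) - 1) *
      (P.q ^ (m + n + 1) + 1) = 0 := by
    simp only [chi, pow_succ, pow_add] at h ⊢
    have hm := pow_ne_zero m hq
    have hn := pow_ne_zero n hq
    field_simp at h
    linear_combination h
  rcases mul_eq_zero.1 h1 with h1 | h1
  · rcases mul_eq_zero.1 h1 with h1 | h1
    · rcases mul_eq_zero.1 h1 with h1 | h1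
      · exact q_pow_inj P (sub_eq_zero.1 h1)
      · have : P.q ^ (m * 2) = P.q ^ (n * 2) := by
          rw [pow_mul, pow_mul, eq_neg_of_add_eq_zero_left h1, neg_sq]
        have := q_pow_inj P this
        omega
    · exact absurd (sub_eq_zero.1 h1) (P.q_pow_ne_one _ (by omega))
  · exact absurd (eq_neg_of_add_eq_zero_left h1) (q_pow_ne_neg_one P _)

/-! ### The Askey–Wilson polynomials as eigenfunctions -/

/-- The Askey–Wilson polynomial `p_n(x; t, -t, it, -it | q)`. -/
abbrev aw (n : ℕ) : Polynomial ℂ :=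
  askeyWilson n P.t (-P.t) (Complex.I * P.t) (-(Complex.I * P.t)) P.q

/-- The product `(tZ, t/Z; q)_k`. -/
def phi (k : ℕ) (Z : ℂ) : ℂ :=
  ∏ j ∈ Finset.range k, ((1 - P.t * P.q ^ j * Z) * (1 - P.t * P.q ^ j * Z⁻¹))

/-- The coefficients of the Askey–Wilson polynomial in the basis `(tZ, t/Z; q)_k`. -/
def awCoeff (n k : ℕ) : ℂ :=
  qShiftedFactorial ((P.q ^ n)⁻¹) P.q k *
    qShiftedFactorial (P.q ^ ((n : ℤ) - 1) * P.t * (-P.t) * (Complex.I * P.t) *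
      (-(Complex.I * P.t))) P.q k * P.q ^ k /
    (qShiftedFactorial (P.t * (-P.t)) P.q k * qShiftedFactorial (P.t * (Complex.I * P.t)) P.q k *
      qShiftedFactorial (P.t * (-(Complex.I * P.t))) P.q k * qShiftedFactorial P.q P.q k)

/-- The normalization constant of the Askey–Wilson polynomial. -/
def awConst (n : ℕ) : ℂ := (P.t ^ n)⁻¹ * (qShiftedFactorial (P.t * (-P.t)) P.q n *
  qShiftedFactorial (P.t * (Complex.I * P.t)) P.q n *
  qShiftedFactorial (P.t * (-(Complex.I * P.t))) P.q n)

lemma aw_eval (n : ℕ) {Z : ℂ} (hZ : Z ≠ 0) : (aw P n).eval ((Z + Z⁻¹) / 2) =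
    awConst P n * ∑ k ∈ Finset.range (n + 1), awCoeff P n k * phi P k Z := by
  rw [aw, askeyWilson, Polynomial.eval_mul, Polynomial.eval_C, Polynomial.eval_finsetSum, awConst]
  congr 1
  refine Finset.sum_congr rfl fun k _ => ?_
  rw [Polynomial.eval_mul, Polynomial.eval_C, Polynomial.eval_prod, awCoeff, phi]
  congr 1
  refine Finset.prod_congr rfl fun j _ => ?_
  simp only [Polynomial.eval_add, Polynomial.eval_sub, Polynomial.eval_one, Polynomial.eval_mul,
    Polynomial.eval_C, Polynomial.eval_X]
  field_simp
  ring

lemma one_sub_mul_q_pow_ne_zero (k : ℕ) : 1 - P.q * P.q ^ k ≠ 0 := by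
  rw [← pow_succ']
  exact fun h => P.q_pow_ne_one (k + 1) (by omega) (sub_eq_zero.1 h).symm

/-- The two factors are 1 ± i q^{k+1}, with product 1 + q^{2(k+1)}. -/
lemma one_sub_t_I_ne_zero (k : ℕ) : 1 - P.t * (Complex.I * P.t) * P.q ^ k ≠ 0 ∧
    1 - P.t * (-(Complex.I * P.t)) * P.q ^ k ≠ 0 := by
  have h : (1 - P.t * (Complex.I * P.t) * P.q ^ k) * (1 - P.t * (-(Complex.I * P.t)) * P.q ^ k) ≠
      0 := by
    intro h
    apply q_pow_ne_neg_one P (2 * (k + 1))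
    rw [mul_comm 2, pow_mul, pow_succ]
    linear_combination h + P.t ^ 4 * (P.q ^ k) ^ 2 * Complex.I_sq -
      (P.q ^ k) ^ 2 * (P.t ^ 2 - P.q) * P.t_sq
  exact ⟨left_ne_zero_of_mul h, right_ne_zero_of_mul h⟩

lemma qShiftedFactorial_succ (a q : ℂ) (m : ℕ) :
    qShiftedFactorial a q (m + 1) = qShiftedFactorial a q m * (1 - a * q ^ m) :=
  Finset.prod_range_succ _ _

lemma awDenominator_ne_zero (k : ℕ) : qShiftedFactorial (P.t * (-P.t)) P.q k ≠ 0 ∧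
    qShiftedFactorial (P.t * (Complex.I * P.t)) P.q k ≠ 0 ∧
    qShiftedFactorial (P.t * (-(Complex.I * P.t))) P.q k ≠ 0 ∧
    qShiftedFactorial P.q P.q k ≠ 0 := by
  have h : P.t * (-P.t) = P.q := by rw [mul_neg, ← pow_two, P.t_sq, neg_neg]
  rw [h]
  refine ⟨?_, ?_, ?_, ?_⟩ <;> refine Finset.prod_ne_zero_iff.2 fun j _ => ?_
  · exact one_sub_mul_q_pow_ne_zero P j
  · exact (one_sub_t_I_ne_zero P j).1
  · exact (one_sub_t_I_ne_zero P j).2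
  · exact one_sub_mul_q_pow_ne_zero P j

/-! ### The q-difference equation of the Askey–Wilson polynomials -/

/-- The lowering coefficient of the `q`-difference operator on the basis `(tZ, t/Z; q)_k`. -/
def lowerCoeff (k : ℕ) : ℂ := -(P.q ^ k)⁻¹ * (1 - P.q ^ k) ^ 2 * (1 + (P.q ^ k) ^ 2)

/-- The ratio of consecutive hypergeometric coefficients is what an eigenvector of a bidiagonal
operator requires, with diagonal χ_k and off-diagonal `lowerCoeff`. -/
lemma awCoeff_succ (n k : ℕ) :
    awCoeff P n (k + 1) * lowerCoeff P (k + 1) = awCoeff P n k * (chi P n - chi P k) := by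
  have hq := P.q_ne_zero
  obtain ⟨h1, h2, h3, h4⟩ := awDenominator_ne_zero P k
  obtain ⟨g1, g2⟩ := one_sub_t_I_ne_zero P k
  have g3 := one_sub_mul_q_pow_ne_zero P k
  have e1 : P.t * (-P.t) = P.q := by rw [mul_neg, ← pow_two, P.t_sq, neg_neg]
  have e2 : P.q ^ ((n : ℤ) - 1) * P.t * (-P.t) * (Complex.I * P.t) * (-(Complex.I * P.t)) =
      -(P.q ^ n * P.q) := by
    have hz : P.q ^ ((n : ℤ) - 1) * P.q = P.q ^ n := by
      rw [← zpow_add_one₀ hq, sub_add_cancel, zpow_natCast]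
    linear_combination (P.q ^ ((n : ℤ) - 1) * P.t ^ 4) * Complex.I_sq -
      P.q ^ ((n : ℤ) - 1) * (P.t ^ 2 - P.q) * P.t_sq - P.q * hz
  have e3 : (1 - P.t * (Complex.I * P.t) * P.q ^ k) * (1 - P.t * (-(Complex.I * P.t)) * P.q ^ k) =
      1 + P.q ^ 2 * (P.q ^ k) ^ 2 := by
    linear_combination (-P.t ^ 4 * (P.q ^ k) ^ 2) * Complex.I_sq +
      (P.q ^ k) ^ 2 * (P.t ^ 2 - P.q) * P.t_sq
  rw [awCoeff, awCoeff, e2, e1]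
  rw [e1] at h1
  simp only [qShiftedFactorial_succ]
  have hk := pow_ne_zero k hq
  have hn := pow_ne_zero n hq
  rw [lowerCoeff, chi, chi, pow_succ P.q k, pow_succ P.q n]
  generalize qShiftedFactorial P.q P.q k = f1 at *
  generalize qShiftedFactorial (P.t * (Complex.I * P.t)) P.q k = f2 at *
  generalize qShiftedFactorial (P.t * (-(Complex.I * P.t))) P.q k = f3 at *
  generalize qShiftedFactorial (-(P.q ^ n * P.q)) P.q k = f4 at *
  generalize qShiftedFactorial (P.q ^ n)⁻¹ P.q k = f5 at *
  generalize 1 - P.t * (Complex.I * P.t) * P.q ^ k = y1 at *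
  generalize 1 - P.t * (-(Complex.I * P.t)) * P.q ^ k = y2 at *
  generalize P.q ^ k = X at *
  generalize P.q ^ n = Y at *
  generalize P.q = q at *
  have e4 : 1 + (X * q) ^ 2 = y1 * y2 := by rw [e3]; ring
  have g4 : 1 - X * q ≠ 0 := by rwa [mul_comm q X] at g3
  rw [e4]
  field_simp
  ring

lemma phi_succ (k : ℕ) (Z : ℂ) : phi P (k + 1) Z =
    phi P k Z * ((1 - P.t * P.q ^ k * Z) * (1 - P.t * P.q ^ k * Z⁻¹)) :=
  Finset.prod_range_succ _ _

/-- Shifting Z by q^{±1} moves each of the two q-shifted factorials by one step. The prefactor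
avoids dividing by the factor that is lost. -/
lemma phi_shift (m : ℕ) {Z : ℂ} (hZ : Z ≠ 0) :
    (1 - P.t * Z) * phi P (m + 1) (P.q * Z) = phi P m Z * (1 - P.t * P.q ^ m * Z) *
      (1 - P.t * P.q ^ (m + 1) * Z) * (1 - P.t * (P.q * Z)⁻¹) ∧
    (1 - P.t * Z⁻¹) * phi P (m + 1) (P.q⁻¹ * Z) = phi P m Z * (1 - P.t * P.q ^ m * Z⁻¹) *
      (1 - P.t * P.q ^ (m + 1) * Z⁻¹) * (1 - P.t * (P.q⁻¹ * Z)) := by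
  have hq := P.q_ne_zero
  induction m with
  | zero =>
    simp only [phi, Finset.prod_range_succ, Finset.prod_range_zero, zero_add, pow_one, pow_zero]
    constructor <;> field_simp
  | succ m ih =>
    obtain ⟨h1, h2⟩ := ih
    constructor
    · rw [phi_succ P (m + 1) (P.q * Z), ← mul_assoc, h1, phi_succ P m Z,
        show P.t * P.q ^ (m + 1) * (P.q * Z)⁻¹ = P.t * P.q ^ m * Z⁻¹ by field_simp; ring,
        show P.t * P.q ^ (m + 1) * (P.q * Z) = P.t * P.q ^ (m + 1 + 1) * Z by ring]
      ring
    · rw [phi_succ P (m + 1) (P.q⁻¹ * Z), ← mul_assoc, h2, phi_succ P m Z,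
        show P.t * P.q ^ (m + 1) * (P.q⁻¹ * Z) = P.t * P.q ^ m * Z by field_simp; ring,
        show P.t * P.q ^ (m + 1) * (P.q⁻¹ * Z)⁻¹ = P.t * P.q ^ (m + 1 + 1) * Z⁻¹ by
          field_simp; ring]
      ring

lemma phi_difference_zero {Z : ℂ} : (1 + P.q * Z ^ 2) * phi P 0 (P.q * Z) -
    (Z ^ 2 + P.q) * phi P 0 (P.q⁻¹ * Z) = (1 - Z ^ 2) * (chi P 0 * phi P 0 Z) := by
  simp only [phi, chi, Finset.prod_range_zero]
  ring

/-- The operator is bidiagonal in the basis (tZ, t/Z; q)_k. Both sides are multiplied by (1 - tZ)(1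
- t/Z) to use the shift formulas, hence the two nonvanishing assumptions. -/
lemma phi_difference_succ (m : ℕ) {Z : ℂ} (hZ : Z ≠ 0) (h1 : 1 - P.t * Z ≠ 0)
    (h2 : 1 - P.t * Z⁻¹ ≠ 0) :
    (1 + P.q * Z ^ 2) * phi P (m + 1) (P.q * Z) - (Z ^ 2 + P.q) * phi P (m + 1) (P.q⁻¹ * Z) =
      (1 - Z ^ 2) * (chi P (m + 1) * phi P (m + 1) Z + lowerCoeff P (m + 1) * phi P m Z) := by
  have hq := P.q_ne_zero
  have ht := t_ne_zero P
  obtain ⟨s1, s2⟩ := phi_shift P m hZ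
  have hm := pow_ne_zero m hq
  rw [phi_succ P m Z, chi, lowerCoeff]
  simp only [pow_succ P.q] at *
  apply mul_left_cancel₀ (mul_ne_zero h1 h2)
  have expand : (1 - P.t * Z) * (1 - P.t * Z⁻¹) * ((1 + P.q * Z ^ 2) * phi P (m + 1) (P.q * Z) -
      (Z ^ 2 + P.q) * phi P (m + 1) (P.q⁻¹ * Z)) = (1 - P.t * Z⁻¹) * (1 + P.q * Z ^ 2) *
      ((1 - P.t * Z) * phi P (m + 1) (P.q * Z)) - (1 - P.t * Z) * (Z ^ 2 + P.q) *
      ((1 - P.t * Z⁻¹) * phi P (m + 1) (P.q⁻¹ * Z)) := by ring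
  rw [expand, s1, s2]
  generalize phi P m Z = p
  generalize P.q ^ m = X at *
  have hqt := q_eq P
  generalize P.q = q at *
  subst hqt
  field_simp
  ring

/-- Collecting the coefficient of each basis element leaves the two-term recurrence `awCoeff_succ`.
The term k = n drops out because its factor χ_n - χ_n is zero, and the lowering term at k = 0 is
absent. -/
lemma aw_difference (n : ℕ) {Z : ℂ} (hZ : Z ≠ 0) (h1 : 1 - P.t * Z ≠ 0) (h2 : 1 - P.t * Z⁻¹ ≠ 0) :
    (1 + P.q * Z ^ 2) * (aw P n).eval ((P.q * Z + (P.q * Z)⁻¹) / 2) -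
      (Z ^ 2 + P.q) * (aw P n).eval ((P.q⁻¹ * Z + (P.q⁻¹ * Z)⁻¹) / 2) =
      chi P n * ((1 - Z ^ 2) * (aw P n).eval ((Z + Z⁻¹) / 2)) := by
  have hq := P.q_ne_zero
  rw [aw_eval P n hZ, aw_eval P n (mul_ne_zero hq hZ), aw_eval P n (mul_ne_zero (inv_ne_zero hq) hZ)]
  have key : (1 + P.q * Z ^ 2) * (∑ k ∈ Finset.range (n + 1), awCoeff P n k * phi P k (P.q * Z)) -
      (Z ^ 2 + P.q) * (∑ k ∈ Finset.range (n + 1), awCoeff P n k * phi P k (P.q⁻¹ * Z)) =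
      chi P n * ((1 - Z ^ 2) * ∑ k ∈ Finset.range (n + 1), awCoeff P n k * phi P k Z) := by
    have e : ∀ k, (1 + P.q * Z ^ 2) * (awCoeff P n k * phi P k (P.q * Z)) -
        (Z ^ 2 + P.q) * (awCoeff P n k * phi P k (P.q⁻¹ * Z)) -
        chi P n * ((1 - Z ^ 2) * (awCoeff P n k * phi P k Z)) = (1 - Z ^ 2) *
        (awCoeff P n k * (chi P k - chi P n) * phi P k Z + awCoeff P n k *
          (if k = 0 then 0 else lowerCoeff P k * phi P (k - 1) Z)) := by
      intro k
      rcases k with _ | k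
      · rw [if_pos rfl]
        linear_combination awCoeff P n 0 * phi_difference_zero P (Z := Z)
      · rw [if_neg (by omega), Nat.add_sub_cancel]
        linear_combination awCoeff P n (k + 1) * phi_difference_succ P k hZ h1 h2
    rw [← sub_eq_zero]
    simp only [Finset.mul_sum]
    rw [← Finset.sum_sub_distrib, ← Finset.sum_sub_distrib, Finset.sum_congr rfl fun k _ => e k,
      ← Finset.mul_sum, Finset.sum_add_distrib, Finset.sum_range_succ, Finset.sum_range_succ' _ n]
    simp only [sub_self, mul_zero, zero_mul, add_zero, if_true, Nat.succ_ne_zero, if_false,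
      Nat.add_sub_cancel]
    rw [← Finset.sum_add_distrib, Finset.sum_eq_zero, mul_zero]
    intro k _
    linear_combination phi P k Z * awCoeff_succ P n k
  linear_combination awConst P n * key

/-! ### Degree, nonvanishing and the case n = 1 -/

lemma aw_natDegree_le (n : ℕ) : (aw P n).natDegree ≤ n := by
  refine (Polynomial.natDegree_C_mul_le _ _).trans ?_
  refine Polynomial.natDegree_sum_le_of_forall_le _ _ fun k hk => ?_
  have hk' := Nat.lt_succ_iff.1 (Finset.mem_range.1 hk)
  refine (Polynomial.natDegree_C_mul_le _ _).trans ((Polynomial.natDegree_prod_le _ _).trans ?_)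
  refine (Finset.sum_le_card_nsmul _ _ 1 fun j _ => ?_).trans (by simpa using hk')
  compute_degree

/-- At Z = t the factor 1 - t/Z kills every term of the series but the first, leaving the
normalization constant. -/
lemma aw_eval_ne_zero (n : ℕ) : (aw P n).eval ((P.t + P.t⁻¹) / 2) ≠ 0 := by
  have ht := t_ne_zero P
  obtain ⟨h1, h2, h3, -⟩ := awDenominator_ne_zero P n
  rw [aw_eval P n ht, Finset.sum_eq_single 0]
  · simp only [awCoeff, phi, qShiftedFactorial, Finset.prod_range_zero, pow_zero]
    simp only [mul_one, div_one, awConst]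
    exact mul_ne_zero (inv_ne_zero (pow_ne_zero n ht)) (mul_ne_zero (mul_ne_zero h1 h2) h3)
  · intro k _ hk
    obtain ⟨k, rfl⟩ := Nat.exists_eq_succ_of_ne_zero hk
    rw [phi, Finset.prod_range_succ']
    simp [ht]
  · simp

lemma aw_one : aw P 1 = Polynomial.C (2 * (1 + P.q ^ 2)) * Polynomial.X := by
  have ht := t_ne_zero P
  have hq := P.q_ne_zero
  have g1 := one_sub_t_I_ne_zero P 0
  have g2 := one_sub_mul_q_pow_ne_zero P 0
  rw [pow_zero, mul_one] at g2
  simp only [pow_zero, mul_one] at g1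
  have e1 : P.t * (-P.t) = P.q := by rw [mul_neg, ← pow_two, P.t_sq, neg_neg]
  have e2 : (1 - P.t * (Complex.I * P.t)) * (1 - P.t * (-(Complex.I * P.t))) = 1 + P.q ^ 2 := by
    linear_combination (-P.t ^ 4) * Complex.I_sq + (P.t ^ 2 - P.q) * P.t_sq
  have e3 : P.t * (-P.t) * (Complex.I * P.t) * (-(Complex.I * P.t)) = -P.q ^ 2 := by
    linear_combination P.t ^ 4 * Complex.I_sq - (P.t ^ 2 - P.q) * P.t_sq
  have e4 : 1 + P.q ^ 2 ≠ 0 := e2 ▸ mul_ne_zero g1.1 g1.2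
  have hA : (P.t)⁻¹ * (qShiftedFactorial (P.t * (-P.t)) P.q 1 *
      qShiftedFactorial (P.t * (Complex.I * P.t)) P.q 1 *
      qShiftedFactorial (P.t * (-(Complex.I * P.t))) P.q 1) = P.t⁻¹ * (1 - P.q) * (1 + P.q ^ 2) := by
    simp only [qShiftedFactorial, Finset.prod_range_one, pow_zero, mul_one, e1]
    rw [← e2]; ring
  have hB : qShiftedFactorial ((P.q ^ 1)⁻¹) P.q 1 *
          qShiftedFactorial (P.q ^ (((1 : ℕ) : ℤ) - 1) * P.t * (-P.t) * (Complex.I * P.t) *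
            (-(Complex.I * P.t))) P.q 1 * P.q ^ 1 /
          (qShiftedFactorial (P.t * (-P.t)) P.q 1 * qShiftedFactorial (P.t * (Complex.I * P.t)) P.q 1 *
            qShiftedFactorial (P.t * (-(Complex.I * P.t))) P.q 1 * qShiftedFactorial P.q P.q 1) =
          -(1 - P.q)⁻¹ := by
    simp only [qShiftedFactorial, Finset.prod_range_one, pow_zero, mul_one, e1]
    rw [Nat.cast_one, sub_self, zpow_zero, one_mul, e3, mul_assoc (1 - P.q), e2, pow_one]
    field_simp
    ring
  rw [aw, askeyWilson, pow_one, hA, Finset.sum_range_succ, Finset.sum_range_one, hB]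
  simp only [Finset.prod_range_zero, Finset.prod_range_one, qShiftedFactorial, pow_zero, mul_one,
    div_one, mul_zero, P.t_sq]
  refine Polynomial.funext fun x => ?_
  simp only [Polynomial.eval_add, Polynomial.eval_sub, Polynomial.eval_neg, Polynomial.eval_one,
    Polynomial.eval_mul, Polynomial.eval_C, Polynomial.eval_X]
  field_simp
  ring

/-! ### The element `ρ₁` -/

lemma RK_RKi (u : A P) : RK P (RKi P u) = u := by
  rw [← ra_mul, kinvD_mul_kD, ra_one, LinearMap.id_apply]

lemma κ_eq : κ P = -P.t * (1 - P.q)⁻¹ := by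
  have ht := t_ne_zero P
  have hq := P.q_ne_zero
  have h1 := one_sub_mul_q_pow_ne_zero P 0
  rw [pow_zero, mul_one] at h1
  have h2 := q_sub_inv_ne_zero P
  rw [κ, div_eq_iff h2]
  field_simp
  linear_combination (P.q - 1) * P.t_sq

lemma db (u : A P) : gd * (gb * u) = -P.t⁻¹ • (gb * (gd * u)) := by
  rw [← mul_assoc, ← mul_assoc, (gen_rep P).bd, smul_mul_assoc, smul_smul, neg_mul_neg,
    inv_mul_cancel₀ (t_ne_zero P), one_smul]

lemma dc (u : A P) : gd * (gc * u) = -P.t⁻¹ • (gc * (gd * u)) := by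
  rw [← mul_assoc, ← mul_assoc, (gen_rep P).cd, smul_mul_assoc, smul_smul, neg_mul_neg,
    inv_mul_cancel₀ (t_ne_zero P), one_smul]

/-- x_{αβ} acts as a twisted derivation: the k in fk cancels the k⁻¹ in the coproduct of f, so the
second term contains u itself. -/
lemma RX_gen_mul (α β : ℂ) (u : A P) :
    RX P α β (ga * u) = P.t • (ga * RX P α β u) + (α * κ P) • (gc * u) ∧
    RX P α β (gb * u) = -P.t • (gb * RX P α β u) + (α * κ P) • (gd * u) ∧
    RX P α β (gc * u) = P.t⁻¹ • (gc * RX P α β u) + (β * P.t) • (ga * u) ∧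
    RX P α β (gd * u) = -P.t⁻¹ • (gd * RX P α β u) + (β * P.t) • (gb * u) := by
  obtain ⟨⟨e1, e2, e3, e4, -⟩, ⟨f1, f2, f3, f4, -⟩, -⟩ := translate_mul P u
  obtain ⟨-, -, ⟨k1, k2, k3, k4, -⟩, -⟩ := translate_mul P (RF P u)
  obtain ⟨-, -, ⟨l1, l2, -⟩, -⟩ := translate_mul P (RKi P u)
  simp only [RX, LinearMap.add_apply, LinearMap.smul_apply, LinearMap.comp_apply, e1, e2, e3, e4,
    f1, f2, f3, f4, map_add, map_sub, map_neg, k1, k2, k3, k4, l1, l2, RK_RKi, mul_add,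
    mul_smul_comm]
  refine ⟨?_, ?_, ?_, ?_⟩ <;> module

lemma LX_gen_mul (α β : ℂ) (u : A P) :
    LX P α β (ga * u) = P.t • (ga * LX P α β u) + (β * P.t) • (gb * parity P u) ∧
    LX P α β (gb * u) = -P.t⁻¹ • (gb * LX P α β u) + (α * κ P) • (ga * parity P u) ∧
    LX P α β (gc * u) = P.t • (gc * LX P α β u) + (β * P.t) • (gd * parity P u) ∧
    LX P α β (gd * u) = -P.t⁻¹ • (gd * LX P α β u) + (α * κ P) • (gc * parity P u) := by
  obtain ⟨-, -, -, -, ⟨e1, e2, e3, e4, -⟩, -, ⟨k1, k2, k3, k4, -⟩, -⟩ := translate_mul P u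
  obtain ⟨-, -, -, -, -, ⟨f1, f2, f3, f4, -⟩, -⟩ := translate_mul P (LK P u)
  simp only [LX, LinearMap.add_apply, LinearMap.smul_apply, LinearMap.comp_apply, e1, e2, e3, e4,
    k1, k2, k3, k4, map_smul, f1, f2, f3, f4, LKi_LK, mul_add, mul_smul_comm]
  refine ⟨?_, ?_, ?_, ?_⟩ <;> module

/-- The even part of `ρ₁ = r σ`. -/
def rhoEven (α β α' β' : ℂ) : A P :=
  ga ^ 2 - (α'⁻¹ * β' * P.t * (1 - P.q)) • gb ^ 2
    + (α * β⁻¹ * P.t * (1 - P.q)⁻¹) • gc ^ 2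
    - (α * β⁻¹ * α'⁻¹ * β' * P.q) • gd ^ 2

lemma rhoOne_eq (α β α' β' : ℂ) : rhoOne P α β α' β' = rhoEven P α β α' β' * gσ := rfl

section invariance
variable {P} {α β α' β' : ℂ} {u : A P}

lemma rhoEven_mul (u : A P) : rhoEven P α β α' β' * u = ga * (ga * u)
    - (α'⁻¹ * β' * P.t * (1 - P.q)) • (gb * (gb * u))
    + (α * β⁻¹ * P.t * (1 - P.q)⁻¹) • (gc * (gc * u))
    - (α * β⁻¹ * α'⁻¹ * β' * P.q) • (gd * (gd * u)) := by
  simp only [rhoEven, add_mul, sub_mul, smul_mul_assoc, pow_two, mul_assoc]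

/-- Once `RX` kills u, the terms a² and c² both yield multiples of ac u, and b² and d² both yield
multiples of bd u. The coefficients of ρ₁ make each pair cancel. -/
lemma RX_rhoEven_mul (hβ : β ≠ 0) (hu : RX P α β u = 0) :
    RX P α β (rhoEven P α β α' β' * u) = 0 := by
  have ht := t_ne_zero P
  have h1 := one_sub_mul_q_pow_ne_zero P 0
  rw [pow_zero, mul_one] at h1
  obtain ⟨a1, b1, c1, d1⟩ := RX_gen_mul P α β u
  rw [hu] at a1 b1 c1 d1
  simp only [mul_zero, smul_zero, zero_add] at a1 b1 c1 d1
  rw [rhoEven_mul, map_sub, map_add, map_sub, map_smul, map_smul, map_smul,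
    (RX_gen_mul P α β _).1, (RX_gen_mul P α β _).2.1, (RX_gen_mul P α β _).2.2.1,
    (RX_gen_mul P α β _).2.2.2, a1, b1, c1, d1]
  simp only [mul_smul_comm, ca, db, κ_eq]
  match_scalars
  · field_simp
    ring
  · field_simp
    linear_combination (-(P.t ^ 2 + 1) * (β' * α * α'⁻¹)) * P.t_sq

/-- The same with other pairs: a² with b², giving ab, and c² with d², giving cd. -/
lemma LX_rhoEven_mul (hα' : α' ≠ 0) (hu : LX P α' β' u = 0) :
    LX P α' β' (rhoEven P α β α' β' * u) = 0 := by
  have ht := t_ne_zero P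
  have h1 := one_sub_mul_q_pow_ne_zero P 0
  rw [pow_zero, mul_one] at h1
  obtain ⟨a1, b1, c1, d1⟩ := LX_gen_mul P α' β' u
  rw [hu] at a1 b1 c1 d1
  simp only [mul_zero, smul_zero, zero_add] at a1 b1 c1 d1
  rw [rhoEven_mul, map_sub, map_add, map_sub, map_smul, map_smul, map_smul,
    (LX_gen_mul P α' β' _).1, (LX_gen_mul P α' β' _).2.1, (LX_gen_mul P α' β' _).2.2.1,
    (LX_gen_mul P α' β' _).2.2.2, a1, b1, c1, d1]
  simp only [map_mul, parity_a, parity_b, parity_c, parity_d, mul_smul_comm, neg_mul, mul_neg, ba,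
    dc, κ_eq]
  match_scalars
  · field_simp
    ring
  · field_simp
    linear_combination ((P.t ^ 2 + 1) * (α * β' * β⁻¹)) * P.t_sq

lemma RX_rhoOne_mul (hβ : β ≠ 0) (hu : RX P α β u = 0) :
    RX P α β (rhoOne P α β α' β' * u) = 0 := by
  rw [rhoOne_eq, mul_assoc]
  exact RX_rhoEven_mul hβ (by rw [RX_σ, hu, mul_zero, neg_zero])

lemma LX_rhoOne_mul (hα' : α' ≠ 0) (hu : LX P α' β' u = 0) :
    LX P α' β' (rhoOne P α β α' β' * u) = 0 := by
  rw [rhoOne_eq, mul_assoc]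
  exact LX_rhoEven_mul hα' (by rw [LX_σ, hu, mul_zero, neg_zero])

lemma RX_one : RX P α β 1 = 0 := by simp [RX]

lemma LX_one : LX P α β 1 = 0 := by simp [LX]

/-- The kernel of an operator that contains `1` and is stable under multiplication by `x` contains
all polynomials in `x`. -/
lemma map_aeval_eq_zero {T : A P →ₗ[ℂ] A P} {x : A P} (h1 : T 1 = 0)
    (hx : ∀ u, T u = 0 → T (x * u) = 0) (p : Polynomial ℂ) : T (Polynomial.aeval x p) = 0 := by
  have h : ∀ k : ℕ, T (x ^ k) = 0 := by
    intro k
    induction k with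
    | zero => rw [pow_zero, h1]
    | succ k ih => rw [pow_succ']; exact hx _ ih
  rw [Polynomial.aeval_eq_sum_range, map_sum]
  exact Finset.sum_eq_zero fun k _ => by rw [map_smul, h, smul_zero]

lemma RX_aeval (hβ : β ≠ 0) (c : ℂ) (p : Polynomial ℂ) :
    RX P α β (Polynomial.aeval (c • rhoOne P α β α' β') p) = 0 :=
  map_aeval_eq_zero RX_one
    (fun u hu => by rw [smul_mul_assoc, map_smul, RX_rhoOne_mul hβ hu, smul_zero]) p

lemma LX_aeval (hα' : α' ≠ 0) (c : ℂ) (p : Polynomial ℂ) :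
    LX P α' β' (Polynomial.aeval (c • rhoOne P α β α' β') p) = 0 :=
  map_aeval_eq_zero LX_one
    (fun u hu => by rw [smul_mul_assoc, map_smul, LX_rhoOne_mul hα' hu, smul_zero]) p

end invariance

section decomposition
variable {P} (α β α' β' : ℂ)

lemma rhoEven_pow_mem_words (k : ℕ) : rhoEven P α β α' β' ^ k ∈ words P (2 * k) := by
  induction k with
  | zero => rw [pow_zero]; exact one_mem_words P
  | succ k ih =>
    obtain ⟨h1, h2, h3, h4⟩ := mul_mem_words ih
    rw [pow_succ', rhoEven_mul]
    exact sub_mem (add_mem (sub_mem (mul_mem_words h1).1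
      (Submodule.smul_mem _ _ (mul_mem_words h2).2.1))
      (Submodule.smul_mem _ _ (mul_mem_words h3).2.2.1))
      (Submodule.smul_mem _ _ (mul_mem_words h4).2.2.2)

/-- The quadratic part of ρ₁ is even, hence commutes with σ, and its k-th power consists of words of
length 2k. This makes the decomposition of words applicable. -/
lemma rhoOne_pow (k : ℕ) : rhoOne P α β α' β' ^ k = gσ ^ k * rhoEven P α β α' β' ^ k := by
  have h : Commute gσ (rhoEven P α β α' β') := by
    rw [Commute, SemiconjBy, σ_mul]
    congr 1
    simp [rhoEven]
  rw [rhoOne_eq, ← h.eq, h.mul_pow]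

lemma aeval_rhoOne_eq_sum (c : ℂ) {n : ℕ} {p : Polynomial ℂ} (hp : p.natDegree ≤ n) :
    ∃ v : ℕ → A P, (∀ k, v k ∈ M P (2 * k) k) ∧
      Polynomial.aeval (c • rhoOne P α β α' β') p = ∑ k ∈ Finset.range (n + 1), v k := by
  choose v hv hs using fun k => exists_sum_of_mem_words P k _ (rhoEven_pow_mem_words α β α' β' k)
  -- The component in M_j σ^j collects the contributions of all powers k ≥ j.
  refine ⟨fun j => ∑ k ∈ Finset.range (n + 1), if j ≤ k then (p.coeff k * c ^ k) • v k j else 0,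
    fun j => sum_mem fun k _ => ?_, ?_⟩
  · split_ifs
    · exact Submodule.smul_mem _ _ (hv k j)
    · exact zero_mem _
  · rw [Polynomial.aeval_eq_sum_range' (Nat.lt_succ_of_le hp), Finset.sum_comm]
    refine Finset.sum_congr rfl fun k hk => ?_
    have hk' := Finset.mem_range.1 hk
    rw [smul_pow, rhoOne_pow, hs, smul_smul, Finset.smul_sum, ← Finset.sum_filter]
    refine Finset.sum_congr ?_ fun _ _ => rfl
    ext j
    simp only [Finset.mem_range, Finset.mem_filter]
    omega

/-- Stability of each summand is what lets invariance of a sum pass to its components. -/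
lemma RX_mem_M {n : ℕ} {u : A P} (hu : u ∈ M P (2 * n) n) : RX P α β u ∈ M P (2 * n) n := by
  rw [M_eq] at hu ⊢
  obtain ⟨_, ⟨C, rfl⟩, rfl⟩ := hu
  rw [LinearMap.mulLeft_apply, RX_σ_pow, RX_el]
  exact Submodule.smul_mem _ _ ⟨_, ⟨_, rfl⟩, rfl⟩

lemma LX_mem_M {n : ℕ} {u : A P} (hu : u ∈ M P (2 * n) n) : LX P α β u ∈ M P (2 * n) n := by
  rw [M_eq] at hu ⊢
  obtain ⟨_, ⟨C, rfl⟩, rfl⟩ := hu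
  rw [LinearMap.mulLeft_apply, LX_σ_pow, LX_el]
  exact Submodule.smul_mem _ _ ⟨_, ⟨_, rfl⟩, rfl⟩

/-- The sum of the spaces `M_k σ^k` is direct. -/
lemma eq_zero_of_sum_M {v : ℕ → A P} (hv : ∀ k, v k ∈ M P (2 * k) k) {s : Finset ℕ}
    (hs : ∑ k ∈ s, v k = 0) : ∀ k ∈ s, v k = 0 :=
  eq_zero_of_sum_eigenvectors (casimir P) (fun k => chi P k ^ 2) v (fun k => casimir_M P (hv k)) s
    (fun _ _ _ _ h => chi_sq_inj P h) hs

/-- The coefficients of a spherical element of `M_n σ^n`. -/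
lemma exists_el_of_spherical {n : ℕ} {u : A P} (hu : u ∈ M P (2 * n) n) (hR : RX P α β u = 0)
    (hL : LX P α' β' u = 0) : ∃ C, u = gσ ^ n * el P (2 * n) C ∧
      RX P α β (el P (2 * n) C) = 0 ∧ LX P α' β' (el P (2 * n) C) = 0 := by
  rw [M_eq] at hu
  obtain ⟨_, ⟨C, rfl⟩, rfl⟩ := hu
  rw [LinearMap.mulLeft_apply] at *
  refine ⟨C, rfl, ?_, ?_⟩
  · rw [RX_σ_pow, smul_eq_zero_iff_right (pow_ne_zero _ (by norm_num))] at hR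
    rw [← σ_pow_σ_pow P n (RX P α β _), hR, mul_zero]
  · rw [LX_σ_pow, smul_eq_zero_iff_right (pow_ne_zero _ (by norm_num))] at hL
    rw [← σ_pow_σ_pow P n (LX P α' β' _), hL, mul_zero]

end decomposition

/-! ### The `q`-difference operator on a geometric progression -/

lemma q_zpow_ne_one {m : ℤ} (hm : m ≠ 0) : P.q ^ m ≠ 1 := by
  intro h
  rcases Int.natAbs_eq m with e | e
  · rw [e, zpow_natCast] at h
    exact P.q_pow_ne_one _ (by omega) h
  · rw [e, zpow_neg, zpow_natCast, inv_eq_one] at h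
    exact P.q_pow_ne_one _ (by omega) h

lemma q_zpow_ne_neg_one (m : ℤ) : P.q ^ m ≠ -1 := by
  intro h
  rcases Int.natAbs_eq m with e | e
  · rw [e, zpow_natCast] at h
    exact q_pow_ne_neg_one P _ h
  · rw [e, zpow_neg, zpow_natCast, inv_eq_iff_eq_inv] at h
    exact q_pow_ne_neg_one P _ (h.trans (by norm_num))

/-- The points `i q^m`, `m ∈ ℤ`. -/
def node (m : ℤ) : ℂ := Complex.I * P.q ^ m

lemma node_ne_zero (m : ℤ) : node P m ≠ 0 :=
  mul_ne_zero Complex.I_ne_zero (zpow_ne_zero _ P.q_ne_zero)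

lemma node_sq (m : ℤ) : node P m ^ 2 = -P.q ^ (2 * m) := by
  rw [node, mul_pow, Complex.I_sq, neg_one_mul, mul_comm, zpow_mul, zpow_ofNat]

lemma node_sq_ne_one (m : ℤ) : 1 - node P m ^ 2 ≠ 0 := by
  rw [node_sq]
  intro h
  exact q_zpow_ne_neg_one P (2 * m) (by linear_combination h)

/-- t² times the square of the node is q^{2m+1}, and an odd power of q is never 1. The second case
reduces to q^{2m-1} ≠ 1. -/
lemma one_sub_t_node_ne_zero (m : ℤ) :
    1 - P.t * node P m ≠ 0 ∧ 1 - P.t * (node P m)⁻¹ ≠ 0 := by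
  have hq := P.q_ne_zero
  have hn := node_ne_zero P m
  have hs := node_sq P m
  constructor
  · intro h
    apply q_zpow_ne_one P (m := 2 * m + 1) (by omega)
    rw [zpow_add_one₀ hq]
    linear_combination (P.t * node P m + 1) * (-h) - node P m ^ 2 * P.t_sq + P.q * hs
  · intro h
    apply q_zpow_ne_one P (m := 2 * m - 1) (by omega)
    have h1 : node P m = P.t := by
      rw [sub_eq_zero, eq_comm, ← div_eq_mul_inv, div_eq_one_iff_eq hn] at h
      exact h.symm
    rw [h1, P.t_sq, neg_inj] at hs
    rw [zpow_sub_one₀ hq, ← hs, mul_inv_cancel₀ hq]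

lemma q_mul_node (m : ℤ) : P.q * node P m = node P (m + 1) := by
  rw [node, node, zpow_add_one₀ P.q_ne_zero]; ring

lemma q_inv_mul_node (m : ℤ) : P.q⁻¹ * node P m = node P (m - 1) := by
  rw [node, node, zpow_sub_one₀ P.q_ne_zero]; ring

lemma node_range_infinite : (Set.range (node P)).Infinite := by
  refine Set.infinite_range_of_injective fun m n h => ?_
  have h1 : P.q ^ m = P.q ^ n := mul_left_cancel₀ Complex.I_ne_zero h
  by_contra hmn
  refine q_zpow_ne_one P (sub_ne_zero.2 hmn) ?_
  rw [zpow_sub₀ P.q_ne_zero, h1, div_self (zpow_ne_zero _ P.q_ne_zero)]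

/-- The `q`-difference operator on functions on the points `i q^m`. -/
def qDifference : (ℤ → ℂ) →ₗ[ℂ] (ℤ → ℂ) where
  toFun g m := ((1 + P.q * node P m ^ 2) * g (m + 1) - (node P m ^ 2 + P.q) * g (m - 1)) /
    (1 - node P m ^ 2)
  map_add' g h := by ext m; simp only [Pi.add_apply]; ring
  map_smul' r g := by ext m; simp only [Pi.smul_apply, smul_eq_mul, RingHom.id_apply]; ring

lemma qDifference_eq {F : ℂ → ℂ} {μ : ℂ}
    (h : ∀ m, (1 + P.q * node P m ^ 2) * F (P.q * node P m) -
      (node P m ^ 2 + P.q) * F (P.q⁻¹ * node P m) = μ * ((1 - node P m ^ 2) * F (node P m))) :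
    qDifference P (fun m => F (node P m)) = μ • fun m => F (node P m) := by
  ext m
  change (_ * F (node P (m + 1)) - _ * F (node P (m - 1))) / _ = μ * F (node P m)
  rw [← q_mul_node, ← q_inv_mul_node, h m]
  have := node_sq_ne_one P m
  field_simp

/-- Eigenfunctions of the `q`-difference operator that sum up to an Askey–Wilson polynomial of
degree `n` vanish in degrees less than `n`. -/
lemma laurent_eq_zero_of_sum {n : ℕ} {G : ℕ → ℕ → ℂ}
    (hG : ∀ k, ∀ l < k, G k (l + 1) *
        (P.q ^ ((k : ℤ) - 2 * l - 1) - P.q ^ (2 * (l : ℤ) + 2 - k) + chi P k) +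
      G k l * (P.q ^ ((k : ℤ) - 2 * l) - P.q ^ (2 * (l : ℤ) + 1 - k) - chi P k) = 0)
    (hs : ∀ Z, Z ≠ 0 →
      ∑ k ∈ Finset.range (n + 1), laurent k (G k) Z = (aw P n).eval ((Z + Z⁻¹) / 2))
    {k : ℕ} (hk : k < n) : G k 0 = 0 := by
  set E : ℤ → ℂ := fun m => (aw P n).eval ((node P m + (node P m)⁻¹) / 2) with hE
  have hDE : qDifference P E = chi P n • E := by
    refine qDifference_eq P (F := fun Z => (aw P n).eval ((Z + Z⁻¹) / 2)) fun m => ?_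
    exact aw_difference P n (node_ne_zero P m) (one_sub_t_node_ne_zero P m).1
      (one_sub_t_node_ne_zero P m).2
  have hDG : ∀ j, qDifference P (fun m => laurent j (G j) (node P m)) =
      chi P j • fun m => laurent j (G j) (node P m) := fun j =>
    qDifference_eq P fun m => laurent_difference P (hG j) (node_ne_zero P m)
  -- Subtracting the Askey–Wilson values from the n-th term keeps it in the χ_n-eigenspace and makes
  -- the total sum zero, so every term vanishes on the nodes.
  have key := eq_zero_of_sum_eigenvectors (qDifference P) (chi P)
    (fun j => (fun m => laurent j (G j) (node P m)) - if j = n then E else 0)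
    (fun j => by
      by_cases hj : j = n
      · subst hj
        rw [if_pos rfl, map_sub, hDE, hDG, smul_sub]
      · rw [if_neg hj, sub_zero, hDG])
    (Finset.range (n + 1)) (fun i _ j _ h => chi_sq_inj P (by rw [h]))
    (by
      rw [Finset.sum_sub_distrib, Finset.sum_ite_eq' (Finset.range (n + 1)) n,
        if_pos (Finset.self_mem_range_succ n), sub_eq_zero]
      ext m
      rw [Finset.sum_apply]
      exact hs _ (node_ne_zero P m)) k (Finset.mem_range.2 (by omega))
  rw [if_neg (by omega), sub_zero] at key
  refine laurent_leading (node_range_infinite P) ?_ (n := k) ?_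
  · rintro _ ⟨m, rfl⟩
    exact node_ne_zero P m
  · rintro _ ⟨m, rfl⟩
    exact congrFun key m

/-! ### The spherical functions -/

section spherical
variable {P} {α β α' β' : ℂ}

/-- On the torus ρ₁ is z² - q z⁻²; with z² = tZ and -q = t² this is t(Z + Z⁻¹). This explains the
scaling by 1/(2t). -/
lemma torus_rhoOne (hv : α'⁻¹ * β' * α * β⁻¹ = 1) {z Z : ℂ} (hz : z ≠ 0) (hZ : z ^ 2 = P.t * Z) :
    torus P hz ((2 * P.t)⁻¹ • rhoOne P α β α' β') = (Z + Z⁻¹) / 2 := by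
  have ht := t_ne_zero P
  have hZ0 : Z ≠ 0 := by
    rintro rfl
    exact hz (pow_eq_zero_iff two_ne_zero |>.1 (by rw [hZ, mul_zero]))
  have hD : α * β⁻¹ * α'⁻¹ * β' * P.q = P.q := by linear_combination P.q * hv
  simp only [rhoOne, hD, map_smul, map_mul, map_add, map_sub, map_pow, torus_a, torus_b, torus_c,
    torus_d, torus_σ, smul_eq_mul, inv_pow, hZ]
  rw [q_eq]
  field_simp
  ring

lemma torus_aeval (hv : α'⁻¹ * β' * α * β⁻¹ = 1) (p : Polynomial ℂ) {z Z : ℂ} (hz : z ≠ 0)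
    (hZ : z ^ 2 = P.t * Z) :
    torus P hz (Polynomial.aeval ((2 * P.t)⁻¹ • rhoOne P α β α' β') p) =
      p.eval ((Z + Z⁻¹) / 2) := by
  rw [← Polynomial.aeval_algHom_apply, torus_rhoOne hv hz hZ, Polynomial.coe_aeval_eq_eval]

lemma aeval_aw_ne_zero (hv : α'⁻¹ * β' * α * β⁻¹ = 1) (n : ℕ) :
    Polynomial.aeval ((2 * P.t)⁻¹ • rhoOne P α β α' β') (aw P n) ≠ 0 := by
  intro h
  have := torus_aeval hv (aw P n) (t_ne_zero P) (pow_two P.t)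
  rw [h, map_zero] at this
  exact aw_eval_ne_zero P n this.symm

lemma aeval_aw_mem_M (hβ : β ≠ 0) (hα' : α' ≠ 0) (hv : α'⁻¹ * β' * α * β⁻¹ = 1) (n : ℕ) :
    Polynomial.aeval ((2 * P.t)⁻¹ • rhoOne P α β α' β') (aw P n) ∈ M P (2 * n) n := by
  have ht := t_ne_zero P
  obtain ⟨v, hvM, hsum⟩ := aeval_rhoOne_eq_sum (P := P) α β α' β' (2 * P.t)⁻¹
    (aw_natDegree_le P n)
  have hR := RX_aeval (P := P) (α := α) (α' := α') (β' := β') hβ (2 * P.t)⁻¹ (aw P n)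
  have hL := LX_aeval (P := P) (α := α) (β := β) (β' := β') hα' (2 * P.t)⁻¹ (aw P n)
  rw [hsum, map_sum] at hR hL
  have hR' := eq_zero_of_sum_M (fun k => RX_mem_M α β (hvM k)) hR
  have hL' := eq_zero_of_sum_M (fun k => LX_mem_M α' β' (hvM k)) hL
  have hC : ∀ k, ∃ C, (k ∈ Finset.range (n + 1) → v k = gσ ^ k * el P (2 * k) C) ∧
      RX P α β (el P (2 * k) C) = 0 ∧ LX P α' β' (el P (2 * k) C) = 0 := by
    intro k
    by_cases hk : k ∈ Finset.range (n + 1)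
    · obtain ⟨C, h1, h2, h3⟩ := exists_el_of_spherical α β α' β' (hvM k) (hR' k hk) (hL' k hk)
      exact ⟨C, fun _ => h1, h2, h3⟩
    -- Outside the range of summation nothing is known about v k, so the zero coefficients serve as
    -- a default.
    · exact ⟨0, fun h => absurd h hk, by simp, by simp⟩
  choose C hC hCR hCL using hC
  have key : ∀ k < n, v k = 0 := by
    intro k hk
    have h0 := laurent_eq_zero_of_sum P (n := n) (G := fun k => torusCoeff P k (C k))
      (fun k l hl => torusCoeff_succ hβ hα' hv (hCR k) (hCL k) hl)
      (fun Z hZ => by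
        -- Any nonzero Z is reached from a torus point z by a square root of tZ.
        obtain ⟨z, hz⟩ := IsAlgClosed.exists_pow_nat_eq (P.t * Z) (n := 2) (by norm_num)
        have hz0 : z ≠ 0 := by
          rintro rfl
          exact mul_ne_zero ht hZ (by rw [← hz]; norm_num)
        rw [← torus_aeval hv _ hz0 hz, hsum, map_sum]
        refine Finset.sum_congr rfl fun k hk => ?_
        rw [hC k hk, map_mul, map_pow, torus_σ, one_pow, one_mul,
          torus_spherical hβ (hCR k) hz0 hz]) hk
    have h00 : C k 0 0 = 0 := by
      simpa [torusCoeff, fval_ne_zero, ht] using h0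
    rw [hC k (Finset.mem_range.2 (by omega)), spherical_eq_zero hβ hα' (hCR k) (hCL k) h00, mul_zero]
  rw [hsum, Finset.sum_range_succ, Finset.sum_eq_zero fun k hk => key k (Finset.mem_range.1 hk),
    zero_add]
  exact hvM n

lemma sphericalFunctions_eq_span (hβ : β ≠ 0) (hα' : α' ≠ 0) {n : ℕ} {p : A P}
    (hp : p ≠ 0) (hpM : p ∈ M P (2 * n) n) (hR : RX P α β p = 0) (hL : LX P α' β' p = 0) :
    sphericalFunctions P (xElt P α β) (xElt P α' β') (M P (2 * n) n) = Submodule.span ℂ {p} := by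
  ext u
  rw [mem_sphericalFunctions, Submodule.mem_span_singleton]
  constructor
  · rintro ⟨huM, huR, huL⟩
    obtain ⟨B, rfl, hBR, hBL⟩ := exists_el_of_spherical α β α' β' huM huR huL
    obtain ⟨C, rfl, hCR, hCL⟩ := exists_el_of_spherical α β α' β' hpM hR hL
    have h0 : C 0 0 ≠ 0 := fun h => hp (by rw [spherical_eq_zero hβ hα' hCR hCL h, mul_zero])
    -- The multiple is forced by the corner coefficients: the difference has corner zero and so
    -- vanishes.
    refine ⟨B 0 0 / C 0 0, ?_⟩
    have e : el P (2 * n) (B - (B 0 0 / C 0 0) • C) = 0 := by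
      refine spherical_eq_zero (α := α) (β' := β') hβ hα' ?_ ?_ ?_
      · rw [map_sub, map_smul, map_sub, map_smul, hBR, hCR, smul_zero, sub_zero]
      · rw [map_sub, map_smul, map_sub, map_smul, hBL, hCL, smul_zero, sub_zero]
      · simp [h0]
    rw [map_sub, map_smul, sub_eq_zero] at e
    rw [e, mul_smul_comm]
  · rintro ⟨c, rfl⟩
    exact ⟨Submodule.smul_mem _ _ hpM, by rw [map_smul, hR, smul_zero],
      by rw [map_smul, hL, smul_zero]⟩

end spherical

end QuantumOSp
end

theorem mainTheorem7 (P : QuantumParameter) (α β α' β' : ℂ)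
    (hα : α ≠ 0) (hβ : β ≠ 0) (hα' : α' ≠ 0) (hβ' : β' ≠ 0)
    (hv : α'⁻¹ * β' * α * β⁻¹ = 1) :
    QuantumOSp.sphericalFunctions P (QuantumOSp.xElt P α β) (QuantumOSp.xElt P α' β')
        (QuantumOSp.M P 2 1) =
      Submodule.span ℂ {QuantumOSp.rhoOne P α β α' β'} ∧
    ∀ n : ℕ,
      Polynomial.aeval ((2 * P.t)⁻¹ • QuantumOSp.rhoOne P α β α' β')
          (askeyWilson n P.t (-P.t) (Complex.I * P.t) (-(Complex.I * P.t)) P.q) ≠ 0 ∧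
      QuantumOSp.sphericalFunctions P (QuantumOSp.xElt P α β) (QuantumOSp.xElt P α' β')
          (QuantumOSp.M P (2 * n) n) =
        Submodule.span ℂ
          {Polynomial.aeval ((2 * P.t)⁻¹ • QuantumOSp.rhoOne P α β α' β')
            (askeyWilson n P.t (-P.t) (Complex.I * P.t) (-(Complex.I * P.t)) P.q)} := by
  have h : ∀ n, QuantumOSp.sphericalFunctions P (QuantumOSp.xElt P α β) (QuantumOSp.xElt P α' β')
      (QuantumOSp.M P (2 * n) n) = Submodule.span ℂ {Polynomial.aeval
        ((2 * P.t)⁻¹ • QuantumOSp.rhoOne P α β α' β') (QuantumOSp.aw P n)} := fun n =>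
    QuantumOSp.sphericalFunctions_eq_span hβ hα' (QuantumOSp.aeval_aw_ne_zero hv n)
      (QuantumOSp.aeval_aw_mem_M hβ hα' hv n) (QuantumOSp.RX_aeval hβ _ _)
      (QuantumOSp.LX_aeval hα' _ _)
  refine ⟨?_, fun n => ⟨QuantumOSp.aeval_aw_ne_zero hv n, h n⟩⟩
  -- By `aw_one`, p_1(ρ₁/2t) is this constant times ρ₁, so the case n = 1 gives the statement about
  -- ρ₁ itself once the constant is nonzero.
  have hc : 2 * (1 + P.q ^ 2) * (2 * P.t)⁻¹ ≠ 0 := by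
    refine mul_ne_zero (mul_ne_zero two_ne_zero fun h0 => ?_)
      (inv_ne_zero (mul_ne_zero two_ne_zero (QuantumOSp.t_ne_zero P)))
    exact QuantumOSp.q_pow_ne_neg_one P 2 (by linear_combination h0)
  refine (h 1).trans ?_
  rw [QuantumOSp.aw_one, map_mul, Polynomial.aeval_C, Polynomial.aeval_X, ← Algebra.smul_def,
    smul_smul]
  exact Submodule.span_singleton_smul_eq (IsUnit.mk0 _ hc) _
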